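/- For an integer $n\ge 1$ let $M(n)=|\{ij : 1\le i,j\le n\}|$ be the number of distinct entries of the $n\times n$ multiplication table, let $\delta(n)$ be the number of elements of $\{n,2n,\dots,n^2\}$ that appear in the $(n-1)\times(n-1)$ multiplication table (so that $M(n)=M(n-1)+n-\delta(n)$), and let $$L(n)=\exp\left(\sqrt{\log n\,\log\log n}\right).$$ The model of computation is a random access machine with word size $\Theta(\log n)$ bits on input $n$, in which each arithmetic operation, comparison and memory access takes one unit of time. Consider the following two algorithms, in which $A$ is a bit vector. * Algorithm 1 (computing $\delta(n)$). The input is the list $[d_0,n/d_0],[d_1,n/d_1],\dots$ of the pairs with $d_0=1<d_1<\dots<d_{\ell-1}$ the divisors of $n$ that are at most $\sqrt n$. Set all bits of $A$ to $0$; for $1\le i<d_{\ell-1}$, let $d_k$ be the least $d_r$ with $d_r>i$ and set $A[ij]=1$ for all $j$ with $i\le j<n/d_k$. Return the Hamming weight of $A$. * Algorithm 2 (computing $\delta(mq)$ given $\delta(mp)$, for primes $p<q$). The input is the bit vector $A$, of length $mq$, that marks the products $ij$ with $0<i<g$, $0<j<mp/g$ for some divisor $g$ of $mp$; its Hamming weight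 $w$; and the lists of the pairs $[d,mp/d]$ and $[d,mq/d]$, where $d$ runs through the divisors $1=d_0<d_1<\dots<d_{\ell-1}=m$ of $m$. For $1\le i<m$, let $d_k$ be the least $d_r$ with $d_r>i$; for all $j$ with $mp/d_k\le j<mq/d_k$, if $A[ij]=0$ then set $A[ij]=1$ and increase $w$ by $1$. Return $w$. Theorem. Algorithms 1 and 2 may be combined to tabulate $M(k)$ for all $k\le n$ in time $$O\left(n^2/L(n)^{1/\sqrt2+o(1)}\right)\qquad (n\to\infty).$$ That is, there is a single program for this machine, calling Algorithms 1 and 2 as subroutines, which for each input $n\ge1$ halts within this time with $M(1),\dots,M(n)$ stored in memory, and in whose run each $\delta(k)$, $1\le k\le n$, is correctly computed by a call of Algorithm 1 or Algorithm 2 on an input for $\delta(k)$ as described above (with $k=n$ in Algorithm 1, $k=mq$ in Algorithm 2); the running time includes the time spent in the calls. -/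

import Mathlib

open Filter Asymptotics Topology

/-! ## The arithmetic functions -/

/-- The set of distinct products in the `n × n` multiplication table. -/
def multTable (n : ℕ) : Finset ℕ :=
  (Finset.Icc 1 n ×ˢ Finset.Icc 1 n).image fun x => x.1 * x.2

/-- `M(n) = |{i j : 1 ≤ i, j ≤ n}|`. -/
def tableCount (n : ℕ) : ℕ := (multTable n).card

/-- `δ(n)`: the number of elements of `{m n : 1 ≤ m ≤ n}` that appear in the
`(n - 1) × (n - 1)` multiplication table. -/
def deltaCount (n : ℕ) : ℕ :=
  (((Finset.Icc 1 n).image fun m => m * n) ∩ multTable (n - 1)).card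

/-- `L(n) = exp (√(log n · log log n))`. -/
noncomputable def subexpL (n : ℕ) : ℝ :=
  Real.exp (Real.sqrt (Real.log n * Real.log (Real.log n)))

/-! ## The machine: a unit-cost word RAM, programmed in structured form

A program uses finitely many registers and finitely many arrays.  Registers and array cells hold
`w`-bit words, and array cells are addressed directly by words. -/

/-- Registers: the input, the registers of the two algorithms below, and scratch registers. -/
inductive Var where
  | input | i | j | k | t | len | weight
  | tmp (a : ℕ)
  deriving DecidableEq

/-- Arrays: the output array, the arrays of the two algorithms below, and scratch arrays. -/
inductive Arr where
  | out | bits | fst | snd | fst' | snd'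
  | tmp (a : ℕ)
  deriving DecidableEq

/-- The contents of all registers and of the memory. -/
structure State where
  var : Var → ℕ
  arr : Arr → ℕ → ℕ

/-- The basic operations on words.  A comparison returns `1` for true and `0` for false. -/
inductive Op where
  | add | sub | mul | div | mod | lt | eq

/-- The result of a basic operation on `w`-bit words: sums and products are reduced modulo `2 ^ w`,
subtraction is truncated at `0`. -/
def Op.eval (w : ℕ) : Op → ℕ → ℕ → ℕ
  | .add, a, b => (a + b) % 2 ^ w
  | .sub, a, b => a - b
  | .mul, a, b => (a * b) % 2 ^ w
  | .div, a, b => a / b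
  | .mod, a, b => a % b
  | .lt, a, b => if a < b then 1 else 0
  | .eq, a, b => if a = b then 1 else 0

/-- Expressions: constants, registers, memory access, basic operations. -/
inductive Expr where
  | const (a : ℕ)
  | var (x : Var)
  | read (a : Arr) (idx : Expr)
  | bin (op : Op) (e f : Expr)

/-- The value of an expression, with word size `w`. -/
def Expr.eval (w : ℕ) (s : State) : Expr → ℕ
  | .const a => a % 2 ^ w
  | .var x => s.var x
  | .read a idx => s.arr a (idx.eval w s)
  | .bin op e f => op.eval w (e.eval w s) (f.eval w s)

/-- Evaluating an expression costs one unit of time for each constant, register access, memory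
access and basic operation in it. -/
def Expr.cost : Expr → ℕ
  | .const _ => 1
  | .var _ => 1
  | .read _ idx => idx.cost + 1
  | .bin _ e f => e.cost + f.cost + 1

/-- The names of the two algorithms that a program may call. -/
inductive Alg where
  | delta
  | multipliers

/-- Programs. -/
inductive Cmd where
  | skip
  | assign (x : Var) (e : Expr)
  | store (a : Arr) (idx e : Expr)
  | seq (p q : Cmd)
  | ite (e : Expr) (p q : Cmd)
  | loop (e : Expr) (p : Cmd)
  | call (a : Alg)

/-- Sequential composition of a list of programs. -/
def Cmd.block : List Cmd → Cmd
  | [] => .skip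
  | [p] => p
  | p :: q :: l => .seq p (Cmd.block (q :: l))

/-! ## The two algorithms

Both are given lists of pairs `D = [[d₀, N / d₀], [d₁, N / d₁], …]` with `len` entries; the first
components stand in one array and the second components in another one. -/

/-- `x := x + 1`. -/
def Cmd.incr (x : Var) : Cmd := .assign x (.bin .add (.var x) (.const 1))

/-- `e < f`. -/
def Expr.lt (e f : Expr) : Expr := .bin .lt e f

/-- `e = f`. -/
def Expr.eq (e f : Expr) : Expr := .bin .eq e f

/-- The expression `D[len - 1][0]`. -/
def Expr.lastFst : Expr := .read .fst (.bin .sub (.var .len) (.const 1))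

/-- The expression `i j`, the index at which the bit vector `A` is accessed. -/
def Expr.ij : Expr := .bin .mul (.var .i) (.var .j)

/-- The algorithm computing `δ(n)` from the list `D` (arrays `fst`, `snd`) of the pairs of divisors
of `n`; here `n = D[0][1]`.  The result is left in `weight`. -/
def algDelta : Cmd := .block
  [ -- initialize a bit vector `A` of length `n` to `0`
    .assign .t (.const 0),
    .loop (.lt (.var .t) (.read .snd (.const 0))) (.block
      [ .store .bits (.var .t) (.const 0),
        .incr .t ]),
    -- mark the products
    .assign .i (.const 1),
    .assign .k (.const 0),
    .loop (.lt (.var .i) .lastFst) (.block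
      [ .ite (.eq (.var .i) (.read .fst (.var .k))) (.incr .k) .skip,
        .assign .j (.var .i),
        .loop (.lt (.var .j) (.read .snd (.var .k))) (.block
          [ .store .bits .ij (.const 1),
            .incr .j ]),
        .incr .i ]),
    -- return the Hamming weight of `A`
    .assign .weight (.const 0),
    .assign .t (.const 0),
    .loop (.lt (.var .t) (.read .snd (.const 0))) (.block
      [ .assign .weight (.bin .add (.var .weight) (.read .bits (.var .t))),
        .incr .t ]) ]

/-- The algorithm computing `δ(m q)` given `δ(m p)`: its input is the bit vector `A` left by the
computation of `δ(m p)`, its weight in `weight`, and the lists `D_p` (arrays `fst`, `snd`) and `D_q`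
(arrays `fst'`, `snd'`).  The result is left in `weight`. -/
def algMultipliers : Cmd := .block
  [ .assign .i (.const 1),
    .assign .k (.const 0),
    .loop (.lt (.var .i) .lastFst) (.block
      [ .ite (.eq (.var .i) (.read .fst (.var .k))) (.incr .k) .skip,
        .assign .j (.read .snd (.var .k)),
        .loop (.lt (.var .j) (.read .snd' (.var .k))) (.block
          [ .ite (.eq (.read .bits .ij) (.const 0))
              (.block
                [ .store .bits .ij (.const 1),
                  .incr .weight ])
              .skip,
            .incr .j ]),
        .incr .i ]) ]

/-- The code of the two algorithms. -/
def Alg.code : Alg → Cmd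
  | .delta => algDelta
  | .multipliers => algMultipliers

/-! ## Running a program -/

/-- Writing a register. -/
def State.setVar (s : State) (x : Var) (v : ℕ) : State :=
  { s with var := Function.update s.var x v }

/-- Writing a memory cell. -/
def State.setArr (s : State) (a : Arr) (idx v : ℕ) : State :=
  { s with arr := Function.update s.arr a (Function.update (s.arr a) idx v) }

/-- The record of a call: the algorithm, and the states at the entry and at the exit. -/
structure CallRecord where
  alg : Alg
  entry : State
  exit : State

/-- `Exec w p s t cs s'`: with word size `w`, the program `p` started in the state `s` halts after
`t` units of time in the state `s'`, and `cs` lists the calls that it made. -/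
inductive Exec (w : ℕ) : Cmd → State → ℕ → List CallRecord → State → Prop where
  | skip (s : State) : Exec w .skip s 1 [] s
  | assign (s : State) (x : Var) (e : Expr) :
      Exec w (.assign x e) s (e.cost + 1) [] (s.setVar x (e.eval w s))
  | store (s : State) (a : Arr) (idx e : Expr) :
      Exec w (.store a idx e) s (idx.cost + e.cost + 1) []
        (s.setArr a (idx.eval w s) (e.eval w s))
  | seq {p q : Cmd} {s s₁ s₂ : State} {t₁ t₂ : ℕ} {c₁ c₂ : List CallRecord}
      (h₁ : Exec w p s t₁ c₁ s₁) (h₂ : Exec w q s₁ t₂ c₂ s₂) :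
      Exec w (.seq p q) s (t₁ + t₂) (c₁ ++ c₂) s₂
  | ite_true {e : Expr} {p q : Cmd} {s s₁ : State} {t : ℕ} {c : List CallRecord}
      (he : e.eval w s ≠ 0) (h : Exec w p s t c s₁) :
      Exec w (.ite e p q) s (e.cost + 1 + t) c s₁
  | ite_false {e : Expr} {p q : Cmd} {s s₁ : State} {t : ℕ} {c : List CallRecord}
      (he : e.eval w s = 0) (h : Exec w q s t c s₁) :
      Exec w (.ite e p q) s (e.cost + 1 + t) c s₁
  | loop_exit {e : Expr} {p : Cmd} {s : State} (he : e.eval w s = 0) :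
      Exec w (.loop e p) s (e.cost + 1) [] s
  | loop_step {e : Expr} {p : Cmd} {s s₁ s₂ : State} {t₁ t₂ : ℕ} {c₁ c₂ : List CallRecord}
      (he : e.eval w s ≠ 0) (h₁ : Exec w p s t₁ c₁ s₁) (h₂ : Exec w (.loop e p) s₁ t₂ c₂ s₂) :
      Exec w (.loop e p) s (e.cost + 1 + t₁ + t₂) (c₁ ++ c₂) s₂
  | call {a : Alg} {s s₁ : State} {t : ℕ} {c : List CallRecord}
      (h : Exec w a.code s t c s₁) :
      Exec w (.call a) s (t + 1) (⟨a, s, s₁⟩ :: c) s₁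

/-- The initial state on input `n`: all other registers and all of the memory are zero. -/
def State.init (n : ℕ) : State where
  var := fun x => if x = .input then n else 0
  arr := fun _ _ => 0

/-! ## Correct use of the two algorithms -/

/-- The arrays `a`, `b` hold the list `[[d₀, N / d₀], …]` where `d₀ < d₁ < …` are the elements
of `S`, and `len` is the length of that list. -/
def State.HoldsPairs (s : State) (a b : Arr) (S : Finset ℕ) (N : ℕ) : Prop :=
  s.var .len = S.card ∧
    ∀ r : Fin S.card, s.arr a r = S.orderEmbOfFin rfl r ∧
      s.arr b r = N / S.orderEmbOfFin rfl r

/-- The products `i j` to be marked in the computation of `δ(N)`: those with `0 < i < g` and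
`0 < j < N / g` for some divisor `g` of `N`. -/
def deltaProducts (N : ℕ) : Finset ℕ :=
  N.divisors.biUnion fun g =>
    (Finset.Ico 1 g ×ˢ Finset.Ico 1 (N / g)).image fun x => x.1 * x.2

/-- The input of the first algorithm for `δ(n)`: the pairs `[d, n / d]` of divisors of `n` with
`d ≤ √n`. -/
def State.IsDeltaInput (s : State) (n : ℕ) : Prop :=
  0 < n ∧ s.HoldsPairs .fst .snd (n.divisors.filter fun d => d * d ≤ n) n

/-- The input of the second algorithm for `δ(m q)`, given `δ(m p)`, with primes `p < q`: the bit
vector of length `m q` containing the products from computing `δ(m p)`, its weight, and the lists of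
divisor pairs of `m p` and of `m q` that are indexed by the divisors of `m`.  Since each
factorization of `m p` into two factors has a factor that divides `m`, these lists contain each pair
of divisors; if `m < p`, they consist exactly of the pairs `[d, m p / d]` with `d ≤ √(m p)`, and
likewise for `q`. -/
def State.IsMultipliersInput (s : State) (m p q : ℕ) : Prop :=
  0 < m ∧ p.Prime ∧ q.Prime ∧ p < q ∧
    (∀ x < m * q, s.arr .bits x = if x ∈ deltaProducts (m * p) then 1 else 0) ∧
    s.var .weight = (deltaProducts (m * p)).card ∧
    s.HoldsPairs .fst .snd m.divisors (m * p) ∧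
    s.HoldsPairs .fst' .snd' m.divisors (m * q)

/-- The call `c` computes `δ(k)`: it is a call of one of the two algorithms on a correct input for
`δ(k)`, and it returns `δ(k)`. -/
def CallRecord.Computes (c : CallRecord) (k : ℕ) : Prop :=
  c.exit.var .weight = deltaCount k ∧
    match c.alg with
    | .delta => c.entry.IsDeltaInput k
    | .multipliers => ∃ m p q, k = m * q ∧ c.entry.IsMultipliersInput m p q

/-- A run of the program `P` on the input `n`, with word size `w`, that takes time `t` and tabulates
`M(k)` for `1 ≤ k ≤ n`, where each `δ(k)` is computed by a call of one of the two algorithms.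
The values `M(k)` are left in the output array. -/
def Tabulates (P : Cmd) (w n t : ℕ) : Prop :=
  ∃ (cs : List CallRecord) (s : State), Exec w P (State.init n) t cs s ∧
    (∀ k ∈ Finset.Icc 1 n, s.arr .out k = tableCount k) ∧
    ∀ k ∈ Finset.Icc 1 n, ∃ c ∈ cs, c.Computes k

/-!
The program first treats multipliers `m = 1, 2, …`.  For each `m` it computes `δ(2 m)` by the first
algorithm and then `δ(m q)` for all primes `q ≤ n / m` by the second algorithm, going from each prime
to the next one.  Since the step from `p` to `q` costs about `(q - p) m log m`, the costs telescope,
and each `m` costs only `O(n log n)` (`wp_columnOf`).  The values `δ(k)` that remain unknown are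
computed one by one with the first algorithm, again for `O(n log n)` each (`wp_finish`).  The program
keeps count of the unknown values and changes from the first part to the second one when `2 m`
reaches this number; hence it takes time `O(m n log n)` for the last `m`, apart from `O(n ^ (3/2))`
for the table of primes (`tabulates`).

If all multipliers below `m` have been treated, then the numbers `k ≤ n` left over have no prime
factor above `n / m`.  So the last `m` is at most about `max (n / y) (ψ(n, y))` for each `y`, where
`ψ(n, y)` counts the numbers up to `n` without prime factors `≥ y` (`le_of_smoothCount_le`).  For
`y = L(n) ^ a` with `a < 1 / √2`, Rankin's bound (`smoothCount_le_rankin`) and the estimate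
`∑_{p < y} 1 / p = O(log log y)` (`sum_primesBelow_inv_le`) give `ψ(n, y) ≤ n / L(n) ^ a` for large `n`
(`eventually_smoothCount_le`), so that the time is at most `n² / L(n) ^ b` for each `b < 1 / √2` and all
large `n`.

That the algorithms compute `δ` rests on the description of the multiples of `n` in the smaller table
as the products `i j` with `i < g`, `j < n / g`, `g ∣ n` (`deltaCount_eq_card`).  Programs are verified
with a weakest-precondition calculus `Wp` in which the elapsed time and the recorded calls are ghost
components of the state.
-/

/-! ### A program logic for total correctness with running time -/

/-- A state together with two ghost components: the time spent so far and the calls made so far. -/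
structure Config where
  /-- the registers and the memory -/
  st : State
  /-- the time spent so far -/
  time : ℕ
  /-- the calls made so far -/
  calls : List CallRecord

/-- The total-correctness weakest precondition: `p`, started in `X`, halts in a configuration
that satisfies `Q`. -/
def Wp (w : ℕ) (p : Cmd) (Q : Config → Prop) (X : Config) : Prop :=
  ∃ (t : ℕ) (cs : List CallRecord) (s : State), Exec w p X.st t cs s ∧
    Q ⟨s, X.time + t, X.calls ++ cs⟩

/-- The registers that a program may write. -/
def Cmd.writesVar : Cmd → Var → Bool
  | .skip, _ => false
  | .assign x _, y => decide (x = y)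
  | .store _ _ _, _ => false
  | .seq p q, y => p.writesVar y || q.writesVar y
  | .ite _ p q, y => p.writesVar y || q.writesVar y
  | .loop _ p, y => p.writesVar y
  | .call _, y => decide (y ∈ [Var.i, .j, .k, .t, .weight])

/-- The arrays that a program may write. -/
def Cmd.writesArr : Cmd → Arr → Bool
  | .skip, _ => false
  | .assign _ _, _ => false
  | .store a _ _, b => decide (a = b)
  | .seq p q, y => p.writesArr y || q.writesArr y
  | .ite _ p q, y => p.writesArr y || q.writesArr y
  | .loop _ p, y => p.writesArr y
  | .call _, y => decide (y = Arr.bits)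

/-- `Y` differs from `X` only in what `p` may write; no recorded call is lost. -/
structure Frame (p : Cmd) (X Y : Config) : Prop where
  var : ∀ x, p.writesVar x = false → Y.st.var x = X.st.var x
  arr : ∀ a, p.writesArr a = false → Y.st.arr a = X.st.arr a
  calls : X.calls ⊆ Y.calls

theorem Frame.refl (p : Cmd) (X : Config) : Frame p X X :=
  ⟨fun _ _ => rfl, fun _ _ => rfl, fun _ h => h⟩

theorem Frame.trans {p : Cmd} {X Y Z : Config} (h : Frame p X Y) (h' : Frame p Y Z) :
    Frame p X Z :=
  ⟨fun x hx => (h'.var x hx).trans (h.var x hx), fun a ha => (h'.arr a ha).trans (h.arr a ha),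
    fun _ hc => h'.calls (h.calls hc)⟩

theorem Alg.writesVar_code (a : Alg) (x : Var) (h : (Cmd.call a).writesVar x = false) :
    a.code.writesVar x = false := by
  cases a <;> cases x <;> first | rfl | simp [Cmd.writesVar] at h

theorem Alg.writesArr_code (a : Alg) (x : Arr) (h : (Cmd.call a).writesArr x = false) :
    a.code.writesArr x = false := by
  cases a <;> cases x <;> first | rfl | simp [Cmd.writesArr] at h

theorem Exec.var_eq {w : ℕ} {p : Cmd} {s s' : State} {t : ℕ} {cs : List CallRecord}
    (h : Exec w p s t cs s') (x : Var) (hx : p.writesVar x = false) : s'.var x = s.var x := by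
  induction h with
  | skip | store | loop_exit => rfl
  | assign s y e =>
    have hne : x ≠ y := by rintro rfl; simp [Cmd.writesVar] at hx
    simp [State.setVar, hne]
  | seq _ _ ih₁ ih₂ =>
    simp only [Cmd.writesVar, Bool.or_eq_false_iff] at hx
    rw [ih₂ hx.2, ih₁ hx.1]
  | ite_true _ _ ih =>
    simp only [Cmd.writesVar, Bool.or_eq_false_iff] at hx
    exact ih hx.1
  | ite_false _ _ ih =>
    simp only [Cmd.writesVar, Bool.or_eq_false_iff] at hx
    exact ih hx.2
  | loop_step _ _ _ ih₁ ih₂ => rw [ih₂ hx, ih₁ hx]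
  | call _ ih => exact ih (Alg.writesVar_code _ _ hx)

theorem Exec.arr_eq {w : ℕ} {p : Cmd} {s s' : State} {t : ℕ} {cs : List CallRecord}
    (h : Exec w p s t cs s') (x : Arr) (hx : p.writesArr x = false) : s'.arr x = s.arr x := by
  induction h with
  | skip | assign | loop_exit => rfl
  | store s a idx e =>
    have hne : x ≠ a := by rintro rfl; simp [Cmd.writesArr] at hx
    simp [State.setArr, hne]
  | seq _ _ ih₁ ih₂ =>
    simp only [Cmd.writesArr, Bool.or_eq_false_iff] at hx
    rw [ih₂ hx.2, ih₁ hx.1]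
  | ite_true _ _ ih =>
    simp only [Cmd.writesArr, Bool.or_eq_false_iff] at hx
    exact ih hx.1
  | ite_false _ _ ih =>
    simp only [Cmd.writesArr, Bool.or_eq_false_iff] at hx
    exact ih hx.2
  | loop_step _ _ _ ih₁ ih₂ => rw [ih₂ hx, ih₁ hx]
  | call _ ih => exact ih (Alg.writesArr_code _ _ hx)

section Rules

variable {w : ℕ} {p q : Cmd} {Q R : Config → Prop} {X : Config}

theorem Wp.mono (h : Wp w p Q X) (hQ : ∀ Y, Frame p X Y → Q Y → R Y) : Wp w p R X := by
  obtain ⟨t, cs, s, he, hq⟩ := h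
  refine ⟨t, cs, s, he, hQ _ ⟨he.var_eq, he.arr_eq, ?_⟩ hq⟩
  exact fun c hc => List.mem_append_left _ hc

theorem Wp.skip (h : Q ⟨X.st, X.time + 1, X.calls⟩) : Wp w .skip Q X :=
  ⟨1, [], X.st, .skip _, by simpa using h⟩

theorem Wp.assign {x : Var} {e : Expr}
    (h : Q ⟨X.st.setVar x (e.eval w X.st), X.time + (e.cost + 1), X.calls⟩) :
    Wp w (.assign x e) Q X :=
  ⟨_, [], _, .assign _ _ _, by simpa using h⟩

theorem Wp.store {a : Arr} {idx e : Expr}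
    (h : Q ⟨X.st.setArr a (idx.eval w X.st) (e.eval w X.st),
      X.time + (idx.cost + e.cost + 1), X.calls⟩) : Wp w (.store a idx e) Q X :=
  ⟨_, [], _, .store _ _ _ _, by simpa using h⟩

theorem Wp.seq (h : Wp w p (Wp w q Q) X) : Wp w (.seq p q) Q X := by
  obtain ⟨t, cs, s, he, t', cs', s', he', hq⟩ := h
  exact ⟨_, _, _, .seq he he', by simpa [add_assoc] using hq⟩

theorem Wp.ite {e : Expr}
    (h₁ : e.eval w X.st ≠ 0 → Wp w p Q ⟨X.st, X.time + (e.cost + 1), X.calls⟩)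
    (h₂ : e.eval w X.st = 0 → Wp w q Q ⟨X.st, X.time + (e.cost + 1), X.calls⟩) :
    Wp w (.ite e p q) Q X := by
  by_cases he : e.eval w X.st = 0
  · obtain ⟨t, cs, s, hx, hq⟩ := h₂ he
    exact ⟨_, _, _, .ite_false he hx, by simpa [add_assoc] using hq⟩
  · obtain ⟨t, cs, s, hx, hq⟩ := h₁ he
    exact ⟨_, _, _, .ite_true he hx, by simpa [add_assoc] using hq⟩

/-- The loop rule: `I i` is the invariant before the round with number `i`, and the round numbers
are bounded by `N`.  The states reached automatically satisfy the frame condition. -/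
theorem Wp.loop {e : Expr} (I : ℕ → Config → Prop) (N i : ℕ) (h₀ : I i X)
    (hN : ∀ i Y, I i Y → i ≤ N)
    (hexit : ∀ i Y, Frame p X Y → I i Y → e.eval w Y.st = 0 →
      Q ⟨Y.st, Y.time + (e.cost + 1), Y.calls⟩)
    (hstep : ∀ i Y, Frame p X Y → I i Y → e.eval w Y.st ≠ 0 →
      Wp w p (I (i + 1)) ⟨Y.st, Y.time + (e.cost + 1), Y.calls⟩) :
    Wp w (.loop e p) Q X := by
  have key : ∀ r i Y, Frame p X Y → I i Y → N + 1 - i ≤ r → Wp w (.loop e p) Q Y := by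
    intro r
    induction r with
    | zero => intro i Y _ hI hr; have := hN i Y hI; omega
    | succ r ih =>
      intro i Y hF hI hr
      by_cases he : e.eval w Y.st = 0
      · exact ⟨_, [], _, .loop_exit he, by simpa using hexit i Y hF hI he⟩
      · obtain ⟨Z, hZ, t, cs, hx⟩ : ∃ Z : Config, (Frame p X Z ∧ I (i + 1) Z) ∧
            ∃ t cs, Exec w p Y.st t cs Z.st ∧ Z.time = Y.time + (e.cost + 1) + t ∧
              Z.calls = Y.calls ++ cs := by
          obtain ⟨t, cs, s, hx, hq⟩ := hstep i Y hF hI he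
          exact ⟨_, ⟨hF.trans ⟨hx.var_eq, hx.arr_eq, fun c hc => List.mem_append_left _ hc⟩, hq⟩,
            t, cs, hx, rfl, rfl⟩
        obtain ⟨t', cs', s', hx', hq'⟩ := ih (i + 1) Z hZ.1 hZ.2 (by omega)
        refine ⟨_, _, _, .loop_step he hx.1 hx', ?_⟩
        have h1 : Y.time + (e.cost + 1 + t + t') = Z.time + t' := by rw [hx.2.1]; ring
        have h2 : Y.calls ++ (cs ++ cs') = Z.calls ++ cs' := by rw [hx.2.2]; simp
        rw [h1, h2]; exact hq'
  exact key _ i X (Frame.refl _ _) h₀ le_rfl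

theorem Wp.call {a : Alg} (h : Wp w a.code (fun Y => ∀ cs, X.calls ⊆ cs →
      (⟨a, X.st, Y.st⟩ : CallRecord) ∈ cs → Q ⟨Y.st, Y.time + 1, cs⟩) X) :
    Wp w (.call a) Q X := by
  obtain ⟨t, cs, s, hx, hq⟩ := h
  refine ⟨_, _, _, .call hx, ?_⟩
  have := hq (X.calls ++ (⟨a, X.st, s⟩ :: cs)) (fun c hc => List.mem_append_left _ hc) (by simp)
  simpa [add_assoc] using this

end Rules

@[simp] theorem Cmd.block_singleton (p : Cmd) : Cmd.block [p] = p := rfl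

@[simp] theorem Cmd.block_cons_cons (p q : Cmd) (l : List Cmd) :
    Cmd.block (p :: q :: l) = .seq p (Cmd.block (q :: l)) := rfl

@[simp] theorem State.setVar_var (s : State) (x : Var) (v : ℕ) (y : Var) :
    (s.setVar x v).var y = if y = x then v else s.var y := by
  simp [State.setVar, Function.update_apply]

@[simp] theorem State.setVar_arr (s : State) (x : Var) (v : ℕ) :
    (s.setVar x v).arr = s.arr := rfl

@[simp] theorem State.setArr_var (s : State) (a : Arr) (idx v : ℕ) :
    (s.setArr a idx v).var = s.var := rfl

@[simp] theorem State.setArr_arr (s : State) (a : Arr) (idx v : ℕ) (b : Arr) :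
    (s.setArr a idx v).arr b = if b = a then Function.update (s.arr a) idx v else s.arr b := by
  simp [State.setArr, Function.update_apply]

/-! ### Counting products and divisors -/

theorem mem_deltaProducts {N x : ℕ} : x ∈ deltaProducts N ↔
    ∃ g, g ∣ N ∧ N ≠ 0 ∧ ∃ i j, 0 < i ∧ i < g ∧ 0 < j ∧ j < N / g ∧ i * j = x := by
  simp only [deltaProducts, Finset.mem_biUnion, Nat.mem_divisors, Finset.mem_image,
    Finset.mem_product, Finset.mem_Ico, Prod.exists]
  constructor
  · rintro ⟨g, ⟨h1, h2⟩, i, j, ⟨⟨h3, h4⟩, h5, h6⟩, rfl⟩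
    exact ⟨g, h1, h2, i, j, by omega, h4, by omega, h6, rfl⟩
  · rintro ⟨g, h1, h2, i, j, h3, h4, h5, h6, rfl⟩
    exact ⟨g, ⟨h1, h2⟩, i, j, ⟨⟨by omega, h4⟩, by omega, h6⟩, rfl⟩

theorem mul_lt_of_lt_div {N g i j : ℕ} (hi : i < g) (hj : j < N / g) : i * j < N := by
  have h1 : i * j < g * (N / g) := Nat.mul_lt_mul'' hi hj
  exact h1.trans_le (Nat.mul_div_le N g)

theorem lt_of_mem_deltaProducts {N x : ℕ} (h : x ∈ deltaProducts N) : x < N := by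
  obtain ⟨g, -, -, i, j, -, hi, -, hj, rfl⟩ := mem_deltaProducts.1 h
  exact mul_lt_of_lt_div hi hj

/-- Writing `m n = a b` with `g = gcd a n`, the multiple `m n` lies in the smaller table iff `m`
splits as a product below a complementary pair of divisors of `n`. -/
theorem deltaCount_eq_card {N : ℕ} (hN : 0 < N) : deltaCount N = (deltaProducts N).card := by
  have h : (deltaProducts N).image (fun m => m * N) =
      ((Finset.Icc 1 N).image fun m => m * N) ∩ multTable (N - 1) := by
    ext x
    simp only [Finset.mem_image, Finset.mem_inter, multTable, Finset.mem_product, Finset.mem_Icc,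
      Prod.exists, mem_deltaProducts]
    constructor
    · rintro ⟨_, ⟨g, ⟨h, rfl⟩, -, i, j, hi, hig, hj, hjN, rfl⟩, rfl⟩
      have hg : 0 < g := by omega
      rw [Nat.mul_div_cancel_left _ hg] at hjN
      have h1 : i * j < g * h := Nat.mul_lt_mul'' hig hjN
      have h2 : 0 < i * j := Nat.mul_pos hi hj
      refine ⟨⟨i * j, ⟨h2, h1.le⟩, rfl⟩, i * h, j * g, ?_, by ring⟩
      have h3 : i * h < g * h := Nat.mul_lt_mul_of_pos_right hig (by omega)
      have h4 : j * g < g * h := by rw [mul_comm g h]; exact Nat.mul_lt_mul_of_pos_right hjN hg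
      have h5 : 0 < i * h := Nat.mul_pos hi (by omega)
      have h6 : 0 < j * g := Nat.mul_pos hj hg
      omega
    · rintro ⟨⟨m, ⟨hm, hmN⟩, rfl⟩, a, b, ⟨⟨ha, haN⟩, hb, hbN⟩, hab⟩
      obtain ⟨g, a', n', hg, hco, rfl, rfl⟩ := Nat.exists_coprime' (m := a) (n := N)
        (Nat.gcd_pos_of_pos_left _ ha)
      have h1 : a' * b = m * n' := by
        apply Nat.eq_of_mul_eq_mul_right hg
        linarith [hab]
      have h2 : n' ∣ b := hco.symm.dvd_of_dvd_mul_left ⟨m, by rw [h1]; ring⟩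
      obtain ⟨b', rfl⟩ := h2
      have hn' : 0 < n' := Nat.pos_of_ne_zero (by rintro rfl; simp at hN)
      have h3 : a' * b' = m := by
        apply Nat.eq_of_mul_eq_mul_right hn'
        linarith [h1]
      have ha' : 0 < a' := Nat.pos_of_ne_zero (by rintro rfl; simp at ha)
      have hb' : 0 < b' := Nat.pos_of_ne_zero (by rintro rfl; simp at hb)
      refine ⟨m, ⟨n', ⟨g, rfl⟩, by omega, a', b', ha', ?_, hb', ?_, h3⟩, rfl⟩
      · have : a' * g < n' * g := by omega
        exact lt_of_mul_lt_mul_right this (Nat.zero_le _)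
      · rw [Nat.mul_div_cancel_left _ hn']
        have : n' * b' < n' * g := by omega
        exact lt_of_mul_lt_mul_left this (Nat.zero_le _)
  rw [deltaCount, ← h, Finset.card_image_of_injective _ (mul_left_injective₀ (by omega))]

/-- The `(k + 1)`-st table arises from the `k`-th one by adjoining the `k + 1` multiples `m (k + 1)`,
of which `δ(k + 1)` are present already. -/
theorem tableCount_add_deltaCount (k : ℕ) :
    tableCount (k + 1) + deltaCount (k + 1) = tableCount k + (k + 1) := by
  have h : multTable (k + 1) = ((Finset.Icc 1 (k + 1)).image fun m => m * (k + 1)) ∪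
      multTable k := by
    ext x
    simp only [multTable, Finset.mem_union, Finset.mem_image, Finset.mem_product, Finset.mem_Icc,
      Prod.exists]
    constructor
    · rintro ⟨a, b, ⟨⟨h1, h2⟩, h3, h4⟩, rfl⟩
      by_cases hb : b = k + 1
      · exact Or.inl ⟨a, ⟨h1, h2⟩, by rw [hb]⟩
      by_cases ha : a = k + 1
      · exact Or.inl ⟨b, ⟨h3, h4⟩, by rw [ha, mul_comm]⟩
      · exact Or.inr ⟨a, b, by omega, rfl⟩
    · rintro (⟨m, h, rfl⟩ | ⟨a, b, h, rfl⟩)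
      · exact ⟨m, k + 1, by omega, rfl⟩
      · exact ⟨a, b, by omega, rfl⟩
  have h2 := Finset.card_union_add_card_inter ((Finset.Icc 1 (k + 1)).image fun m => m * (k + 1))
    (multTable k)
  rw [← h, Finset.card_image_of_injective _ (mul_left_injective₀ (by omega))] at h2
  simp only [Nat.card_Icc] at h2
  simp only [tableCount, deltaCount, Nat.add_sub_cancel]
  omega

theorem tableCount_le (k : ℕ) : tableCount k ≤ k * k :=
  Finset.card_image_le.trans (by simp)

/-- The number of elements of `S` below `i`, which is the position of `i` in the increasing
enumeration of `S` when `i ∈ S`. -/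
def Finset.countBelow (S : Finset ℕ) (i : ℕ) : ℕ := (S.filter (· < i)).card

theorem Finset.countBelow_orderEmbOfFin (S : Finset ℕ) (r : Fin S.card) :
    S.countBelow (S.orderEmbOfFin rfl r) = r := by
  have h : S.filter (· < S.orderEmbOfFin rfl r) =
      (Finset.univ.filter (· < r)).map (S.orderEmbOfFin rfl).toEmbedding := by
    ext x
    simp only [Finset.mem_filter, Finset.mem_map, Finset.mem_univ, true_and,
      RelEmbedding.coe_toEmbedding]
    constructor
    · rintro ⟨h1, h2⟩
      obtain ⟨r', rfl⟩ : x ∈ Set.range (S.orderEmbOfFin rfl) := by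
        rw [Finset.range_orderEmbOfFin]; exact h1
      exact ⟨r', by simpa using h2, rfl⟩
    · rintro ⟨r', h1, rfl⟩
      exact ⟨Finset.orderEmbOfFin_mem _ _ _, by simpa using h1⟩
  have h' : Finset.univ.filter (· < r) = Finset.Iio r := by ext; simp
  rw [Finset.countBelow, h, Finset.card_map, h', Fin.card_Iio]

theorem State.holdsPairs_iff {s : State} {a b : Arr} {S : Finset ℕ} {N : ℕ} :
    s.HoldsPairs a b S N ↔ s.var .len = S.card ∧
      ∀ x ∈ S, s.arr a (S.countBelow x) = x ∧ s.arr b (S.countBelow x) = N / x := by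
  refine and_congr_right fun _ => ⟨fun h x hx => ?_, fun h r => ?_⟩
  · obtain ⟨r, rfl⟩ : x ∈ Set.range (S.orderEmbOfFin rfl) := by
      rw [Finset.range_orderEmbOfFin]; exact hx
    rw [Finset.countBelow_orderEmbOfFin]
    exact h r
  · have := h _ (Finset.orderEmbOfFin_mem S rfl r)
    rwa [Finset.countBelow_orderEmbOfFin] at this

/-- The least element of `S` above `i`; it is `0` if there is none. -/
noncomputable def Finset.nextAbove (S : Finset ℕ) (i : ℕ) : ℕ := sInf {x | x ∈ S ∧ i < x}

theorem Finset.nextAbove_spec {S : Finset ℕ} {i D : ℕ} (hD : D ∈ S) (hi : i < D) :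
    S.nextAbove i ∈ S ∧ i < S.nextAbove i :=
  Nat.sInf_mem (s := {x | x ∈ S ∧ i < x}) ⟨D, hD, hi⟩

theorem Finset.nextAbove_le {S : Finset ℕ} {i x : ℕ} (hx : x ∈ S) (hi : i < x) :
    S.nextAbove i ≤ x :=
  Nat.sInf_le ⟨hx, hi⟩

theorem Finset.countBelow_succ (S : Finset ℕ) (i : ℕ) :
    S.countBelow (i + 1) = S.countBelow i + if i ∈ S then 1 else 0 := by
  simp only [Finset.countBelow]
  split_ifs with h
  · rw [← Finset.card_insert_of_notMem (a := i) (by simp)]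
    congr 1; ext x
    simp only [Finset.mem_filter, Finset.mem_insert]
    constructor
    · rintro ⟨h1, h2⟩
      by_cases hx : x = i
      · exact Or.inl hx
      · exact Or.inr ⟨h1, by omega⟩
    · rintro (rfl | ⟨h1, h2⟩)
      · exact ⟨h, by omega⟩
      · exact ⟨h1, by omega⟩
  · rw [add_zero]
    congr 1; ext x
    simp only [Finset.mem_filter, and_congr_right_iff]
    intro hx
    have : x ≠ i := by rintro rfl; exact h hx
    omega

theorem Finset.countBelow_nextAbove {S : Finset ℕ} {i D : ℕ} (hD : D ∈ S) (hi : i < D) :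
    S.countBelow (S.nextAbove i) = S.countBelow (i + 1) := by
  simp only [Finset.countBelow]
  congr 1; ext x
  simp only [Finset.mem_filter, and_congr_right_iff]
  intro hx
  have h1 := Finset.nextAbove_spec hD hi
  constructor
  · intro h
    by_contra hc
    have := Finset.nextAbove_le hx (i := i) (by omega)
    omega
  · intro h; omega

theorem Finset.countBelow_lt_card {S : Finset ℕ} {x : ℕ} (hx : x ∈ S) :
    S.countBelow x < S.card :=
  Finset.card_lt_card ⟨Finset.filter_subset _ _, fun h => by simpa using h hx⟩

theorem Finset.countBelow_of_forall_le {S : Finset ℕ} {D : ℕ} (hD : D ∈ S)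
    (hmax : ∀ x ∈ S, x ≤ D) : S.countBelow D = S.card - 1 := by
  rw [Finset.countBelow, ← Finset.card_erase_of_mem hD]
  congr 1; ext x
  simp only [Finset.mem_filter, Finset.mem_erase]
  constructor
  · rintro ⟨h1, h2⟩; exact ⟨by omega, h1⟩
  · rintro ⟨h1, h2⟩; exact ⟨h2, lt_of_le_of_ne (hmax x h2) h1⟩

/-- The set of products `i j` with `1 ≤ i < I` and `a i ≤ j < b i`. -/
def markedProducts (a b : ℕ → ℕ) (I : ℕ) : Finset ℕ :=
  (Finset.Ico 1 I).biUnion fun i => (Finset.Ico (a i) (b i)).image (i * ·)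

theorem mem_markedProducts {a b : ℕ → ℕ} {I x : ℕ} : x ∈ markedProducts a b I ↔
    ∃ i, 1 ≤ i ∧ i < I ∧ ∃ j, a i ≤ j ∧ j < b i ∧ i * j = x := by
  simp [markedProducts, and_assoc]

theorem markedProducts_succ {a b : ℕ → ℕ} {I : ℕ} (hI : 1 ≤ I) : markedProducts a b (I + 1) =
    markedProducts a b I ∪ (Finset.Ico (a I) (b I)).image (I * ·) := by
  ext x
  simp only [mem_markedProducts, Finset.mem_union, Finset.mem_image, Finset.mem_Ico]
  constructor
  · rintro ⟨i, h1, h2, j, h3, h4, rfl⟩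
    by_cases h : i = I
    · subst h; exact Or.inr ⟨j, ⟨h3, h4⟩, rfl⟩
    · exact Or.inl ⟨i, h1, by omega, j, h3, h4, rfl⟩
  · rintro (⟨i, h1, h2, j, h3, h4, rfl⟩ | ⟨j, ⟨h3, h4⟩, rfl⟩)
    · exact ⟨i, h1, by omega, j, h3, h4, rfl⟩
    · exact ⟨I, hI, by omega, j, h3, h4, rfl⟩

/-- The divisors of `N` that are at most `√N`. -/
def smallDivisors (N : ℕ) : Finset ℕ := N.divisors.filter fun d => d * d ≤ N

/-- By the symmetry of the two factors it suffices to mark the products `i j` with `i ≤ j`, and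
then the first factor is below a divisor that is at most `√N`. -/
theorem markedProducts_smallDivisors {N D : ℕ} (hD : D ∈ smallDivisors N)
    (hmax : ∀ x ∈ smallDivisors N, x ≤ D) :
    markedProducts (fun i => i) (fun i => N / (smallDivisors N).nextAbove i) D =
      deltaProducts N := by
  have hS : ∀ x, x ∈ smallDivisors N ↔ x ∣ N ∧ N ≠ 0 ∧ x * x ≤ N := by
    simp [smallDivisors, and_assoc]
  have hN : N ≠ 0 := ((hS D).1 hD).2.1
  have key : ∀ g i j, g ∣ N → 0 < i → i ≤ j → i < g → j < N / g →
      i < D ∧ j < N / (smallDivisors N).nextAbove i := by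
    intro g i j hg hi hij hig hjg
    by_cases hgS : g ∈ smallDivisors N
    · have h1 := hmax g hgS
      refine ⟨by omega, hjg.trans_le (Nat.div_le_div_left (Finset.nextAbove_le hgS hig) ?_)⟩
      have := (Finset.nextAbove_spec hgS hig).2
      omega
    · obtain ⟨h, rfl⟩ := hg
      have hg0 : 0 < g := by omega
      rw [Nat.mul_div_cancel_left _ hg0] at hjg
      have h2 : h < g := by
        by_contra hc
        exact hgS ((hS g).2 ⟨⟨h, rfl⟩, hN, Nat.mul_le_mul_left g (by omega)⟩)
      have hhS : h ∈ smallDivisors (g * h) :=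
        (hS h).2 ⟨⟨g, mul_comm _ _⟩, hN, Nat.mul_le_mul_right h h2.le⟩
      have h1 := hmax h hhS
      have hih : i < h := by omega
      have h3 := (Finset.nextAbove_spec hhS hih).2
      have h4 : g * h / h ≤ g * h / (smallDivisors (g * h)).nextAbove i :=
        Nat.div_le_div_left (Finset.nextAbove_le hhS hih) (by omega)
      rw [Nat.mul_div_cancel _ (by omega)] at h4
      omega
  ext x
  rw [mem_markedProducts, mem_deltaProducts]
  constructor
  · rintro ⟨i, h1, h2, j, h3, h4, rfl⟩
    have h5 := Finset.nextAbove_spec hD h2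
    exact ⟨_, ((hS _).1 h5.1).1, hN, i, j, h1, h5.2, by omega, h4, rfl⟩
  · rintro ⟨g, hg, -, i, j, hi, hig, hj, hjg, rfl⟩
    rcases le_total i j with hij | hij
    · obtain ⟨h1, h2⟩ := key g i j hg hi hij hig hjg
      exact ⟨i, hi, h1, j, hij, h2, rfl⟩
    · obtain ⟨h, rfl⟩ := hg
      have hg0 : 0 < g := by omega
      rw [Nat.mul_div_cancel_left _ hg0] at hjg
      obtain ⟨h1, h2⟩ := key h j i ⟨g, mul_comm _ _⟩ hj hij hjg
        (by rwa [Nat.mul_div_cancel _ (by omega)])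
      exact ⟨j, hj, h1, i, hij, h2, mul_comm _ _⟩

/-- In a factorization of `m p` with `p` prime, one of the factors divides `m`. -/
theorem Nat.Prime.dvd_or_dvd_of_mul_eq {m p g h : ℕ} (hp : p.Prime) (hgh : m * p = g * h) :
    g ∣ m ∨ h ∣ m := by
  rcases hp.dvd_mul.1 (hgh ▸ Dvd.intro_left m rfl : p ∣ g * h) with ⟨c, rfl⟩ | ⟨c, rfl⟩
  · exact Or.inr ⟨c, Nat.eq_of_mul_eq_mul_right hp.pos (by linarith)⟩
  · exact Or.inl ⟨c, Nat.eq_of_mul_eq_mul_right hp.pos (by linarith)⟩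

/-- For the products belonging to `m p` it suffices to let `g` run through the divisors of `m`: in
each factorization of `m p` one of the factors divides `m`, and the two factors of a product may be
interchanged. -/
theorem mem_deltaProducts_mul_prime {m p x : ℕ} (hm : 0 < m) (hp : p.Prime) :
    x ∈ deltaProducts (m * p) ↔
      ∃ i, 1 ≤ i ∧ i < m ∧ ∃ j, 0 < j ∧ j < m * p / m.divisors.nextAbove i ∧ i * j = x := by
  have hmm : m ∈ m.divisors := Nat.mem_divisors.2 ⟨dvd_rfl, by omega⟩
  have key : ∀ g i j, g ∣ m → 0 < i → i < g → j < m * p / g →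
      i < m ∧ j < m * p / m.divisors.nextAbove i := by
    intro g i j hg hi hig hjg
    have hgS : g ∈ m.divisors := Nat.mem_divisors.2 ⟨hg, by omega⟩
    have h1 := Nat.le_of_dvd hm hg
    have := (Finset.nextAbove_spec hgS hig).2
    exact ⟨by omega, hjg.trans_le (Nat.div_le_div_left (Finset.nextAbove_le hgS hig) (by omega))⟩
  rw [mem_deltaProducts]
  constructor
  · rintro ⟨g, ⟨h, hgh⟩, -, i, j, hi, hig, hj, hjg, rfl⟩
    rcases hp.dvd_or_dvd_of_mul_eq hgh with hd | hd
    · obtain ⟨h1, h2⟩ := key g i j hd hi hig hjg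
      exact ⟨i, hi, h1, j, hj, h2, rfl⟩
    · rw [hgh, Nat.mul_div_cancel_left _ (by omega)] at hjg
      obtain ⟨h1, h2⟩ := key h j i hd hj hjg (by rwa [hgh, Nat.mul_div_cancel _ (by omega)])
      exact ⟨j, hj, h1, i, hi, h2, mul_comm _ _⟩
  · rintro ⟨i, h1, h2, j, h3, h4, rfl⟩
    have h5 := Finset.nextAbove_spec hmm h2
    exact ⟨_, (Nat.dvd_of_mem_divisors h5.1).mul_right p, (Nat.mul_pos hm hp.pos).ne', i, j, h1,
      h5.2, h3, h4, rfl⟩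

/-- The products that are new for `m q`, compared with `m p`, are those visited by the second
algorithm. -/
theorem deltaProducts_union_markedProducts {m p q : ℕ} (hm : 0 < m) (hp : p.Prime)
    (hq : q.Prime) (hpq : p < q) :
    deltaProducts (m * p) ∪ markedProducts (fun i => m * p / m.divisors.nextAbove i)
      (fun i => m * q / m.divisors.nextAbove i) m = deltaProducts (m * q) := by
  have hmm : m ∈ m.divisors := Nat.mem_divisors.2 ⟨dvd_rfl, by omega⟩
  ext x
  rw [Finset.mem_union, mem_deltaProducts_mul_prime hm hp, mem_deltaProducts_mul_prime hm hq,
    mem_markedProducts]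
  constructor
  · rintro (⟨i, h1, h2, j, h3, h4, rfl⟩ | ⟨i, h1, h2, j, h3, h4, rfl⟩)
    · exact ⟨i, h1, h2, j, h3,
        h4.trans_le (Nat.div_le_div_right (Nat.mul_le_mul_left _ hpq.le)), rfl⟩
    · refine ⟨i, h1, h2, j, ?_, h4, rfl⟩
      have h5 := Finset.nextAbove_spec hmm h2
      have h6 : 0 < m * p / m.divisors.nextAbove i :=
        Nat.div_pos ((Nat.divisor_le h5.1).trans (Nat.le_mul_of_pos_right _ hp.pos)) (by omega)
      omega
  · rintro ⟨i, h1, h2, j, h3, h4, rfl⟩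
    by_cases h : j < m * p / m.divisors.nextAbove i
    · exact Or.inl ⟨i, h1, h2, j, h3, h, rfl⟩
    · exact Or.inr ⟨i, h1, h2, j, by omega, h4, rfl⟩

/-- The integer version of `m (1 + 1/2 + ⋯ + 1/m)`. -/
def harmonicMul (m : ℕ) : ℕ := ∑ i ∈ Finset.range m, m / (i + 1)

theorem le_harmonicMul (m : ℕ) : m ≤ harmonicMul m := by
  calc m = ∑ i ∈ Finset.range m, 1 := by simp
    _ ≤ harmonicMul m := Finset.sum_le_sum fun i hi => by
      have := Finset.mem_range.1 hi
      exact Nat.div_pos (by omega) (by omega)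

theorem harmonicMul_le (m : ℕ) : (harmonicMul m : ℝ) ≤ m * (1 + Real.log m) := by
  have h1 : (harmonicMul m : ℝ) ≤ m * (harmonic m : ℚ) := by
    rw [harmonicMul, harmonic]
    push_cast
    rw [Finset.mul_sum]
    refine Finset.sum_le_sum fun i _ => ?_
    have := @Nat.cast_div_le ℝ _ _ _ m (i + 1)
    push_cast at this
    rwa [div_eq_mul_inv] at this
  exact h1.trans (mul_le_mul_of_nonneg_left (harmonic_le_one_add_log m) (by positivity))

/-! ### The two algorithms -/

/-- The bit vector `b` marks the elements of `F` below `L`. -/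
def Marks (b : ℕ → ℕ) (F : Finset ℕ) (L : ℕ) : Prop := ∀ x < L, b x = if x ∈ F then 1 else 0

theorem Marks.update {b : ℕ → ℕ} {F : Finset ℕ} {L : ℕ} (h : Marks b F L) (x : ℕ) :
    Marks (Function.update b x 1) (insert x F) L := by
  intro y hy
  by_cases hxy : y = x
  · simp [hxy]
  · simp [hxy, h y hy]

theorem Marks.sum_range {b : ℕ → ℕ} {F : Finset ℕ} {L : ℕ} (h : Marks b F L)
    (hF : ∀ x ∈ F, x < L) : ∑ x ∈ Finset.range L, b x = F.card := by
  rw [Finset.sum_congr rfl fun x hx => h x (Finset.mem_range.1 hx), Finset.sum_ite_mem,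
    Finset.inter_eq_right.2 (fun x hx => Finset.mem_range.2 (hF x hx))]
  simp

/-- The body of the loop that clears the bit vector. -/
def clearBody : Cmd := .block [.store .bits (.var .t) (.const 0), .incr .t]

/-- The guard bound `g` is an expression with the constant value `B` during the loop. -/
theorem wp_clear {w B : ℕ} {g : Expr} {X : Config} (hB : B < 2 ^ w) (h1 : 1 < 2 ^ w)
    (hg : ∀ Y, Frame clearBody X Y → g.eval w Y.st = B) (ht : X.st.var .t = 0) :
    Wp w (.loop (.lt (.var .t) g) clearBody) (fun Y =>
      (∀ x < B, Y.st.arr .bits x = 0) ∧ (∀ x, B ≤ x → Y.st.arr .bits x = X.st.arr .bits x) ∧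
      Y.time ≤ X.time + (g.cost + 10) * B + (g.cost + 3)) X := by
  refine Wp.loop (fun i Y => i ≤ B ∧ Y.st.var .t = i ∧ (∀ x < i, Y.st.arr .bits x = 0) ∧
      (∀ x, i ≤ x → Y.st.arr .bits x = X.st.arr .bits x) ∧
      Y.time ≤ X.time + (g.cost + 10) * i) B 0 ?_ ?_ ?_ ?_
  · simp [ht]
  · exact fun i Y h => h.1
  · rintro i Y hF ⟨hi, ht, h2, h3, h4⟩ he
    simp only [Expr.lt, Expr.eval, Op.eval, hg Y hF, ht, ite_eq_right_iff, one_ne_zero, imp_false,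
      not_lt] at he
    obtain rfl : i = B := by omega
    refine ⟨h2, h3, ?_⟩
    simp only [Expr.lt, Expr.cost]
    omega
  · rintro i Y hF ⟨hi, ht, h2, h3, h4⟩ he
    simp only [Expr.lt, Expr.eval, Op.eval, hg Y hF, ht, ne_eq, ite_eq_right_iff, one_ne_zero,
      imp_false, not_not] at he
    simp only [clearBody, Cmd.block_cons_cons, Cmd.block_singleton, Cmd.incr]
    refine Wp.seq (Wp.store (Wp.assign ?_))
    have hm : (i + 1) % 2 ^ w = i + 1 := Nat.mod_eq_of_lt (by omega)
    simp only [Expr.eval, Op.eval, ht, Nat.mod_eq_of_lt h1, Nat.zero_mod, State.setVar_var,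
      State.setArr_var, State.setVar_arr, State.setArr_arr, if_true, hm, Expr.cost, Expr.lt]
    refine ⟨by omega, trivial, fun x hx => ?_, fun x hx => ?_, ?_⟩
    · by_cases hxi : x = i
      · simp [hxi]
      · rw [Function.update_of_ne hxi]; exact h2 x (by omega)
    · rw [Function.update_of_ne (by omega)]; exact h3 x (by omega)
    · rw [mul_add]; omega

/-- The body of the loop over `j` in the first algorithm. -/
def markBody : Cmd := .block [.store .bits .ij (.const 1), .incr .j]

/-- The inner loop marks the products of `i` with the `j` from the initial value up to `b`. -/
theorem wp_mark {w i b L : ℕ} {g : Expr} {F : Finset ℕ} {X : Config} (h1 : 1 < 2 ^ w)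
    (hL : L < 2 ^ w) (hi : X.st.var .i = i) (hi1 : 1 ≤ i)
    (hg : ∀ Y, Frame markBody X Y → g.eval w Y.st = b)
    (hb : ∀ j < b, i * j < L) (hF : Marks (X.st.arr .bits) F L) :
    Wp w (.loop (.lt (.var .j) g) markBody) (fun Y =>
      Marks (Y.st.arr .bits) (F ∪ (Finset.Ico (X.st.var .j) b).image (i * ·)) L ∧
      (∀ x, L ≤ x → Y.st.arr .bits x = X.st.arr .bits x) ∧
      Y.time ≤ X.time + (g.cost + 12) * (b - X.st.var .j) + (g.cost + 3)) X := by
  generalize ha : X.st.var .j = a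
  refine Wp.loop (fun j Y => (a ≤ j ∧ (j ≤ b ∨ j = a)) ∧ Y.st.var .j = j ∧
      Marks (Y.st.arr .bits) (F ∪ (Finset.Ico a j).image (i * ·)) L ∧
      (∀ x, L ≤ x → Y.st.arr .bits x = X.st.arr .bits x) ∧
      Y.time ≤ X.time + (g.cost + 12) * (j - a)) (max a b) a ?_ ?_ ?_ ?_
  · simpa [ha] using hF
  · rintro j Y ⟨h, -⟩; omega
  · rintro j Y hFr ⟨hj, hjv, h2, h3, h4⟩ he
    simp only [Expr.lt, Expr.eval, Op.eval, hg Y hFr, hjv, ite_eq_right_iff, one_ne_zero,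
      imp_false, not_lt] at he
    have h5 : Finset.Ico a j = Finset.Ico a b := by
      ext x; simp only [Finset.mem_Ico]; omega
    have h6 : j - a = b - a := by omega
    rw [h5] at h2; rw [h6] at h4
    refine ⟨h2, h3, ?_⟩
    simp only [Expr.lt, Expr.cost]
    omega
  · rintro j Y hFr ⟨hj, hjv, h2, h3, h4⟩ he
    simp only [Expr.lt, Expr.eval, Op.eval, hg Y hFr, hjv, ne_eq, ite_eq_right_iff, one_ne_zero,
      imp_false, not_not] at he
    have hiv : Y.st.var .i = i := (hFr.var .i rfl).trans hi
    simp only [markBody, Cmd.block_cons_cons, Cmd.block_singleton, Cmd.incr]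
    refine Wp.seq (Wp.store (Wp.assign ?_))
    have hij := hb j he
    have hjj : j ≤ i * j := Nat.le_mul_of_pos_left _ hi1
    have hm : (j + 1) % 2 ^ w = j + 1 := Nat.mod_eq_of_lt (by omega)
    have hm' : (i * j) % 2 ^ w = i * j := Nat.mod_eq_of_lt (by omega)
    simp only [Expr.eval, Op.eval, hjv, hiv, Nat.mod_eq_of_lt h1, State.setVar_var, Expr.ij,
      State.setArr_var, State.setVar_arr, State.setArr_arr, if_true, hm, hm', Expr.cost, Expr.lt]
    refine ⟨by omega, trivial, ?_, fun x hx => ?_, ?_⟩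
    · have h7 : F ∪ (Finset.Ico a (j + 1)).image (i * ·) =
          insert (i * j) (F ∪ (Finset.Ico a j).image (i * ·)) := by
        rw [← Finset.insert_Ico_right_eq_Ico_add_one hj.1, Finset.image_insert,
          Finset.union_insert]
      rw [h7]
      exact h2.update _
    · rw [Function.update_of_ne (by omega)]; exact h3 x (by omega)
    · have h8 : j + 1 - a = (j - a) + 1 := by omega
      rw [h8, mul_add]; omega

/-- The position of the least element of `S` above `i`: it is the number of elements below `i`,
increased by one if `i` itself is an element. -/
theorem State.HoldsPairs.next {s : State} {a b : Arr} {S : Finset ℕ} {N i D : ℕ}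
    (h : s.HoldsPairs a b S N) (hD : D ∈ S) (hi : i < D) :
    s.arr b (S.countBelow (i + 1)) = N / S.nextAbove i := by
  rw [← Finset.countBelow_nextAbove hD hi]
  exact ((State.holdsPairs_iff.1 h).2 _ (Finset.nextAbove_spec hD hi).1).2

theorem State.HoldsPairs.fst_eq_iff {s : State} {a b : Arr} {S : Finset ℕ} {N i D : ℕ}
    (h : s.HoldsPairs a b S N) (hD : D ∈ S) (hi : i < D) :
    s.arr a (S.countBelow i) = i ↔ i ∈ S := by
  constructor
  · intro hx
    by_contra hn
    have h2 : S.countBelow (S.nextAbove i) = S.countBelow i := by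
      rw [Finset.countBelow_nextAbove hD hi, Finset.countBelow_succ, if_neg hn, add_zero]
    have h3 := Finset.nextAbove_spec hD hi
    have h4 := ((State.holdsPairs_iff.1 h).2 _ h3.1).1
    rw [h2, hx] at h4
    omega
  · exact fun hx => ((State.holdsPairs_iff.1 h).2 i hx).1

theorem State.HoldsPairs.last {s : State} {a b : Arr} {S : Finset ℕ} {N D : ℕ}
    (h : s.HoldsPairs a b S N) (hD : D ∈ S) (hmax : ∀ x ∈ S, x ≤ D) :
    s.arr a (s.var .len - 1) = D := by
  have h2 := State.holdsPairs_iff.1 h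
  rw [h2.1, ← Finset.countBelow_of_forall_le hD hmax]
  exact (h2.2 D hD).1

theorem State.HoldsPairs.congr {s s' : State} {a b : Arr} {S : Finset ℕ} {N : ℕ}
    (h : s.HoldsPairs a b S N) (hlen : s'.var .len = s.var .len) (ha : s'.arr a = s.arr a)
    (hb : s'.arr b = s.arr b) : s'.HoldsPairs a b S N := by
  rw [State.HoldsPairs, hlen, ha, hb]; exact h

/-- The step by which both algorithms move `k` to the least divisor above `i`. -/
def advance : Cmd := .ite (.eq (.var .i) (.read .fst (.var .k))) (.incr .k) .skip

theorem wp_advance {w i N D : ℕ} {b : Arr} {S : Finset ℕ} {X : Config} (h1 : 1 < 2 ^ w)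
    (hp : X.st.HoldsPairs .fst b S N) (hD : D ∈ S) (hi : i < D)
    (hiv : X.st.var .i = i) (hk : X.st.var .k = S.countBelow i)
    (hcard : S.card < 2 ^ w) {Q : Config → Prop}
    (hQ : ∀ t ≤ X.time + 9,
      Q ⟨X.st.setVar .k (S.countBelow (i + 1)), t, X.calls⟩) : Wp w advance Q X := by
  have hev : (Expr.eq (.var .i) (.read .fst (.var .k))).eval w X.st = if i ∈ S then 1 else 0 := by
    simp only [Expr.eq, Expr.eval, Op.eval, hiv, hk]
    by_cases h : i ∈ S
    · rw [if_pos h, if_pos ((hp.fst_eq_iff hD hi).2 h).symm]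
    · rw [if_neg h, if_neg (fun h' => h ((hp.fst_eq_iff hD hi).1 h'.symm))]
  refine Wp.ite (fun he => Wp.assign ?_) (fun he => Wp.skip ?_) <;> rw [hev] at he
  · have hiS : i ∈ S := by by_contra h; simp [h] at he
    have h2 : S.countBelow (i + 1) = S.countBelow i + 1 := by
      rw [Finset.countBelow_succ, if_pos hiS]
    have h3 := Finset.countBelow_lt_card hiS
    rw [h2] at hQ
    simp only [Expr.eval, Op.eval, hk, Nat.mod_eq_of_lt h1,
      Nat.mod_eq_of_lt (show S.countBelow i + 1 < 2 ^ w by omega), Expr.cost, Expr.eq]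
    exact hQ _ (by omega)
  · have hiS : i ∉ S := by intro h; simp [h] at he
    have h2 : S.countBelow (i + 1) = X.st.var .k := by
      rw [Finset.countBelow_succ, if_neg hiS, hk, add_zero]
    have h3 : X.st.setVar .k (S.countBelow (i + 1)) = X.st := by
      rw [h2, State.setVar, Function.update_eq_self]
    rw [h3] at hQ
    exact hQ _ (by simp only [Expr.cost, Expr.eq]; omega)

theorem card_le_of_mem_Icc {S : Finset ℕ} {D : ℕ} (h0 : ∀ x ∈ S, 0 < x) (hmax : ∀ x ∈ S, x ≤ D) :
    S.card ≤ D := by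
  have : S ⊆ Finset.Icc 1 D := fun x hx => Finset.mem_Icc.2 ⟨h0 x hx, hmax x hx⟩
  simpa using Finset.card_le_card this

/-- The body of the loop over `i` in the first algorithm. -/
def deltaBody : Cmd := .block [advance, .assign .j (.var .i),
  .loop (.lt (.var .j) (.read .snd (.var .k))) markBody, .incr .i]

/-- The round `i` takes at most `N / d ≤ N / (i + 1)` steps, where `d` is the divisor following `i`;
the sum over `i` is bounded by `harmonicMul N`. -/
theorem wp_deltaLoop {w N : ℕ} {X : Config} (h1 : 1 < 2 ^ w) (hw : N < 2 ^ w)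
    (hin : X.st.IsDeltaInput N) (hi : X.st.var .i = 1) (hk : X.st.var .k = 0)
    (hX : Marks (X.st.arr .bits) ∅ N) :
    Wp w (.loop (.lt (.var .i) .lastFst) deltaBody) (fun Y =>
      Marks (Y.st.arr .bits) (deltaProducts N) N ∧
      (∀ x, N ≤ x → Y.st.arr .bits x = X.st.arr .bits x) ∧
      Y.time ≤ X.time + 50 * harmonicMul N) X := by
  obtain ⟨hN, hp⟩ := hin
  change X.st.HoldsPairs .fst .snd (smallDivisors N) N at hp
  have hS : ∀ x, x ∈ smallDivisors N ↔ x ∣ N ∧ N ≠ 0 ∧ x * x ≤ N := by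
    simp [smallDivisors, and_assoc]
  have h1S : 1 ∈ smallDivisors N := (hS 1).2 ⟨one_dvd _, by omega, by omega⟩
  obtain ⟨D, hD, hmax⟩ : ∃ D ∈ smallDivisors N, ∀ x ∈ smallDivisors N, x ≤ D :=
    ⟨_, Finset.max'_mem _ ⟨1, h1S⟩, fun x hx => Finset.le_max' _ x hx⟩
  have hDN : D ≤ N := Nat.le_of_dvd hN ((hS D).1 hD).1
  have hpos : ∀ x ∈ smallDivisors N, 0 < x := fun x hx => Nat.pos_of_dvd_of_pos ((hS x).1 hx).1 hN
  have hcard := card_le_of_mem_Icc hpos hmax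
  have h1D := hmax 1 h1S
  have hGN := le_harmonicMul N
  refine Wp.loop (fun i Y => (1 ≤ i ∧ i ≤ D) ∧ Y.st.var .i = i ∧
      Y.st.var .k = (smallDivisors N).countBelow i ∧
      Marks (Y.st.arr .bits) (markedProducts (fun i => i)
        (fun i => N / (smallDivisors N).nextAbove i) i) N ∧
      (∀ x, N ≤ x → Y.st.arr .bits x = X.st.arr .bits x) ∧
      Y.time ≤ X.time + 42 * ∑ i' ∈ Finset.range i, N / (i' + 1)) D 1 ?_ ?_ ?_ ?_
  · refine ⟨⟨le_rfl, h1D⟩, hi, ?_, by simpa [markedProducts] using hX, fun _ _ => rfl, by omega⟩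
    rw [hk, Finset.countBelow, eq_comm, Finset.card_eq_zero, Finset.filter_eq_empty_iff]
    intro x hx; have := hpos x hx; omega
  · exact fun i Y h => h.1.2
  · rintro i Y hF ⟨hi, hiv, hkv, h2, h3, h4⟩ he
    have hpY : Y.st.HoldsPairs .fst .snd (smallDivisors N) N :=
      hp.congr (hF.var _ rfl) (hF.arr _ rfl) (hF.arr _ rfl)
    simp only [Expr.lt, Expr.lastFst, Expr.eval, Op.eval, Nat.mod_eq_of_lt h1, hiv,
      hpY.last hD hmax, ite_eq_right_iff, one_ne_zero, imp_false, not_lt] at he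
    obtain rfl : i = D := by omega
    rw [markedProducts_smallDivisors hD hmax] at h2
    refine ⟨h2, h3, ?_⟩
    have h5 : ∑ i' ∈ Finset.range i, N / (i' + 1) ≤ harmonicMul N :=
      Finset.sum_le_sum_of_subset (Finset.range_subset_range.2 hDN)
    simp only [Expr.lt, Expr.cost, Expr.lastFst]
    omega
  · rintro i Y hF ⟨hi, hiv, hkv, h2, h3, h4⟩ he
    have hpY : Y.st.HoldsPairs .fst .snd (smallDivisors N) N :=
      hp.congr (hF.var _ rfl) (hF.arr _ rfl) (hF.arr _ rfl)
    simp only [Expr.lt, Expr.lastFst, Expr.eval, Op.eval, Nat.mod_eq_of_lt h1, hiv,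
      hpY.last hD hmax, ne_eq, ite_eq_right_iff, one_ne_zero, imp_false, not_not] at he
    have hnx := Finset.nextAbove_spec hD he
    have hnxD := hmax _ hnx.1
    simp only [deltaBody, Cmd.block_cons_cons, Cmd.block_singleton, Cmd.incr]
    refine Wp.seq ?_
    refine wp_advance (S := smallDivisors N) (N := N) (b := .snd) h1 ?_ hD he ?_ ?_ (by omega) ?_
    · exact hpY
    · exact hiv
    · exact hkv
    intro t ht
    simp only [Expr.lt, Expr.cost, Expr.lastFst] at ht
    refine Wp.seq (Wp.assign (Wp.seq ((wp_mark (i := i) (L := N)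
      (b := N / (smallDivisors N).nextAbove i)
      (F := markedProducts (fun i => i) (fun i => N / (smallDivisors N).nextAbove i) i)
      h1 hw ?_ hi.1 ?_ ?_ ?_).mono ?_)))
    · simpa [Expr.eval] using hiv
    · intro Z hZ
      simp only [Expr.eval, hZ.var .k rfl, hZ.arr .snd rfl]
      simpa using hpY.next hD he
    · exact fun j hj => mul_lt_of_lt_div hnx.2 hj
    · simpa using h2
    · rintro Z hZ ⟨h5, h6, h7⟩
      refine Wp.assign ?_
      simp only [Expr.eval, Expr.cost, State.setVar_var, State.setVar_arr, if_true, reduceCtorEq,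
        if_false, hiv] at h5 h6 h7
      have hiZ : Z.st.var .i = i := by
        rw [hZ.var .i rfl]; simpa [Expr.eval] using hiv
      have hkZ : Z.st.var .k = (smallDivisors N).countBelow (i + 1) := by
        rw [hZ.var .k rfl]; simp
      simp only [Expr.eval, Op.eval, hiZ, hkZ, Nat.mod_eq_of_lt h1, State.setVar_var,
        State.setVar_arr, if_true, reduceCtorEq, if_false, Expr.cost,
        Nat.mod_eq_of_lt (show i + 1 < 2 ^ w by omega)]
      refine ⟨by omega, trivial, trivial, ?_, fun x hx => (h6 x hx).trans (h3 x hx), ?_⟩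
      · rw [markedProducts_succ hi.1]; exact h5
      · have h8 : N / (smallDivisors N).nextAbove i ≤ N / (i + 1) :=
          Nat.div_le_div_left hnx.2 (by omega)
        have h9 : 1 ≤ N / (i + 1) := Nat.div_pos (by omega) (by omega)
        rw [Finset.sum_range_succ]
        omega

/-- The body of the loop that adds up the bits. -/
def weightBody : Cmd :=
  .block [.assign .weight (.bin .add (.var .weight) (.read .bits (.var .t))), .incr .t]

theorem wp_weight {w N : ℕ} {F : Finset ℕ} {X : Config} (h1 : 1 < 2 ^ w) (hw : N < 2 ^ w)
    (hN : X.st.arr .snd 0 = N) (hF : ∀ x ∈ F, x < N) (hX : Marks (X.st.arr .bits) F N)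
    (ht : X.st.var .t = 0) (hwt : X.st.var .weight = 0) :
    Wp w (.loop (.lt (.var .t) (.read .snd (.const 0))) weightBody)
      (fun Y => Y.st.var .weight = F.card ∧ Y.time ≤ X.time + 14 * N + 5) X := by
  refine Wp.loop (fun i Y => i ≤ N ∧ Y.st.var .t = i ∧
      Y.st.var .weight = ∑ x ∈ Finset.range i, X.st.arr .bits x ∧
      Y.time ≤ X.time + 14 * i) N 0 (by simp [ht, hwt]) (fun i Y h => h.1) ?_ ?_
  · rintro i Y hFr ⟨hi, hiv, h2, h3⟩ he
    simp only [Expr.lt, Expr.eval, Op.eval, hiv, Nat.zero_mod, hFr.arr .snd rfl, hN,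
      ite_eq_right_iff, one_ne_zero, imp_false, not_lt] at he
    obtain rfl : i = N := by omega
    rw [hX.sum_range hF] at h2
    exact ⟨h2, by simp only [Expr.lt, Expr.cost]; omega⟩
  · rintro i Y hFr ⟨hi, hiv, h2, h3⟩ he
    simp only [Expr.lt, Expr.eval, Op.eval, hiv, Nat.zero_mod, hFr.arr .snd rfl, hN, ne_eq,
      ite_eq_right_iff, one_ne_zero, imp_false, not_not] at he
    simp only [weightBody, Cmd.block_cons_cons, Cmd.block_singleton, Cmd.incr]
    refine Wp.seq (Wp.assign (Wp.assign ?_))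
    have h4 : ∑ x ∈ Finset.range (i + 1), X.st.arr .bits x ≤ N := by
      calc _ ≤ ∑ x ∈ Finset.range N, X.st.arr .bits x :=
            Finset.sum_le_sum_of_subset (Finset.range_subset_range.2 he)
        _ = F.card := hX.sum_range hF
        _ ≤ (Finset.range N).card :=
            Finset.card_le_card fun x hx => Finset.mem_range.2 (hF x hx)
        _ = N := Finset.card_range N
    rw [Finset.sum_range_succ] at h4
    simp only [Expr.eval, Op.eval, hiv, h2, Nat.mod_eq_of_lt h1, State.setVar_var,
      if_true, reduceCtorEq, if_false, Expr.cost, hFr.arr .bits rfl,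
      Finset.sum_range_succ,
      Nat.mod_eq_of_lt (show i + 1 < 2 ^ w by omega), Nat.mod_eq_of_lt (h4.trans_lt hw)]
    exact ⟨by omega, trivial, trivial, by simp only [Expr.lt, Expr.cost]; omega⟩

/-- The first algorithm is correct, and takes time `O(harmonicMul N) = O(N log N)`. -/
theorem wp_algDelta {w N : ℕ} {X : Config} (h1 : 1 < 2 ^ w) (hw : N < 2 ^ w)
    (hin : X.st.IsDeltaInput N) : Wp w algDelta (fun Y =>
      Y.st.var .weight = deltaCount N ∧ Marks (Y.st.arr .bits) (deltaProducts N) N ∧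
      (∀ x, N ≤ x → Y.st.arr .bits x = X.st.arr .bits x) ∧
      Y.time ≤ X.time + 100 * harmonicMul N) X := by
  have hN := hin.1
  have hGN := le_harmonicMul N
  have hsnd : X.st.arr .snd 0 = N := by
    have h1S : 1 ∈ smallDivisors N := by
      simp only [smallDivisors, Finset.mem_filter, Nat.mem_divisors]
      exact ⟨⟨one_dvd _, by omega⟩, by omega⟩
    have h0 : (smallDivisors N).countBelow 1 = 0 := by
      rw [Finset.countBelow, Finset.card_eq_zero, Finset.filter_eq_empty_iff]
      intro x hx
      have := Nat.pos_of_mem_divisors (Finset.mem_filter.1 hx).1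
      omega
    have := ((State.holdsPairs_iff.1 hin.2).2 1 h1S).2
    change X.st.arr .snd ((smallDivisors N).countBelow 1) = N / 1 at this
    rwa [h0, Nat.div_one] at this
  have hIn : ∀ Y : Config, Y.st.var .len = X.st.var .len → Y.st.arr .fst = X.st.arr .fst →
      Y.st.arr .snd = X.st.arr .snd → Y.st.IsDeltaInput N :=
    fun Y h h' h'' => ⟨hN, hin.2.congr h h' h''⟩
  simp only [algDelta, Cmd.block_cons_cons]
  refine Wp.seq (Wp.assign (Wp.seq ((wp_clear (B := N) hw h1 ?_ ?_).mono ?_)))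
  · intro Y hY
    simp only [Expr.eval, Nat.zero_mod, hY.arr .snd rfl]
    exact hsnd
  · simp [Expr.eval]
  rintro Y hY ⟨h2, h3, h4⟩
  refine Wp.seq (Wp.assign (Wp.seq (Wp.assign (Wp.seq ((wp_deltaLoop h1 hw (hIn _ ?_ ?_ ?_)
    ?_ ?_ ?_).mono ?_)))))
  · simpa using hY.var .len rfl
  · simpa using hY.arr .fst rfl
  · simpa using hY.arr .snd rfl
  · simp [Expr.eval, Nat.mod_eq_of_lt h1]
  · simp [Expr.eval]
  · intro x hx; simpa using h2 x hx
  rintro Z hZ ⟨h5, h6, h7⟩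
  have hZs : Z.st.arr .snd 0 = N := by
    rw [hZ.arr .snd rfl]
    simp only [State.setVar_arr]
    rw [hY.arr .snd rfl]
    exact hsnd
  refine Wp.seq (Wp.assign (Wp.seq (Wp.assign ((wp_weight (F := deltaProducts N) h1 hw ?_ ?_ ?_ ?_
    ?_).mono ?_))))
  · simpa using hZs
  · exact fun x hx => lt_of_mem_deltaProducts hx
  · simpa using h5
  · simp [Expr.eval]
  · simp [Expr.eval]
  rintro V hV ⟨h8, h9⟩
  have hVb : V.st.arr .bits = Z.st.arr .bits := by simpa using hV.arr .bits rfl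
  rw [hVb, deltaCount_eq_card hN]
  refine ⟨h8, h5, fun x hx => ?_, ?_⟩
  · rw [h6 x hx]
    simpa using h3 x hx
  · simp only [Expr.cost] at h4 h7 h9
    omega

/-- The body of the loop over `j` in the second algorithm. -/
def recountBody : Cmd := .block [
  .ite (.eq (.read .bits .ij) (.const 0)) (.block [.store .bits .ij (.const 1), .incr .weight])
    .skip,
  .incr .j]

/-- The inner loop marks products and keeps `weight` equal to the number of marked ones. -/
theorem wp_recount {w i b L : ℕ} {g : Expr} {F : Finset ℕ} {X : Config} (h1 : 1 < 2 ^ w)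
    (hL : L < 2 ^ w) (hi : X.st.var .i = i) (hi1 : 1 ≤ i)
    (hg : ∀ Y, Frame recountBody X Y → g.eval w Y.st = b)
    (hb : ∀ j < b, i * j < L) (hFL : ∀ x ∈ F, x < L) (hF : Marks (X.st.arr .bits) F L)
    (hwt : X.st.var .weight = F.card) :
    Wp w (.loop (.lt (.var .j) g) recountBody) (fun Y =>
      Marks (Y.st.arr .bits) (F ∪ (Finset.Ico (X.st.var .j) b).image (i * ·)) L ∧
      Y.st.var .weight = (F ∪ (Finset.Ico (X.st.var .j) b).image (i * ·)).card ∧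
      (∀ x, L ≤ x → Y.st.arr .bits x = X.st.arr .bits x) ∧
      Y.time ≤ X.time + (g.cost + 24) * (b - X.st.var .j) + (g.cost + 3)) X := by
  generalize ha : X.st.var .j = a
  refine Wp.loop (fun j Y => (a ≤ j ∧ (j ≤ b ∨ j = a)) ∧ Y.st.var .j = j ∧
      Marks (Y.st.arr .bits) (F ∪ (Finset.Ico a j).image (i * ·)) L ∧
      Y.st.var .weight = (F ∪ (Finset.Ico a j).image (i * ·)).card ∧
      (∀ x, L ≤ x → Y.st.arr .bits x = X.st.arr .bits x) ∧
      Y.time ≤ X.time + (g.cost + 24) * (j - a)) (max a b) a ?_ ?_ ?_ ?_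
  · simpa [ha, hwt] using hF
  · rintro j Y ⟨h, -⟩; omega
  · rintro j Y hFr ⟨hj, hjv, h2, hw2, h3, h4⟩ he
    simp only [Expr.lt, Expr.eval, Op.eval, hg Y hFr, hjv, ite_eq_right_iff, one_ne_zero,
      imp_false, not_lt] at he
    have h5 : Finset.Ico a j = Finset.Ico a b := by
      ext x; simp only [Finset.mem_Ico]; omega
    have h6 : j - a = b - a := by omega
    rw [h5] at h2 hw2; rw [h6] at h4
    refine ⟨h2, hw2, h3, ?_⟩
    simp only [Expr.lt, Expr.cost]
    omega
  · rintro j Y hFr ⟨hj, hjv, h2, hw2, h3, h4⟩ he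
    simp only [Expr.lt, Expr.eval, Op.eval, hg Y hFr, hjv, ne_eq, ite_eq_right_iff, one_ne_zero,
      imp_false, not_not] at he
    have hiv : Y.st.var .i = i := (hFr.var .i rfl).trans hi
    simp only [recountBody, Cmd.block_cons_cons, Cmd.block_singleton, Cmd.incr]
    have hij := hb j he
    have hjj : j ≤ i * j := Nat.le_mul_of_pos_left _ hi1
    have hm : (j + 1) % 2 ^ w = j + 1 := Nat.mod_eq_of_lt (by omega)
    have hm' : (i * j) % 2 ^ w = i * j := Nat.mod_eq_of_lt (by omega)
    have h7 : F ∪ (Finset.Ico a (j + 1)).image (i * ·) =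
        insert (i * j) (F ∪ (Finset.Ico a j).image (i * ·)) := by
      rw [← Finset.insert_Ico_right_eq_Ico_add_one hj.1, Finset.image_insert,
        Finset.union_insert]
    have h8 : j + 1 - a = (j - a) + 1 := by omega
    have hlt : ∀ x ∈ insert (i * j) (F ∪ (Finset.Ico a j).image (i * ·)), x ∈ Finset.range L := by
      intro x hx
      simp only [Finset.mem_insert, Finset.mem_union, Finset.mem_image, Finset.mem_Ico] at hx
      rw [Finset.mem_range]
      rcases hx with rfl | hx | ⟨j', hj', rfl⟩
      · exact hij
      · exact hFL x hx
      · exact hb j' (by omega)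
    have hcL : (insert (i * j) (F ∪ (Finset.Ico a j).image (i * ·))).card ≤ L := by
      simpa using Finset.card_le_card hlt
    rw [h7, h8, mul_add]
    generalize F ∪ (Finset.Ico a j).image (i * ·) = G at *
    refine Wp.seq (Wp.ite (fun he' => ?_) fun he' => ?_)
    · simp only [Expr.eq, Expr.eval, Op.eval, Expr.ij, hjv, hiv, hm', Nat.zero_mod, h2 _ hij, ne_eq,
        ite_eq_right_iff, one_ne_zero, imp_false, not_not] at he'
      rw [Finset.card_insert_of_notMem he'] at hcL ⊢
      refine Wp.seq (Wp.store (Wp.assign (Wp.assign ?_)))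
      simp only [Expr.eval, Op.eval, hjv, hiv, hw2, Nat.mod_eq_of_lt h1, State.setVar_var, Expr.ij,
        State.setArr_var, State.setVar_arr, State.setArr_arr, if_true, hm, hm', Expr.cost, Expr.lt,
        reduceCtorEq, if_false, Nat.mod_eq_of_lt (hcL.trans_lt hL), Expr.eq]
      refine ⟨by omega, trivial, h2.update _, trivial, fun x hx => ?_, by omega⟩
      rw [Function.update_of_ne (by omega)]; exact h3 x hx
    · have hmem : i * j ∈ G := by
        by_contra hn
        simp [Expr.eq, Expr.eval, Op.eval, Expr.ij, hjv, hiv, hm', h2 _ hij, hn] at he'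
      rw [Finset.insert_eq_of_mem hmem]
      refine Wp.skip (Wp.assign ?_)
      simp only [Expr.eval, Op.eval, hjv, hw2, Nat.mod_eq_of_lt h1, State.setVar_var, Expr.ij,
        State.setVar_arr, if_true, hm, Expr.cost, Expr.lt, reduceCtorEq, if_false, Expr.eq]
      exact ⟨by omega, trivial, h2, trivial, h3, by omega⟩

/-- The body of the loop over `i` in the second algorithm. -/
def multipliersBody : Cmd := .block [advance, .assign .j (.read .snd (.var .k)),
  .loop (.lt (.var .j) (.read .snd' (.var .k))) recountBody, .incr .i]

theorem wp_multipliersLoop {w m p q : ℕ} {X : Config} (h1 : 1 < 2 ^ w) (hw : m * q < 2 ^ w)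
    (hin : X.st.IsMultipliersInput m p q) (hi : X.st.var .i = 1) (hk : X.st.var .k = 0) :
    Wp w (.loop (.lt (.var .i) .lastFst) multipliersBody) (fun Y =>
      Y.st.var .weight = (deltaProducts (m * q)).card ∧
      Marks (Y.st.arr .bits) (deltaProducts (m * q)) (m * q) ∧
      (∀ x, m * q ≤ x → Y.st.arr .bits x = X.st.arr .bits x) ∧
      Y.time ≤ X.time + 80 * ((q - p) * harmonicMul m)) X := by
  obtain ⟨hm, hp, hq, hpq, hbits, hwt, hdp, hdq⟩ := hin
  have hS : ∀ x, x ∈ m.divisors ↔ x ∣ m ∧ m ≠ 0 := by simp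
  have hD : m ∈ m.divisors := (hS m).2 ⟨dvd_rfl, by omega⟩
  have hmax : ∀ x ∈ m.divisors, x ≤ m := fun x hx => Nat.divisor_le hx
  have hpos : ∀ x ∈ m.divisors, 0 < x := fun x hx => Nat.pos_of_mem_divisors hx
  have hcard := card_le_of_mem_Icc hpos hmax
  have hmq : m ≤ m * q := Nat.le_mul_of_pos_right _ hq.pos
  have hGm : m ≤ (q - p) * harmonicMul m :=
    (le_harmonicMul m).trans (Nat.le_mul_of_pos_left _ (by omega))
  have hmpq : m * p ≤ m * q := Nat.mul_le_mul_left _ hpq.le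
  refine Wp.loop (fun i Y => (1 ≤ i ∧ i ≤ m) ∧ Y.st.var .i = i ∧
      Y.st.var .k = m.divisors.countBelow i ∧
      Marks (Y.st.arr .bits) (deltaProducts (m * p) ∪
        markedProducts (fun i => m * p / m.divisors.nextAbove i)
        (fun i => m * q / m.divisors.nextAbove i) i) (m * q) ∧
      Y.st.var .weight = (deltaProducts (m * p) ∪
        markedProducts (fun i => m * p / m.divisors.nextAbove i)
        (fun i => m * q / m.divisors.nextAbove i) i).card ∧
      (∀ x, m * q ≤ x → Y.st.arr .bits x = X.st.arr .bits x) ∧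
      Y.time ≤ X.time + 70 * ((q - p) * ∑ i' ∈ Finset.range i, m / (i' + 1))) m 1 ?_ ?_ ?_ ?_
  · refine ⟨⟨le_rfl, hm⟩, hi, ?_, by simpa [markedProducts, Marks] using hbits,
      by simpa [markedProducts] using hwt, fun _ _ => rfl, by omega⟩
    rw [hk, Finset.countBelow, eq_comm, Finset.card_eq_zero, Finset.filter_eq_empty_iff]
    intro x hx; have := hpos x hx; omega
  · exact fun i Y h => h.1.2
  · rintro i Y hF ⟨hi, hiv, hkv, h2, hw2, h3, h4⟩ he
    have hpY : Y.st.HoldsPairs .fst .snd m.divisors (m * p) :=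
      hdp.congr (hF.var _ rfl) (hF.arr _ rfl) (hF.arr _ rfl)
    simp only [Expr.lt, Expr.lastFst, Expr.eval, Op.eval, Nat.mod_eq_of_lt h1, hiv,
      hpY.last hD hmax, ite_eq_right_iff, one_ne_zero, imp_false, not_lt] at he
    obtain rfl : i = m := by omega
    rw [deltaProducts_union_markedProducts hm hp hq hpq] at h2 hw2
    refine ⟨hw2, h2, h3, ?_⟩
    simp only [Expr.lt, Expr.cost, Expr.lastFst]
    rw [← harmonicMul] at h4
    omega
  · rintro i Y hF ⟨hi, hiv, hkv, h2, hw2, h3, h4⟩ he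
    have hpY : Y.st.HoldsPairs .fst .snd m.divisors (m * p) :=
      hdp.congr (hF.var _ rfl) (hF.arr _ rfl) (hF.arr _ rfl)
    have hqY : Y.st.HoldsPairs .fst' .snd' m.divisors (m * q) :=
      hdq.congr (hF.var _ rfl) (hF.arr _ rfl) (hF.arr _ rfl)
    simp only [Expr.lt, Expr.lastFst, Expr.eval, Op.eval, Nat.mod_eq_of_lt h1, hiv,
      hpY.last hD hmax, ne_eq, ite_eq_right_iff, one_ne_zero, imp_false, not_not] at he
    have hnx := Finset.nextAbove_spec hD he
    have hnxD := hmax _ hnx.1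
    have hnxd := (hS _).1 hnx.1
    have hkp := hpY.next hD he
    have hkq := hqY.next hD he
    simp only [multipliersBody, Cmd.block_cons_cons, Cmd.block_singleton, Cmd.incr]
    refine Wp.seq ?_
    refine wp_advance (S := m.divisors) (N := m * p) (b := .snd) h1 ?_ hD he ?_ ?_ (by omega) ?_
    · exact hpY
    · exact hiv
    · exact hkv
    intro t ht
    simp only [Expr.lt, Expr.cost, Expr.lastFst] at ht
    refine Wp.seq (Wp.assign (Wp.seq ((wp_recount (i := i) (L := m * q)
      (b := m * q / m.divisors.nextAbove i)
      (F := deltaProducts (m * p) ∪ markedProducts (fun i => m * p / m.divisors.nextAbove i)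
        (fun i => m * q / m.divisors.nextAbove i) i)
      h1 hw ?_ hi.1 ?_ ?_ ?_ ?_ ?_).mono ?_)))
    · simpa [Expr.eval] using hiv
    · intro Z hZ
      simp only [Expr.eval, hZ.var .k rfl, hZ.arr .snd' rfl]
      simpa using hkq
    · exact fun j hj => mul_lt_of_lt_div hnx.2 hj
    · intro x hx
      rcases Finset.mem_union.1 hx with hx | hx
      · exact (lt_of_mem_deltaProducts hx).trans_le hmpq
      · obtain ⟨i', h5, h6, j, h7, h8, rfl⟩ := mem_markedProducts.1 hx
        exact mul_lt_of_lt_div (Finset.nextAbove_spec hD (h6.trans he)).2 h8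
    · simpa using h2
    · simpa using hw2
    · rintro Z hZ ⟨h5, hw5, h6, h7⟩
      refine Wp.assign ?_
      simp only [Expr.eval, Expr.cost, State.setVar_var, State.setVar_arr, if_true, reduceCtorEq,
        if_false, hkp] at h5 hw5 h6 h7
      have hiZ : Z.st.var .i = i := by
        rw [hZ.var .i rfl]; simpa [Expr.eval] using hiv
      have hkZ : Z.st.var .k = m.divisors.countBelow (i + 1) := by
        rw [hZ.var .k rfl]; simp
      simp only [Expr.eval, Op.eval, hiZ, hkZ, Nat.mod_eq_of_lt h1, State.setVar_var,
        State.setVar_arr, if_true, reduceCtorEq, if_false, Expr.cost,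
        Nat.mod_eq_of_lt (show i + 1 < 2 ^ w by omega)]
      rw [markedProducts_succ hi.1, ← Finset.union_assoc]
      refine ⟨by omega, trivial, trivial, h5, hw5, fun x hx => (h6 x hx).trans (h3 x hx), ?_⟩
      -- the number of rounds of the inner loop is `(q - p) m / d` with `d` a divisor above `i`
      have h8 : m * q / m.divisors.nextAbove i - m * p / m.divisors.nextAbove i ≤
          (q - p) * (m / (i + 1)) := by
        rw [Nat.mul_div_right_comm hnxd.1, Nat.mul_div_right_comm hnxd.1, ← Nat.mul_sub,
          mul_comm]
        exact Nat.mul_le_mul_left _ (Nat.div_le_div_left hnx.2 (by omega))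
      have h9 : 1 ≤ (q - p) * (m / (i + 1)) :=
        Nat.mul_pos (by omega) (Nat.div_pos (by omega) (by omega))
      rw [Finset.sum_range_succ, mul_add]
      omega

/-- The second algorithm is correct.  Its running time is proportional to `q - p`, so that the total
time along an increasing sequence of primes telescopes. -/
theorem wp_algMultipliers {w m p q : ℕ} {X : Config} (h1 : 1 < 2 ^ w) (hw : m * q < 2 ^ w)
    (hin : X.st.IsMultipliersInput m p q) : Wp w algMultipliers (fun Y =>
      Y.st.var .weight = deltaCount (m * q) ∧
      Marks (Y.st.arr .bits) (deltaProducts (m * q)) (m * q) ∧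
      (∀ x, m * q ≤ x → Y.st.arr .bits x = X.st.arr .bits x) ∧
      Y.time ≤ X.time + 90 * ((q - p) * harmonicMul m)) X := by
  have hm := hin.1
  have hq := hin.2.2.1
  have hpq := hin.2.2.2.1
  have hGm : m ≤ (q - p) * harmonicMul m :=
    (le_harmonicMul m).trans (Nat.le_mul_of_pos_left _ (by omega))
  simp only [algMultipliers, Cmd.block_cons_cons, Cmd.block_singleton]
  refine Wp.seq (Wp.assign (Wp.seq (Wp.assign ((wp_multipliersLoop h1 hw (m := m) (p := p) (q := q)
    ?_ ?_ ?_).mono ?_))))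
  · obtain ⟨h2, h3, h4, h5, h6, h7, h8, h9⟩ := hin
    refine ⟨h2, h3, h4, h5, by simpa using h6, by simpa using h7, h8.congr ?_ ?_ ?_,
      h9.congr ?_ ?_ ?_⟩ <;> simp
  · simp [Expr.eval, Nat.mod_eq_of_lt h1]
  · simp [Expr.eval]
  · rintro Y hY ⟨h2, h3, h4, h5⟩
    rw [deltaCount_eq_card (Nat.mul_pos hm hq.pos)]
    refine ⟨h2, h3, by simpa using h4, ?_⟩
    simp only [Expr.cost] at h5
    omega

/-! ### The tabulation program -/

-- `rM`: the current multiplier `m`; `rQ`: the current candidate for a prime `q`; `rP`: the last prime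
-- before it; `rD`, `rBase`, `rNum`, `rFlag`: the registers of trial division; `rRem`: the number of
-- unknown `δ(k)`; `rCur`: the current `k`; `rAcc`: the last value `M(k)`.
notation "rM" => Var.tmp 0
notation "rP" => Var.tmp 1
notation "rQ" => Var.tmp 2
notation "rD" => Var.tmp 3
notation "rBase" => Var.tmp 4
notation "rNum" => Var.tmp 5
notation "rRem" => Var.tmp 6
notation "rCur" => Var.tmp 7
notation "rAcc" => Var.tmp 8
notation "rFlag" => Var.tmp 9
-- `aPrime`: the characteristic function of the primes; `aDone`: which `δ(k)` are known; `aDelta`: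
-- these values.
notation "aPrime" => Arr.tmp 0
notation "aDone" => Arr.tmp 1
notation "aDelta" => Arr.tmp 2

/-- The bound `input + 1` of the loops. -/
def Expr.inputSucc : Expr := .bin .add (.var .input) (.const 1)

/-- One round of `fillPairs`. -/
def fillBody (a b : Arr) : Cmd := .block [
  .ite (.eq (.bin .mod (.var rBase) (.var rD)) (.const 0))
    (.block [
      .store a (.var .len) (.var rD),
      .store b (.var .len) (.bin .div (.var rNum) (.var rD)),
      .incr .len])
    .skip,
  .incr rD]

/-- Lists the divisors `d` of `rBase` in the array `a` and the quotients `rNum / d` in the array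
`b`, where `d` runs upwards from `1` while the guard `g` holds. -/
def fillPairs (a b : Arr) (g : Expr) : Cmd := .block [
  .assign .len (.const 0),
  .assign rD (.const 1),
  .loop g (fillBody a b)]

/-- The guard `d² ≤ rNum`. -/
def guardSqrt : Expr :=
  .lt (.bin .mul (.var rD) (.var rD)) (.bin .add (.var rNum) (.const 1))

/-- The guard `d ≤ rBase`. -/
def guardAll : Expr := .lt (.var rD) (.bin .add (.var rBase) (.const 1))

/-- Files the value in `weight` as `δ(rCur)`, unless this value is known already; `rRem` counts the
values that are not known. -/
def fileDelta : Cmd :=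
  .ite (.eq (.read aDone (.var rCur)) (.const 0))
    (.block [
      .store aDone (.var rCur) (.const 1),
      .store aDelta (.var rCur) (.var .weight),
      .assign rRem (.bin .sub (.var rRem) (.const 1))])
    .skip

theorem Finset.countBelow_mono (S : Finset ℕ) {i j : ℕ} (h : i ≤ j) :
    S.countBelow i ≤ S.countBelow j :=
  Finset.card_le_card fun x hx => by
    rw [Finset.mem_filter] at hx ⊢
    exact ⟨hx.1, by omega⟩

theorem Finset.countBelow_lt_countBelow {S : Finset ℕ} {i j : ℕ} (hi : i ∈ S) (h : i < j) :
    S.countBelow i < S.countBelow j := by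
  have h1 := S.countBelow_succ i
  rw [if_pos hi] at h1
  have := S.countBelow_mono (show i + 1 ≤ j by omega)
  omega

/-- The guard `g` has to hold exactly for `d < B`; then the divisors `d < B` of `M` are listed. -/
theorem wp_fillPairs {w M N B : ℕ} {a b : Arr} {g : Expr} {X : Config} (h1 : 1 < 2 ^ w)
    (hab : a ≠ b) (hB1 : 1 ≤ B) (hB : B < 2 ^ w)
    (hM : X.st.var rBase = M) (hN : X.st.var rNum = N)
    (hg : ∀ s : State, s.var rBase = M → s.var rNum = N → s.var rD ≤ B →
      (g.eval w s = 0 ↔ B ≤ s.var rD)) :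
    Wp w (fillPairs a b g) (fun Y => Y.st.HoldsPairs a b ((Finset.Ico 1 B).filter (· ∣ M)) N ∧
      Y.time ≤ X.time + (g.cost + 25) * B) X := by
  set S := (Finset.Ico 1 B).filter (· ∣ M) with hS
  have hmem : ∀ x, x ∈ S ↔ 1 ≤ x ∧ x < B ∧ x ∣ M := by simp [hS, and_assoc]
  have hcard : S.card ≤ B := card_le_of_mem_Icc (fun x hx => ((hmem x).1 hx).1)
    (fun x hx => ((hmem x).1 hx).2.1.le)
  simp only [fillPairs, Cmd.block_cons_cons, Cmd.block_singleton]
  refine Wp.seq (Wp.assign (Wp.seq (Wp.assign ?_)))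
  refine Wp.loop (fun i Y => (1 ≤ i ∧ i ≤ B) ∧ Y.st.var rD = i ∧
      Y.st.var .len = S.countBelow i ∧
      (∀ x ∈ S, x < i → Y.st.arr a (S.countBelow x) = x ∧ Y.st.arr b (S.countBelow x) = N / x) ∧
      Y.time ≤ X.time + 4 + (g.cost + 25) * (i - 1)) B 1 ?_ ?_ ?_ ?_
  · refine ⟨⟨le_rfl, hB1⟩, by simp [Expr.eval, Nat.mod_eq_of_lt h1], ?_, ?_, ?_⟩
    · simp only [State.setVar_var, reduceCtorEq, if_false, if_true, Expr.eval, Nat.zero_mod]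
      rw [Finset.countBelow, eq_comm, Finset.card_eq_zero, Finset.filter_eq_empty_iff]
      intro x hx; have := ((hmem x).1 hx).1; omega
    · intro x hx hx1; have := ((hmem x).1 hx).1; omega
    · simp only [Expr.cost]; omega
  · exact fun i Y h => h.1.2
  · rintro i Y hF ⟨hi, hiv, h2, h3, h4⟩ he
    have hMY : Y.st.var rBase = M := by rw [hF.var _ rfl]; simpa using hM
    have hNY : Y.st.var rNum = N := by rw [hF.var _ rfl]; simpa using hN
    have := (hg Y.st hMY hNY (by omega)).1 he
    obtain rfl : i = B := by omega
    refine ⟨State.holdsPairs_iff.2 ⟨?_, fun x hx => h3 x hx ((hmem x).1 hx).2.1⟩, ?_⟩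
    · rw [h2, Finset.countBelow, Finset.filter_true_of_mem fun x hx => ((hmem x).1 hx).2.1]
    · have : (g.cost + 25) * i = (g.cost + 25) * (i - 1) + (g.cost + 25) := by
        obtain ⟨i, rfl⟩ : ∃ i', i = i' + 1 := ⟨i - 1, by omega⟩
        rw [Nat.add_sub_cancel, mul_add, mul_one]
      simp only
      omega
  · rintro i Y hF ⟨hi, hiv, h2, h3, h4⟩ he
    have hMY : Y.st.var rBase = M := by rw [hF.var _ rfl]; simpa using hM
    have hNY : Y.st.var rNum = N := by rw [hF.var _ rfl]; simpa using hN
    have hiB : i < B := by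
      by_contra h; exact he ((hg Y.st hMY hNY (by omega)).2 (by omega))
    have h5 : (g.cost + 25) * (i + 1 - 1) = (g.cost + 25) * (i - 1) + (g.cost + 25) := by
      obtain ⟨i, rfl⟩ : ∃ i', i = i' + 1 := ⟨i - 1, by omega⟩
      rw [Nat.add_sub_cancel, Nat.add_sub_cancel, mul_add, mul_one]
    have hm : (i + 1) % 2 ^ w = i + 1 := Nat.mod_eq_of_lt (by omega)
    simp only [fillBody, Cmd.block_cons_cons, Cmd.block_singleton, Cmd.incr]
    rw [h5]
    refine Wp.seq (Wp.ite (fun he' => ?_) (fun he' => ?_))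
    · have hiS : i ∈ S := by
        refine (hmem i).2 ⟨hi.1, hiB, Nat.dvd_of_mod_eq_zero ?_⟩
        simpa [Expr.eq, Expr.eval, Op.eval, hMY, hiv] using he'
      have hc := Finset.countBelow_lt_card hiS
      refine Wp.seq (Wp.store (Wp.seq (Wp.store (Wp.assign (Wp.assign ?_)))))
      simp only [Expr.eval, Op.eval, h2, hiv, hNY, Nat.mod_eq_of_lt h1, State.setVar_var,
        State.setArr_var, State.setVar_arr, State.setArr_arr, if_true, reduceCtorEq, if_false, hm,
        Nat.mod_eq_of_lt (show S.countBelow i + 1 < 2 ^ w by omega), hab, hab.symm]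
      refine ⟨by omega, trivial, ?_, ?_, ?_⟩
      · rw [Finset.countBelow_succ, if_pos hiS]
      · intro x hx hxi
        by_cases hxe : x = i
        · simp [hxe]
        · have := Finset.countBelow_lt_countBelow hx (show x < i by omega)
          rw [Function.update_of_ne this.ne, Function.update_of_ne this.ne]
          exact h3 x hx (by omega)
      · simp only [Expr.cost, Expr.eq]; omega
    · have hiS : i ∉ S := by
        intro h
        have := Nat.mod_eq_zero_of_dvd ((hmem i).1 h).2.2
        simp [Expr.eq, Expr.eval, Op.eval, hMY, hiv, this] at he'
      refine Wp.skip (Wp.assign ?_)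
      simp only [Expr.eval, Op.eval, hiv, Nat.mod_eq_of_lt h1, State.setVar_var, State.setVar_arr,
        if_true, reduceCtorEq, if_false, hm]
      refine ⟨by omega, trivial, ?_, ?_, ?_⟩
      · rw [Finset.countBelow_succ, if_neg hiS]; exact h2
      · intro x hx hxi
        have : x ≠ i := by rintro rfl; exact hiS hx
        exact h3 x hx (by omega)
      · simp only [Expr.cost, Expr.eq]; omega

theorem wp_fillPairs_sqrt {w N : ℕ} {X : Config} (hN0 : 0 < N) (hw : (N + 1) * (N + 1) < 2 ^ w)
    (hM : X.st.var rBase = N) (hN : X.st.var rNum = N) :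
    Wp w (fillPairs .fst .snd guardSqrt) (fun Y => Y.st.IsDeltaInput N ∧
      Y.time ≤ X.time + 32 * (N.sqrt + 1)) X := by
  have h1 : 1 < 2 ^ w := by nlinarith
  have hs : N.sqrt ≤ N := Nat.sqrt_le_self N
  have hNw : N + 1 < 2 ^ w := by nlinarith
  refine (wp_fillPairs (B := N.sqrt + 1) h1 (by simp) (by omega) (by omega) hM hN ?_).mono ?_
  · intro s h2 h3 h4
    have h5 : s.var rD * s.var rD < 2 ^ w :=
      (Nat.mul_le_mul (h4.trans (by omega)) (h4.trans (by omega))).trans_lt hw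
    simp only [guardSqrt, Expr.lt, Expr.eval, Op.eval, h3, Nat.mod_eq_of_lt h1,
      Nat.mod_eq_of_lt hNw, Nat.mod_eq_of_lt h5, ite_eq_right_iff, one_ne_zero, imp_false]
    rw [not_lt, Nat.succ_le_iff, Nat.succ_le_iff, Nat.sqrt_lt]
  · rintro Y - ⟨h2, h3⟩
    have h4 : (Finset.Ico 1 (N.sqrt + 1)).filter (· ∣ N) =
        N.divisors.filter fun d => d * d ≤ N := by
      ext x
      simp only [Finset.mem_filter, Finset.mem_Ico, Nat.mem_divisors, Nat.lt_succ_iff,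
        Nat.le_sqrt]
      constructor
      · rintro ⟨⟨h5, h6⟩, h7⟩; exact ⟨⟨h7, hN0.ne'⟩, h6⟩
      · rintro ⟨⟨h5, h6⟩, h7⟩; exact ⟨⟨Nat.pos_of_dvd_of_pos h5 hN0, h7⟩, h5⟩
    rw [h4] at h2
    exact ⟨⟨hN0, h2⟩, h3⟩

theorem wp_fillPairs_all {w M N : ℕ} {a b : Arr} {X : Config} (hab : a ≠ b) (hM0 : 0 < M)
    (hw : M + 1 < 2 ^ w) (hM : X.st.var rBase = M) (hN : X.st.var rNum = N) :
    Wp w (fillPairs a b guardAll) (fun Y => Y.st.HoldsPairs a b M.divisors N ∧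
      Y.time ≤ X.time + 30 * (M + 1)) X := by
  have h1 : 1 < 2 ^ w := by omega
  refine (wp_fillPairs (B := M + 1) h1 hab (by omega) hw hM hN ?_).mono ?_
  · intro s h2 h3 h4
    simp only [guardAll, Expr.lt, Expr.eval, Op.eval, h2, Nat.mod_eq_of_lt h1,
      Nat.mod_eq_of_lt hw, ite_eq_right_iff, one_ne_zero, imp_false, not_lt]
  · rintro Y - ⟨h2, h3⟩
    have h4 : (Finset.Ico 1 (M + 1)).filter (· ∣ M) = M.divisors := rfl
    rw [h4] at h2
    exact ⟨h2, h3⟩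

/-- Some call in `cs` computes `δ(k)`. -/
def Computed (cs : List CallRecord) (k : ℕ) : Prop := ∃ c ∈ cs, c.Computes k

theorem Computed.mono {cs cs' : List CallRecord} {k : ℕ} (h : Computed cs k) (hs : cs ⊆ cs') :
    Computed cs' k := by
  obtain ⟨c, hc, h⟩ := h
  exact ⟨c, hs hc, h⟩

theorem wp_callDelta {w N : ℕ} {X : Config} (h1 : 1 < 2 ^ w) (hw : N < 2 ^ w)
    (hin : X.st.IsDeltaInput N) : Wp w (.call .delta) (fun Y =>
      Y.st.var .weight = deltaCount N ∧ Marks (Y.st.arr .bits) (deltaProducts N) N ∧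
      (∀ x, N ≤ x → Y.st.arr .bits x = X.st.arr .bits x) ∧ Computed Y.calls N ∧
      Y.time ≤ X.time + 101 * harmonicMul N) X := by
  refine Wp.call ((wp_algDelta h1 hw hin).mono ?_)
  rintro Y - ⟨h2, h3, h4, h5⟩ cs hcs hc
  refine ⟨h2, h3, h4, ⟨_, hc, h2, hin⟩, ?_⟩
  have := le_harmonicMul N
  have := hin.1
  simp only; omega

theorem wp_callMultipliers {w m p q : ℕ} {X : Config} (h1 : 1 < 2 ^ w) (hw : m * q < 2 ^ w)
    (hin : X.st.IsMultipliersInput m p q) : Wp w (.call .multipliers) (fun Y =>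
      Y.st.var .weight = deltaCount (m * q) ∧
      Marks (Y.st.arr .bits) (deltaProducts (m * q)) (m * q) ∧
      (∀ x, m * q ≤ x → Y.st.arr .bits x = X.st.arr .bits x) ∧ Computed Y.calls (m * q) ∧
      Y.time ≤ X.time + 91 * ((q - p) * harmonicMul m)) X := by
  refine Wp.call ((wp_algMultipliers h1 hw hin).mono ?_)
  rintro Y - ⟨h2, h3, h4, h5⟩ cs hcs hc
  refine ⟨h2, h3, h4, ⟨_, hc, h2, m, p, q, rfl, hin⟩, ?_⟩
  have := le_harmonicMul m
  have := hin.1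
  have h6 : 1 ≤ (q - p) * harmonicMul m :=
    Nat.mul_pos (by have := hin.2.2.2.1; omega) (by omega)
  simp only; omega

/-- The bookkeeping of the known values `δ(k)`, `k ≤ n`: those with `aDone[k] ≠ 0`. -/
structure Ledger (n : ℕ) (X : Config) : Prop where
  known : ∀ k, 1 ≤ k → k ≤ n → X.st.arr aDone k ≠ 0 →
    X.st.arr aDelta k = deltaCount k ∧ Computed X.calls k
  rem : X.st.var rRem = ((Finset.Icc 1 n).filter fun k => X.st.arr aDone k = 0).card

theorem Ledger.congr {n : ℕ} {X Y : Config} (h : Ledger n X)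
    (hr : Y.st.var rRem = X.st.var rRem) (hd : Y.st.arr aDone = X.st.arr aDone)
    (hv : Y.st.arr aDelta = X.st.arr aDelta) (hc : X.calls ⊆ Y.calls) : Ledger n Y := by
  refine ⟨fun k h1 h2 h3 => ?_, by rw [hr, hd]; exact h.rem⟩
  rw [hd] at h3
  rw [hv]
  exact ⟨(h.known k h1 h2 h3).1, (h.known k h1 h2 h3).2.mono hc⟩

theorem wp_fileDelta {w n k : ℕ} {X : Config} (h1 : 1 < 2 ^ w) (hL : Ledger n X)
    (hk1 : 1 ≤ k) (hkn : k ≤ n) (hk : X.st.var rCur = k) (hw : X.st.var .weight = deltaCount k)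
    (hc : Computed X.calls k) : Wp w fileDelta (fun Y => Ledger n Y ∧ Y.st.arr aDone k ≠ 0 ∧
      (∀ k', X.st.arr aDone k' ≠ 0 → Y.st.arr aDone k' ≠ 0) ∧ Y.time ≤ X.time + 20) X := by
  simp only [fileDelta, Cmd.block_cons_cons, Cmd.block_singleton]
  refine Wp.ite (fun he => ?_) (fun he => ?_)
  · have h0 : X.st.arr aDone k = 0 := by
      simpa [Expr.eq, Expr.eval, Op.eval, hk] using he
    refine Wp.seq (Wp.store (Wp.seq (Wp.store (Wp.assign ?_))))
    simp only [Expr.eval, Op.eval, hk, hw, Nat.mod_eq_of_lt h1, State.setArr_var, State.setArr_arr,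
      State.setVar_arr, if_true, if_false, Arr.tmp.injEq,
      OfNat.one_ne_ofNat, OfNat.ofNat_ne_one]
    refine ⟨⟨fun k' hk1' hkn' hd => ?_, ?_⟩, by simp, fun k' hk' => ?_, ?_⟩
    · by_cases hkk : k' = k
      · subst hkk; simpa using hc
      · simp only [State.setVar_arr, State.setArr_arr, if_true, if_false, Arr.tmp.injEq,
          OfNat.ofNat_ne_one, OfNat.one_ne_ofNat, Function.update_of_ne hkk] at hd ⊢
        exact hL.known k' hk1' hkn' hd
    · have h2 : (Finset.Icc 1 n).filter (fun k' => Function.update (X.st.arr aDone) k 1 k' = 0) =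
          ((Finset.Icc 1 n).filter fun k' => X.st.arr aDone k' = 0).erase k := by
        ext x
        by_cases hx : x = k
        · simp [hx]
        · simp [hx]
      simp only [State.setVar_var, State.setVar_arr, State.setArr_arr, if_true, if_false,
        Arr.tmp.injEq, OfNat.one_ne_ofNat, hL.rem]
      rw [h2, Finset.card_erase_of_mem (by simp [hk1, hkn, h0])]
    · by_cases hkk : k' = k
      · simp [hkk]
      · simpa [hkk] using hk'
    · simp only [Expr.cost, Expr.eq]; omega
  · have h0 : X.st.arr aDone k ≠ 0 := by
      intro h; simp [Expr.eq, Expr.eval, Op.eval, hk, h] at he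
    refine Wp.skip ⟨hL.congr rfl rfl rfl fun _ h => h, h0, fun k' h => h, ?_⟩
    simp only [Expr.cost, Expr.eq]; omega

/-! ### The primes, and the columns `m q` -/

/-- The trial division of `rQ` by `rD`. -/
def trialBody : Cmd := .block [
  .ite (.eq (.bin .mod (.var rQ) (.var rD)) (.const 0)) (.assign rFlag (.const 0)) .skip,
  .incr rD]

/-- The guard `d² ≤ rQ`. -/
def trialGuard : Expr :=
  .lt (.bin .mul (.var rD) (.var rD)) (.bin .add (.var rQ) (.const 1))

/-- Computes one entry of the table of primes. -/
def primeRow : Cmd := .block [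
  .assign rFlag (.const 1),
  .assign rD (.const 2),
  .loop trialGuard trialBody,
  .store aPrime (.var rQ) (.var rFlag),
  .incr rQ]

/-- Computes the table of the primes up to the input. -/
def primeTable : Cmd := .block [
  .assign rQ (.const 2),
  .loop (.lt (.var rQ) .inputSucc) primeRow]

theorem wp_trial {w q : ℕ} {X : Config} (hq : 2 ≤ q) (hw : (q + 1) * (q + 1) < 2 ^ w)
    (hqv : X.st.var rQ = q) (hd : X.st.var rD = 2) (hf : X.st.var rFlag = 1) :
    Wp w (.loop trialGuard trialBody) (fun Y =>
      (Y.st.var rFlag ≠ 0 ↔ q.Prime) ∧ Y.time ≤ X.time + 20 * (q.sqrt + 1)) X := by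
  have hs1 : 1 ≤ q.sqrt := Nat.le_sqrt.2 (by omega)
  have hs : q.sqrt ≤ q := Nat.sqrt_le_self q
  have h1 : 1 < 2 ^ w := by nlinarith
  have hqw : q + 1 < 2 ^ w := by nlinarith
  have hguard : ∀ Y : Config, Frame trialBody X Y → ∀ d ≤ q.sqrt + 1, Y.st.var rD = d →
      (trialGuard.eval w Y.st = 0 ↔ q.sqrt < d) := by
    intro Y hF d hd h
    have h5 : d * d < 2 ^ w :=
      (Nat.mul_le_mul (hd.trans (by omega)) (hd.trans (by omega))).trans_lt hw
    simp only [trialGuard, Expr.lt, Expr.eval, Op.eval, h, hF.var rQ rfl, hqv, Nat.mod_eq_of_lt h1,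
      Nat.mod_eq_of_lt hqw, Nat.mod_eq_of_lt h5, ite_eq_right_iff, one_ne_zero, imp_false]
    rw [not_lt, Nat.succ_le_iff, Nat.sqrt_lt]
  refine Wp.loop (fun d Y => (2 ≤ d ∧ d ≤ q.sqrt + 1) ∧ Y.st.var rD = d ∧
      (Y.st.var rFlag ≠ 0 ↔ ∀ e, 2 ≤ e → e < d → ¬ e ∣ q) ∧
      Y.time ≤ X.time + 20 * (d - 2)) (q.sqrt + 1) 2 ?_ ?_ ?_ ?_
  · refine ⟨⟨le_rfl, by omega⟩, hd, ?_, by omega⟩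
    rw [hf]
    exact ⟨fun _ e h2 h3 => by omega, fun _ => one_ne_zero⟩
  · exact fun d Y h => h.1.2
  · rintro d Y hF ⟨hd, hdv, h2, h3⟩ he
    have := (hguard Y hF d hd.2 hdv).1 he
    obtain rfl : d = q.sqrt + 1 := by omega
    refine ⟨?_, by simp only [trialGuard, Expr.lt, Expr.cost]; omega⟩
    rw [Nat.prime_def_le_sqrt]
    simp only [h2, Nat.lt_succ_iff]
    exact ⟨fun h => ⟨hq, h⟩, fun h => h.2⟩
  · rintro d Y hF ⟨hd, hdv, h2, h3⟩ he
    have hlt : d ≤ q.sqrt := by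
      by_contra hc; exact he ((hguard Y hF d hd.2 hdv).2 (by omega))
    have hqY : Y.st.var rQ = q := (hF.var _ rfl).trans hqv
    have hm : (d + 1) % 2 ^ w = d + 1 := Nat.mod_eq_of_lt (by omega)
    simp only [trialBody, Cmd.block_cons_cons, Cmd.block_singleton, Cmd.incr]
    refine Wp.seq (Wp.ite (fun he' => ?_) (fun he' => ?_))
    · have hdvd : d ∣ q := Nat.dvd_of_mod_eq_zero
        (by simpa [Expr.eq, Expr.eval, Op.eval, hqY, hdv] using he')
      refine Wp.assign (Wp.assign ?_)
      simp only [Expr.eval, Op.eval, hdv, Nat.mod_eq_of_lt h1, State.setVar_var, if_true, if_false,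
        Nat.zero_mod, hm, Var.tmp.injEq, Nat.reduceEqDiff]
      refine ⟨by omega, trivial, ?_, by
        simp only [Expr.cost, Expr.eq, trialGuard, Expr.lt]; omega⟩
      exact ⟨fun h => absurd rfl h, fun h => absurd hdvd (h d hd.1 (by omega))⟩
    · have hdvd : ¬ d ∣ q := by
        intro h
        simp [Expr.eq, Expr.eval, Op.eval, hqY, hdv, Nat.mod_eq_zero_of_dvd h] at he'
      refine Wp.skip (Wp.assign ?_)
      simp only [Expr.eval, Op.eval, hdv, Nat.mod_eq_of_lt h1, State.setVar_var, if_true, if_false,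
        hm, Var.tmp.injEq, Nat.reduceEqDiff]
      refine ⟨by omega, trivial, ?_, by
        simp only [Expr.cost, Expr.eq, trialGuard, Expr.lt]; omega⟩
      rw [h2]
      refine ⟨fun h e he1 he2 => ?_, fun h e he1 he2 => h e he1 (by omega)⟩
      by_cases hed : e = d
      · rw [hed]; exact hdvd
      · exact h e he1 (by omega)

theorem wp_primeTable {w n : ℕ} {X : Config} (hn : 1 ≤ n) (hw : (n + 1) * (n + 1) < 2 ^ w)
    (hin : X.st.var .input = n) :
    Wp w primeTable (fun Y => (∀ q, 2 ≤ q → q ≤ n → (Y.st.arr aPrime q ≠ 0 ↔ q.Prime)) ∧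
      Y.time ≤ X.time + 60 * (n * (n.sqrt + 1))) X := by
  have h1 : 1 < 2 ^ w := by nlinarith
  have h2w : 2 < 2 ^ w := by nlinarith
  have hnw : n + 1 < 2 ^ w := by nlinarith
  simp only [primeTable, Cmd.block_cons_cons, Cmd.block_singleton]
  refine Wp.seq (Wp.assign ?_)
  have hguard : ∀ s : State, s.var .input = n → Expr.inputSucc.eval w s = n + 1 := by
    intro s hs
    simp [Expr.inputSucc, Expr.eval, Op.eval, hs, Nat.mod_eq_of_lt h1, Nat.mod_eq_of_lt hnw]
  refine Wp.loop (fun q Y => (2 ≤ q ∧ q ≤ n + 2) ∧ Y.st.var rQ = q ∧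
      (∀ r, 2 ≤ r → r < q → r ≤ n → (Y.st.arr aPrime r ≠ 0 ↔ r.Prime)) ∧
      Y.time ≤ X.time + 2 + 50 * ((q - 2) * (n.sqrt + 1))) (n + 2) 2 ?_ ?_ ?_ ?_
  · refine ⟨by omega, by simp [Expr.eval, Nat.mod_eq_of_lt h2w], fun r h2 h3 => by omega, ?_⟩
    simp only [Expr.cost]; omega
  · exact fun d Y h => h.1.2
  · rintro q Y hF ⟨hq, hqv, h2, h3⟩ he
    have hinY : Y.st.var .input = n := by rw [hF.var .input rfl]; simpa using hin
    simp only [Expr.lt, Expr.eval, Op.eval, hguard _ hinY, hqv, ite_eq_right_iff, one_ne_zero,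
      imp_false, not_lt] at he
    refine ⟨fun r hr hrn => h2 r hr (by omega) hrn, ?_⟩
    have h4 : (q - 2) * (n.sqrt + 1) ≤ n * (n.sqrt + 1) := Nat.mul_le_mul_right _ (by omega)
    have h5 : 1 ≤ n * (n.sqrt + 1) := Nat.mul_pos (by omega) (by omega)
    simp only [Expr.lt, Expr.cost, Expr.inputSucc]; omega
  · rintro q Y hF ⟨hq, hqv, h2, h3⟩ he
    have hinY : Y.st.var .input = n := by rw [hF.var .input rfl]; simpa using hin
    simp only [Expr.lt, Expr.eval, Op.eval, hguard _ hinY, hqv, ne_eq, ite_eq_right_iff,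
      one_ne_zero, imp_false, not_not] at he
    have hqn : (q + 1) * (q + 1) < 2 ^ w :=
      (Nat.mul_le_mul (by omega) (by omega)).trans_lt hw
    simp only [primeRow, Cmd.block_cons_cons, Cmd.block_singleton, Cmd.incr]
    refine Wp.seq (Wp.assign (Wp.seq (Wp.assign (Wp.seq ((wp_trial (q := q) hq.1 hqn ?_ ?_
      ?_).mono ?_)))))
    · simpa using hqv
    · simp [Expr.eval, Nat.mod_eq_of_lt h2w]
    · simp [Expr.eval, Nat.mod_eq_of_lt h1]
    rintro Z hZ ⟨h4, h5⟩
    refine Wp.seq (Wp.store (Wp.assign ?_))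
    have hqZ : Z.st.var rQ = q := by rw [hZ.var rQ rfl]; simpa using hqv
    have haZ : Z.st.arr aPrime = Y.st.arr aPrime := by rw [hZ.arr aPrime rfl]; simp
    have hss : q.sqrt ≤ n.sqrt := Nat.sqrt_le_sqrt (by omega)
    have h6 : (q + 1 - 2) * (n.sqrt + 1) = (q - 2) * (n.sqrt + 1) + (n.sqrt + 1) := by
      rw [show q + 1 - 2 = (q - 2) + 1 by omega, add_mul, one_mul]
    simp only [Expr.eval, Op.eval, hqZ, Nat.mod_eq_of_lt h1, State.setVar_var, State.setArr_var,
      State.setVar_arr, State.setArr_arr, if_true, haZ,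
      Nat.mod_eq_of_lt (show q + 1 < 2 ^ w by omega), h6]
    refine ⟨by omega, trivial, fun r hr hrq hrn => ?_, ?_⟩
    · by_cases hrq' : r = q
      · subst hrq'; simpa using h4
      · rw [Function.update_of_ne hrq']; exact h2 r hr (by omega) hrn
    · simp only [Expr.cost, Expr.lt, Expr.inputSucc] at h5 ⊢
      omega

/-- Computes `δ(m q)` by the second algorithm from what the computation of `δ(m p)` left, for the
multiplier `m` in `rM` and the primes `p`, `q` in `rP`, `rQ`; then `q` takes the place of `p`. -/
def nextPrimeStep : Cmd := .block [
  .assign rBase (.var rM),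
  .assign rNum (.bin .mul (.var rM) (.var rP)),
  fillPairs .fst .snd guardAll,
  .assign rNum (.bin .mul (.var rM) (.var rQ)),
  fillPairs .fst' .snd' guardAll,
  .assign rCur (.var rNum),
  .call .multipliers,
  fileDelta,
  .assign rP (.var rQ)]

/-- One round of the loop over the multipliers `q` for a fixed `m`. -/
def multiplierRow : Cmd := .block [
  .ite (.read aPrime (.var rQ)) nextPrimeStep .skip,
  .incr rQ]

/-- Computes `δ(m q)` for all primes `q` with `m q ≤ n`: the first algorithm serves for `q = 2`, and
then the second algorithm leads from each prime to the next one. -/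
def columnOf : Cmd := .block [
  .assign .t (.const 0),
  .loop (.lt (.var .t) .inputSucc) clearBody,
  .assign rCur (.bin .mul (.var rM) (.const 2)),
  .assign rBase (.var rCur),
  .assign rNum (.var rCur),
  fillPairs .fst .snd guardSqrt,
  .call .delta,
  fileDelta,
  .assign rP (.const 2),
  .assign rQ (.const 3),
  .loop (.lt (.bin .mul (.var rM) (.var rQ)) .inputSucc) multiplierRow,
  .incr rM]

/-- The table of primes up to `n` is available, and `n` is the input. -/
structure Prepared (n : ℕ) (X : Config) : Prop where
  input : X.st.var .input = n
  prime : ∀ q, 2 ≤ q → q ≤ n → (X.st.arr aPrime q ≠ 0 ↔ q.Prime)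

theorem Prepared.congr {n : ℕ} {X Y : Config} (h : Prepared n X)
    (hi : Y.st.var .input = X.st.var .input) (ha : Y.st.arr aPrime = X.st.arr aPrime) :
    Prepared n Y :=
  ⟨hi.trans h.input, by rw [ha]; exact h.prime⟩

/-- The step from one prime `p` to the next prime `q`. -/
theorem wp_nextPrime {w n m p q : ℕ} {X : Config} (hw : (n + 1) * (n + 1) < 2 ^ w)
    (hL : Ledger n X) (hm0 : 1 ≤ m) (hm : X.st.var rM = m) (hp : X.st.var rP = p)
    (hq : X.st.var rQ = q) (hpp : p.Prime) (hqp : q.Prime) (hpq : p < q) (hmq : m * q ≤ n)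
    (hbits : Marks (X.st.arr .bits) (deltaProducts (m * p)) (n + 1))
    (hwt : X.st.var .weight = deltaCount (m * p)) :
    Wp w nextPrimeStep (fun Y => Ledger n Y ∧ Y.st.var rP = q ∧
        Marks (Y.st.arr .bits) (deltaProducts (m * q)) (n + 1) ∧
        Y.st.var .weight = deltaCount (m * q) ∧
        Y.st.arr aDone (m * q) ≠ 0 ∧
        (∀ k, X.st.arr aDone k ≠ 0 → Y.st.arr aDone k ≠ 0) ∧
        Y.time ≤ X.time + 400 * ((q - p) * harmonicMul m)) X := by
  have hn : 1 ≤ n := (Nat.mul_pos hm0 hqp.pos).trans_le hmq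
  have h1 : 1 < 2 ^ w := by nlinarith
  have hnw : n + 1 < 2 ^ w := by nlinarith
  have hmpq : m * p ≤ m * q := Nat.mul_le_mul_left _ hpq.le
  have hmq' : m ≤ m * q := Nat.le_mul_of_pos_right _ hqp.pos
  have hmG : m ≤ (q - p) * harmonicMul m :=
    (le_harmonicMul m).trans (Nat.le_mul_of_pos_left _ (by omega))
  simp only [nextPrimeStep, Cmd.block_cons_cons, Cmd.block_singleton]
  refine Wp.seq (Wp.assign (Wp.seq (Wp.assign (Wp.seq ((wp_fillPairs_all (M := m) (N := m * p)
    (by simp) hm0 (by omega) ?_ ?_).mono ?_)))))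
  · simp [Expr.eval, hm]
  · simp [Expr.eval, Op.eval, hm, hp, Nat.mod_eq_of_lt (show m * p < 2 ^ w by omega)]
  rintro Y hY ⟨h2, h3⟩
  have hmY : Y.st.var rM = m := by rw [hY.var rM rfl]; simpa using hm
  have hqY : Y.st.var rQ = q := by rw [hY.var rQ rfl]; simpa using hq
  have hbY : Y.st.var rBase = m := by rw [hY.var rBase rfl]; simpa [Expr.eval] using hm
  refine Wp.seq (Wp.assign (Wp.seq ((wp_fillPairs_all (M := m) (N := m * q)
    (by simp) hm0 (by omega) ?_ ?_).mono ?_)))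
  · simpa using hbY
  · simp [Expr.eval, Op.eval, hmY, hqY, Nat.mod_eq_of_lt (show m * q < 2 ^ w by omega)]
  rintro Z hZ ⟨h4, h5⟩
  have hnZ : Z.st.var rNum = m * q := by
    rw [hZ.var rNum rfl]
    simp [Expr.eval, Op.eval, hmY, hqY, Nat.mod_eq_of_lt (show m * q < 2 ^ w by omega)]
  have hbZ : Z.st.arr .bits = X.st.arr .bits := by
    rw [hZ.arr .bits rfl, State.setVar_arr, hY.arr .bits rfl]; simp
  refine Wp.seq (Wp.assign (Wp.seq ((wp_callMultipliers (m := m) (p := p) (q := q) h1 (by omega)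
    ⟨hm0, hpp, hqp, hpq, ?_, ?_, ?_, ?_⟩).mono ?_)))
  · intro x hx
    simp only [State.setVar_arr, hbZ]
    exact hbits x (by omega)
  · simp only [State.setVar_var, reduceCtorEq, if_false]
    rw [hZ.var .weight rfl]
    simp only [State.setVar_var, reduceCtorEq, if_false]
    rw [hY.var .weight rfl]
    simp only [State.setVar_var, reduceCtorEq, if_false]
    rw [hwt, deltaCount_eq_card (Nat.mul_pos hm0 hpp.pos)]
  · refine h2.congr ?_ ?_ ?_
    · simp only [State.setVar_var, reduceCtorEq, if_false]
      rw [h4.1, h2.1]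
    · simp only [State.setVar_arr]; rw [hZ.arr .fst rfl, State.setVar_arr]
    · simp only [State.setVar_arr]; rw [hZ.arr .snd rfl, State.setVar_arr]
  · exact h4.congr (by simp) (by simp) (by simp)
  rintro V hV ⟨h6, h7, h8, h9, h10⟩
  have hc : X.calls ⊆ V.calls := fun c hc => hV.calls (hZ.calls (hY.calls hc))
  have hdV : ∀ a, a = aDone ∨ a = aDelta → V.st.arr a = X.st.arr a := by
    rintro a (rfl | rfl)
    · rw [hV.arr aDone rfl, State.setVar_arr, hZ.arr aDone rfl, State.setVar_arr,
        hY.arr aDone rfl]; simp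
    · rw [hV.arr aDelta rfl, State.setVar_arr, hZ.arr aDelta rfl, State.setVar_arr,
        hY.arr aDelta rfl]; simp
  have hrV : V.st.var rRem = X.st.var rRem := by
    rw [hV.var rRem rfl]
    simp only [State.setVar_var, Var.tmp.injEq, Nat.reduceEqDiff, if_false]
    rw [hZ.var rRem rfl]
    simp only [State.setVar_var, Var.tmp.injEq, Nat.reduceEqDiff, if_false]
    rw [hY.var rRem rfl]
    simp
  have hLV : Ledger n V := hL.congr hrV (hdV _ (Or.inl rfl)) (hdV _ (Or.inr rfl)) hc
  have hcV : V.st.var rCur = m * q := by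
    rw [hV.var rCur rfl]; simpa [Expr.eval] using hnZ
  refine Wp.seq ((wp_fileDelta h1 hLV (by omega) hmq hcV h6 h9).mono ?_)
  rintro U hU ⟨h11, h12, h13, h14⟩
  have hqU : U.st.var rQ = q := by
    rw [hU.var rQ rfl, hV.var rQ rfl]
    simp only [State.setVar_var, Var.tmp.injEq, Nat.reduceEqDiff, if_false]
    rw [hZ.var rQ rfl]; simpa using hqY
  refine Wp.assign ⟨h11.congr (by simp) (by simp) (by simp) (fun _ h => h), ?_, ?_, ?_, ?_, ?_, ?_⟩
  · simpa [Expr.eval] using hqU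
  · simp only [State.setVar_arr]
    rw [hU.arr .bits rfl]
    intro x hx
    by_cases hxq : x < m * q
    · exact h7 x hxq
    · rw [h8 x (by omega), State.setVar_arr, hbZ, hbits x hx, if_neg, if_neg]
      · exact fun h => hxq (lt_of_mem_deltaProducts h)
      · exact fun h => hxq ((lt_of_mem_deltaProducts h).trans_le hmpq)
  · simp only [State.setVar_var, reduceCtorEq, if_false]
    rw [hU.var .weight rfl, h6]
  · simpa using h12
  · intro k hk
    simp only [State.setVar_arr]
    exact h13 k (by rw [hdV _ (Or.inl rfl)]; exact hk)
  · simp only [Expr.cost] at h3 h5 h10 h14 ⊢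
    omega

/-- The costs `(q - p) · harmonicMul m` of the single steps telescope, which leaves
`harmonicMul m · p` for the last prime `p ≤ n / m`. -/
theorem wp_multiplierLoop {w n m : ℕ} {X : Config} (hw : (n + 1) * (n + 1) < 2 ^ w)
    (hP : Prepared n X) (hL : Ledger n X) (hm0 : 1 ≤ m) (hm : X.st.var rM = m)
    (hp : X.st.var rP = 2) (hq : X.st.var rQ = 3) (hm2 : m * 2 ≤ n)
    (hbits : Marks (X.st.arr .bits) (deltaProducts (m * 2)) (n + 1))
    (hwt : X.st.var .weight = deltaCount (m * 2)) (hdone : X.st.arr aDone (m * 2) ≠ 0) :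
    Wp w (.loop (.lt (.bin .mul (.var rM) (.var rQ)) .inputSucc) multiplierRow) (fun Y =>
      Ledger n Y ∧ (∀ k, X.st.arr aDone k ≠ 0 → Y.st.arr aDone k ≠ 0) ∧
      (∀ r, r.Prime → m * r ≤ n → Y.st.arr aDone (m * r) ≠ 0) ∧
      ∃ p, m * p ≤ n ∧ Y.time ≤ X.time + 400 * (harmonicMul m * p) + 40 * (n + 1)) X := by
  have h1 : 1 < 2 ^ w := by nlinarith
  have hnw : n + 1 < 2 ^ w := by nlinarith
  have h2n : 2 * n + 1 < 2 ^ w := by nlinarith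
  have hguard : ∀ s : State, s.var .input = n → Expr.inputSucc.eval w s = n + 1 := by
    intro s hs
    simp [Expr.inputSucc, Expr.eval, Op.eval, hs, Nat.mod_eq_of_lt h1, Nat.mod_eq_of_lt hnw]
  refine Wp.loop (fun q Y => 3 ≤ q ∧ m * q ≤ n + m ∧ Y.st.var rQ = q ∧
    ∃ p, p.Prime ∧ p < q ∧ m * p ≤ n ∧ Y.st.var rP = p ∧
      Marks (Y.st.arr .bits) (deltaProducts (m * p)) (n + 1) ∧
      Y.st.var .weight = deltaCount (m * p) ∧ Ledger n Y ∧
      (∀ k, X.st.arr aDone k ≠ 0 → Y.st.arr aDone k ≠ 0) ∧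
      (∀ r < q, r.Prime → m * r ≤ n → Y.st.arr aDone (m * r) ≠ 0) ∧
      Y.time ≤ X.time + 400 * (harmonicMul m * p) + 20 * q) (2 * n) 3 ?_ ?_ ?_ ?_
  · refine ⟨le_rfl, by omega, hq, 2, Nat.prime_two, by omega, hm2, hp, hbits, hwt, hL,
      fun _ h => h, ?_, by omega⟩
    intro r hr hrp _
    obtain rfl : r = 2 := by have := hrp.two_le; omega
    exact hdone
  · rintro q Y ⟨h3, h4, -⟩
    have : q ≤ m * q := Nat.le_mul_of_pos_left _ hm0
    omega
  · rintro q Y hF ⟨hq3, hmq, hqv, p, hpp, hpq, hmp, hpv, h2, h3, h4, h5, h6, h7⟩ he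
    have hmY : Y.st.var rM = m := (hF.var rM rfl).trans hm
    have hiY : Y.st.var .input = n := (hF.var .input rfl).trans hP.input
    have hqn : q ≤ m * q := Nat.le_mul_of_pos_left _ hm0
    simp only [Expr.lt, Expr.eval, Op.eval, hguard _ hiY, hqv, hmY,
      Nat.mod_eq_of_lt (show m * q < 2 ^ w by omega), ite_eq_right_iff, one_ne_zero,
      imp_false, not_lt] at he
    refine ⟨h4.congr rfl rfl rfl (fun _ h => h), h5, fun r hrp hrn => h6 r ?_ hrp hrn, p, hmp, ?_⟩
    · exact lt_of_mul_lt_mul_left (show m * r < m * q by omega) (Nat.zero_le _)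
    · simp only [Expr.cost, Expr.lt, Expr.inputSucc]
      omega
  · rintro q Y hF ⟨hq3, hmq, hqv, p, hpp, hpq, hmp, hpv, h2, h3, h4, h5, h6, h7⟩ he
    have hmY : Y.st.var rM = m := (hF.var rM rfl).trans hm
    have hiY : Y.st.var .input = n := (hF.var .input rfl).trans hP.input
    have hPY : Prepared n Y := hP.congr (hF.var _ rfl) (hF.arr _ rfl)
    simp only [Expr.lt, Expr.eval, Op.eval, hguard _ hiY, hqv, hmY,
      Nat.mod_eq_of_lt (show m * q < 2 ^ w by omega), ne_eq, ite_eq_right_iff, one_ne_zero,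
      imp_false, not_not] at he
    have hqn : q ≤ m * q := Nat.le_mul_of_pos_left _ hm0
    have hpr := hPY.prime q (by omega) (by omega)
    have hm1 : (q + 1) % 2 ^ w = q + 1 := Nat.mod_eq_of_lt (by omega)
    have hmul : m * (q + 1) ≤ n + m := by rw [mul_add]; omega
    have hstep : ∀ r < q + 1, r ≠ q → r < q := by intro r h h'; omega
    simp only [multiplierRow]
    rw [Cmd.block_cons_cons]
    refine Wp.seq (Wp.ite (fun he' => ?_) (fun he' => ?_))
    · have hqp : q.Prime := hpr.1 (by simpa [Expr.eval, hqv] using he')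
      refine (wp_nextPrime (n := n) (m := m) (p := p) (q := q) hw ?_ hm0 ?_ ?_ ?_ hpp hqp hpq
        (by omega) ?_ ?_).mono ?_
      · exact h4.congr rfl rfl rfl (fun _ h => h)
      · exact hmY
      · exact hpv
      · exact hqv
      · exact h2
      · exact h3
      rintro Z hZ ⟨h8, h9, h10, h11, h12, h13, h14⟩
      have hqZ : Z.st.var rQ = q := by rw [hZ.var rQ rfl]; exact hqv
      refine Wp.assign ?_
      simp only [Expr.eval, Op.eval, hqZ, Nat.mod_eq_of_lt h1, State.setVar_var,
        State.setVar_arr, if_true, hm1]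
      refine ⟨by omega, hmul, trivial, q, hqp, by omega, by omega, by simpa using h9, h10,
        by simpa using h11, h8.congr (by simp) (by simp) (by simp) (fun _ h => h),
        fun k hk => h13 k (h5 k hk), fun r hr hrp hrn => ?_, ?_⟩
      · by_cases hrq : r = q
        · rw [hrq]; exact h12
        · exact h13 _ (h6 r (hstep r hr hrq) hrp hrn)
      · have h15 : (q - p) * harmonicMul m + harmonicMul m * p = harmonicMul m * q := by
          rw [mul_comm, ← mul_add, Nat.sub_add_cancel hpq.le]
        simp only [Expr.cost, Expr.lt, Expr.inputSucc] at h14 ⊢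
        omega
    · have hqp : ¬ q.Prime := by rw [← hpr]; simpa [Expr.eval, hqv] using he'
      refine Wp.skip (Wp.assign ?_)
      simp only [Expr.eval, Op.eval, hqv, Nat.mod_eq_of_lt h1, State.setVar_var,
        State.setVar_arr, if_true, hm1]
      refine ⟨by omega, hmul, trivial, p, hpp, by omega, hmp, by simpa using hpv, h2,
        by simpa using h3, h4.congr (by simp) (by simp) (by simp) (fun _ h => h),
        h5, fun r hr hrp hrn => h6 r (hstep r hr ?_) hrp hrn, ?_⟩
      · rintro rfl; exact hqp hrp
      · simp only [Expr.cost, Expr.lt, Expr.inputSucc]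
        omega

/-- Each `m` costs `O(n H)`, where `H` is a bound for `harmonicMul m / m`: all values `δ(m q)`
together are about as expensive as a single value near `n`. -/
theorem wp_columnOf {w n m H : ℕ} {X : Config} (hw : (n + 1) * (n + 1) < 2 ^ w)
    (hH : ∀ m ≤ n, harmonicMul m ≤ m * H) (hP : Prepared n X) (hL : Ledger n X) (hm0 : 1 ≤ m)
    (hm : X.st.var rM = m) (hm2 : m * 2 ≤ n) :
    Wp w columnOf (fun Y => Ledger n Y ∧ Y.st.var rM = m + 1 ∧
      (∀ k, X.st.arr aDone k ≠ 0 → Y.st.arr aDone k ≠ 0) ∧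
      (∀ r, r.Prime → m * r ≤ n → Y.st.arr aDone (m * r) ≠ 0) ∧
      Y.time ≤ X.time + 1000 * (n * H)) X := by
  have hn : 1 ≤ n := by omega
  have h1 : 1 < 2 ^ w := by nlinarith
  have h2w : 2 < 2 ^ w := by nlinarith
  have h3w : 3 < 2 ^ w := by nlinarith
  have hnw : n + 1 < 2 ^ w := by nlinarith
  have hnH : n ≤ n * H := (le_harmonicMul n).trans (hH n le_rfl)
  have h2m : (m * 2 + 1) * (m * 2 + 1) < 2 ^ w :=
    (Nat.mul_le_mul (by omega) (by omega)).trans_lt hw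
  simp only [columnOf, Cmd.block_cons_cons, Cmd.block_singleton, Cmd.incr]
  refine Wp.seq (Wp.assign (Wp.seq ((wp_clear (B := n + 1) hnw h1 ?_ ?_).mono ?_)))
  · intro Y hY
    have : Y.st.var .input = n := by rw [hY.var .input rfl]; simpa using hP.input
    simp [Expr.inputSucc, Expr.eval, Op.eval, this, Nat.mod_eq_of_lt h1, Nat.mod_eq_of_lt hnw]
  · simp [Expr.eval]
  rintro Y hY ⟨h2, -, h3⟩
  have hmY : Y.st.var rM = m := by rw [hY.var rM rfl]; simpa using hm
  refine Wp.seq (Wp.assign (Wp.seq (Wp.assign (Wp.seq (Wp.assign (Wp.seq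
    ((wp_fillPairs_sqrt (N := m * 2) (by omega) h2m ?_ ?_).mono ?_)))))))
  · simp [Expr.eval, Op.eval, hmY, Nat.mod_eq_of_lt h2w,
      Nat.mod_eq_of_lt (show m * 2 < 2 ^ w by omega)]
  · simp [Expr.eval, Op.eval, hmY, Nat.mod_eq_of_lt h2w,
      Nat.mod_eq_of_lt (show m * 2 < 2 ^ w by omega)]
  rintro Z hZ ⟨h4, h5⟩
  refine Wp.seq ((wp_callDelta (N := m * 2) h1 (by omega) h4).mono ?_)
  rintro V hV ⟨h6, h7, h8, h9, h10⟩
  have hcV : V.st.var rCur = m * 2 := by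
    rw [hV.var rCur rfl, hZ.var rCur rfl]
    simp [Expr.eval, Op.eval, hmY, Nat.mod_eq_of_lt h2w,
      Nat.mod_eq_of_lt (show m * 2 < 2 ^ w by omega)]
  have hdV : ∀ a, a = aDone ∨ a = aDelta ∨ a = aPrime → V.st.arr a = X.st.arr a := by
    rintro a (rfl | rfl | rfl)
    · rw [hV.arr aDone rfl, hZ.arr aDone rfl]
      simp only [State.setVar_arr]
      rw [hY.arr aDone rfl, State.setVar_arr]
    · rw [hV.arr aDelta rfl, hZ.arr aDelta rfl]
      simp only [State.setVar_arr]
      rw [hY.arr aDelta rfl, State.setVar_arr]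
    · rw [hV.arr aPrime rfl, hZ.arr aPrime rfl]
      simp only [State.setVar_arr]
      rw [hY.arr aPrime rfl, State.setVar_arr]
  have hrV : V.st.var rRem = X.st.var rRem := by
    rw [hV.var rRem rfl, hZ.var rRem rfl]
    simp only [State.setVar_var, Var.tmp.injEq, Nat.reduceEqDiff, if_false]
    rw [hY.var rRem rfl]
    simp
  have hiV : V.st.var .input = X.st.var .input := by
    rw [hV.var .input rfl, hZ.var .input rfl]
    simp only [State.setVar_var, reduceCtorEq, if_false]
    rw [hY.var .input rfl]
    simp
  have hmV : V.st.var rM = m := by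
    rw [hV.var rM rfl, hZ.var rM rfl]
    simpa using hmY
  have hbV : Marks (V.st.arr .bits) (deltaProducts (m * 2)) (n + 1) := by
    intro x hx
    by_cases hxm : x < m * 2
    · exact h7 x hxm
    · rw [h8 x (by omega), if_neg (fun h => hxm (lt_of_mem_deltaProducts h)), hZ.arr .bits rfl]
      simpa using h2 x hx
  have hc : X.calls ⊆ V.calls := fun c hc => hV.calls (hZ.calls (hY.calls hc))
  have hLV : Ledger n V := hL.congr hrV (hdV _ (by simp)) (hdV _ (by simp)) hc
  refine Wp.seq ((wp_fileDelta h1 hLV (by omega) hm2 hcV h6 h9).mono ?_)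
  rintro U hU ⟨h11, h12, h13, h14⟩
  refine Wp.seq (Wp.assign (Wp.seq (Wp.assign (Wp.seq ((wp_multiplierLoop (n := n) (m := m) hw
    ?_ ?_ hm0 ?_ ?_ ?_ hm2 ?_ ?_ ?_).mono ?_)))))
  · refine hP.congr ?_ ?_
    · simp only [State.setVar_var, reduceCtorEq, if_false]
      rw [hU.var .input rfl, hiV]
    · simp only [State.setVar_arr]
      rw [hU.arr aPrime rfl, hdV _ (by simp)]
  · exact h11.congr (by simp) (by simp) (by simp) (fun _ h => h)
  · simp only [State.setVar_var, Var.tmp.injEq, OfNat.zero_ne_ofNat, if_false, zero_ne_one]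
    rw [hU.var rM rfl, hmV]
  · simp [Expr.eval, Nat.mod_eq_of_lt h2w]
  · simp [Expr.eval, Nat.mod_eq_of_lt h3w]
  · simp only [State.setVar_arr]
    rw [hU.arr .bits rfl]
    exact hbV
  · simp only [State.setVar_var, reduceCtorEq, if_false]
    rw [hU.var .weight rfl, h6]
  · simpa using h12
  rintro W hW ⟨h15, h16, h17, p, h18, h19⟩
  have hmW : W.st.var rM = m := by
    rw [hW.var rM rfl]
    simp only [State.setVar_var, Var.tmp.injEq, OfNat.zero_ne_ofNat, if_false, zero_ne_one]
    rw [hU.var rM rfl, hmV]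
  refine Wp.assign ⟨h15.congr (by simp) (by simp) (by simp) (fun _ h => h), ?_, ?_, ?_, ?_⟩
  · simp [Expr.eval, Op.eval, hmW, Nat.mod_eq_of_lt h1,
      Nat.mod_eq_of_lt (show m + 1 < 2 ^ w by omega)]
  · intro k hk
    simp only [State.setVar_arr]
    refine h16 k ?_
    simp only [State.setVar_arr]
    exact h13 k (by rw [hdV _ (by simp)]; exact hk)
  · intro r hr hrn
    simpa using h17 r hr hrn
  · have h20 : harmonicMul m * p ≤ n * H := by
      calc harmonicMul m * p ≤ (m * H) * p := Nat.mul_le_mul_right _ (hH m (by omega))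
        _ = (m * p) * H := by ring
        _ ≤ n * H := Nat.mul_le_mul_right _ h18
    have h21 : harmonicMul (m * 2) ≤ n * H :=
      (hH _ hm2).trans (Nat.mul_le_mul_right _ hm2)
    have h22 := Nat.sqrt_le_self (m * 2)
    simp only [Expr.cost, Expr.inputSucc] at h3 h5 h10 h14 h19 ⊢
    omega

/-! ### The whole run -/

/-- The number of `k ≤ n` that are not of the form `m' q` with `m' < m` and `q` prime. -/
noncomputable def uncovered (n m : ℕ) : ℕ :=
  {k | k ∈ Finset.Icc 1 n ∧ ¬ ∃ m' < m, ∃ q : ℕ, q.Prime ∧ k = m' * q}.ncard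

/-- Treats `m = 1, 2, …` as long as `2 m` is below the number of the values `δ(k)` that are
unknown.  This test balances the two parts of the computation without evaluating `L(n)`. -/
def columns : Cmd := .block [
  .assign rRem (.var .input),
  .assign rM (.const 1),
  .loop (.lt (.bin .mul (.var rM) (.const 2)) (.var rRem)) columnOf]

theorem card_unknown_le {n m : ℕ} {a : ℕ → ℕ}
    (h : ∀ m' < m, ∀ q : ℕ, q.Prime → 1 ≤ m' → m' * q ≤ n → a (m' * q) ≠ 0) :
    ((Finset.Icc 1 n).filter fun k => a k = 0).card ≤ uncovered n m := by
  rw [← Set.ncard_coe_finset]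
  refine Set.ncard_le_ncard ?_ ((Finset.Icc 1 n).finite_toSet.subset fun k hk => hk.1)
  intro k hk
  simp only [Finset.coe_filter, Set.mem_ofPred_eq] at hk ⊢
  refine ⟨hk.1, ?_⟩
  rintro ⟨m', hm', q, hq, rfl⟩
  rw [Finset.mem_Icc] at hk
  refine h m' hm' q hq ?_ hk.1.2 hk.2
  exact Nat.pos_of_ne_zero (by rintro rfl; simp at hk)

/-- The multiplier `m` at which the loop ends is bounded through the counts `uncovered n m'`, `m' < m`,
which are purely arithmetical. -/
theorem wp_columns {w n H : ℕ} {X : Config} (hn : 1 ≤ n) (hw : (n + 1) * (n + 1) < 2 ^ w)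
    (hH : ∀ m ≤ n, harmonicMul m ≤ m * H) (hP : Prepared n X)
    (hdone : ∀ k, X.st.arr aDone k = 0) :
    Wp w columns (fun Y => Ledger n Y ∧ ∃ m, 1 ≤ m ∧
      (∀ m' < m, 1 ≤ m' → 2 * m' < uncovered n m') ∧ Y.st.var rRem ≤ 2 * m ∧
      Y.time ≤ X.time + 2000 * (m * (n * H))) X := by
  have h1 : 1 < 2 ^ w := by nlinarith
  have h2w : 2 < 2 ^ w := by nlinarith
  have h2n : 2 * n + 1 < 2 ^ w := by nlinarith
  have hnH : n ≤ n * H := (le_harmonicMul n).trans (hH n le_rfl)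
  simp only [columns, Cmd.block_cons_cons, Cmd.block_singleton]
  refine Wp.seq (Wp.assign (Wp.seq (Wp.assign ?_)))
  refine Wp.loop (fun m Y => (1 ≤ m ∧ m ≤ n + 1) ∧ Y.st.var rM = m ∧ Ledger n Y ∧
    (∀ m' < m, ∀ q : ℕ, q.Prime → 1 ≤ m' → m' * q ≤ n → Y.st.arr aDone (m' * q) ≠ 0) ∧
    (∀ m' < m, 1 ≤ m' → 2 * m' < uncovered n m') ∧
    Y.time ≤ X.time + 4 + 1010 * ((m - 1) * (n * H))) (n + 1) 1 ?_ ?_ ?_ ?_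
  · refine ⟨by omega, by simp [Expr.eval, Nat.mod_eq_of_lt h1], ⟨fun k _ _ h => ?_, ?_⟩, ?_, ?_, ?_⟩
    · simp [hdone] at h
    · simp [hdone, Expr.eval, hP.input]
    · intro m' h h' h'' h'''; omega
    · intro m' h h'; omega
    · simp only [Expr.cost]; omega
  · exact fun m Y h => h.1.2
  · rintro m Y hF ⟨hm, hmv, h2, h3, h4, h5⟩ he
    have h6 : (m - 1) * (n * H) + n * H = m * (n * H) := by
      obtain ⟨m, rfl⟩ : ∃ m', m = m' + 1 := ⟨m - 1, by omega⟩
      rw [Nat.add_sub_cancel, add_mul, one_mul]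
    simp only [Expr.lt, Expr.eval, Op.eval, hmv, Nat.mod_eq_of_lt h2w] at he
    rw [Nat.mod_eq_of_lt] at he
    · simp only [ite_eq_right_iff, one_ne_zero, imp_false, not_lt] at he
      refine ⟨h2.congr rfl rfl rfl fun _ h => h, m, hm.1, h4, by simp only; omega, ?_⟩
      simp only [Expr.cost, Expr.lt]; omega
    · nlinarith
  · rintro m Y hF ⟨hm, hmv, h2, h3, h4, h5⟩ he
    have hm2w : m * 2 < 2 ^ w := by nlinarith
    simp only [Expr.lt, Expr.eval, Op.eval, hmv, Nat.mod_eq_of_lt h2w, Nat.mod_eq_of_lt hm2w,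
      ne_eq, ite_eq_right_iff, one_ne_zero, imp_false, not_not] at he
    have hrem : Y.st.var rRem ≤ uncovered n m := h2.rem.trans_le (card_unknown_le h3)
    have hremn : Y.st.var rRem ≤ n := by
      rw [h2.rem]
      simpa using Finset.card_filter_le (Finset.Icc 1 n) (fun k => Y.st.arr aDone k = 0)
    refine (wp_columnOf (m := m) hw hH ?_ ?_ hm.1 ?_ (by omega)).mono ?_
    · refine hP.congr ?_ ?_
      · simp only; rw [hF.var .input rfl]; simp
      · simp only; rw [hF.arr aPrime rfl]; simp
    · exact h2.congr rfl rfl rfl fun _ h => h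
    · exact hmv
    · rintro Z hZ ⟨h6, h7, h8, h9, h10⟩
      refine ⟨by omega, h7, h6, fun m' hm' q hq h' h'' => ?_, fun m' hm' h' => ?_, ?_⟩
      · by_cases hmm : m' = m
        · subst hmm; exact h9 q hq h''
        · exact h8 _ (h3 m' (by omega) q hq h' h'')
      · by_cases hmm : m' = m
        · subst hmm; omega
        · exact h4 m' (by omega) h'
      · have h11 : (m + 1 - 1) * (n * H) = (m - 1) * (n * H) + n * H := by
          obtain ⟨m, rfl⟩ : ∃ m', m = m' + 1 := ⟨m - 1, by omega⟩
          rw [Nat.add_sub_cancel, Nat.add_sub_cancel, add_mul, one_mul]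
        rw [h11]
        simp only [Expr.cost, Expr.lt] at h10
        omega

/-- Computes the value `δ(rCur)` by the first algorithm. -/
def directDelta : Cmd := .block [
  .assign rBase (.var rCur),
  .assign rNum (.var rCur),
  fillPairs .fst .snd guardSqrt,
  .call .delta,
  .store aDelta (.var rCur) (.var .weight)]

/-- Computes `M(k)` from `M(k - 1)`, after supplying `δ(k)` if it is unknown. -/
def finishBody : Cmd := .block [
  .ite (.eq (.read aDone (.var rCur)) (.const 0)) directDelta .skip,
  .assign rAcc (.bin .sub (.bin .add (.var rAcc) (.var rCur)) (.read aDelta (.var rCur))),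
  .store .out (.var rCur) (.var rAcc),
  .incr rCur]

/-- Computes the values `M(k)`. -/
def finish : Cmd := .block [
  .assign rCur (.const 1),
  .assign rAcc (.const 0),
  .loop (.lt (.var rCur) .inputSucc) finishBody]

theorem wp_directDelta {w n k H : ℕ} {X : Config} (hw : (n + 1) * (n + 1) < 2 ^ w)
    (hH : ∀ m ≤ n, harmonicMul m ≤ m * H) (hk1 : 1 ≤ k) (hkn : k ≤ n)
    (hk : X.st.var rCur = k) :
    Wp w directDelta (fun Y => Y.st.arr aDelta = Function.update (X.st.arr aDelta) k (deltaCount k) ∧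
      Computed Y.calls k ∧ Y.time ≤ X.time + 300 * (n * H)) X := by
  have h1 : 1 < 2 ^ w := by nlinarith
  have hnw : n + 1 < 2 ^ w := by nlinarith
  have hkw : (k + 1) * (k + 1) < 2 ^ w :=
    (Nat.mul_le_mul (by omega) (by omega)).trans_lt hw
  have hnH : n ≤ n * H := (le_harmonicMul n).trans (hH n le_rfl)
  have hkH : harmonicMul k ≤ n * H := (hH k hkn).trans (Nat.mul_le_mul_right _ hkn)
  have hs := Nat.sqrt_le_self k
  simp only [directDelta, Cmd.block_cons_cons, Cmd.block_singleton]
  refine Wp.seq (Wp.assign (Wp.seq (Wp.assign (Wp.seq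
    ((wp_fillPairs_sqrt (N := k) (by omega) hkw ?_ ?_).mono ?_)))))
  · simp [Expr.eval, hk]
  · simp [Expr.eval, hk]
  rintro Y hY ⟨h2, h3⟩
  refine Wp.seq ((wp_callDelta (N := k) h1 (by omega) h2).mono ?_)
  rintro Z hZ ⟨h4, -, -, h5, h6⟩
  have hcZ : Z.st.var rCur = k := by
    rw [hZ.var rCur rfl, hY.var rCur rfl]; simpa using hk
  have haZ : Z.st.arr aDelta = X.st.arr aDelta := by
    rw [hZ.arr aDelta rfl, hY.arr aDelta rfl]; simp
  refine Wp.store ⟨?_, h5, ?_⟩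
  · simp [Expr.eval, hcZ, haZ, h4]
  · simp only [Expr.cost] at h3 h6 ⊢
    omega

theorem wp_finish {w n H : ℕ} {X : Config} (hw : (n + 1) * (n + 1) < 2 ^ w)
    (hH : ∀ m ≤ n, harmonicMul m ≤ m * H) (hin : X.st.var .input = n) (hL : Ledger n X) :
    Wp w finish (fun Y => (∀ k, 1 ≤ k → k ≤ n → Y.st.arr .out k = tableCount k ∧
        Computed Y.calls k) ∧
      Y.time ≤ X.time + 40 * (n + 1) + 300 * (X.st.var rRem * (n * H))) X := by
  have h1 : 1 < 2 ^ w := by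
    by_contra h
    have : 1 ≤ (n + 1) * (n + 1) := Nat.mul_pos (by omega) (by omega)
    omega
  have hnw : n + 1 < 2 ^ w := by nlinarith
  have hguard : ∀ s : State, s.var .input = n → Expr.inputSucc.eval w s = n + 1 := by
    intro s hs
    simp [Expr.inputSucc, Expr.eval, Op.eval, hs, Nat.mod_eq_of_lt h1, Nat.mod_eq_of_lt hnw]
  simp only [finish, Cmd.block_cons_cons, Cmd.block_singleton]
  refine Wp.seq (Wp.assign (Wp.seq (Wp.assign ?_)))
  refine Wp.loop (fun k Y => (1 ≤ k ∧ k ≤ n + 1) ∧ Y.st.var rCur = k ∧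
    Y.st.var rAcc = tableCount (k - 1) ∧
    (∀ k', 1 ≤ k' → k' < k → Y.st.arr .out k' = tableCount k' ∧ Computed Y.calls k') ∧
    (∀ k', k ≤ k' → Y.st.arr aDelta k' = X.st.arr aDelta k') ∧
    Y.time ≤ X.time + 4 + 40 * (k - 1) +
      300 * (((Finset.Ico 1 k).filter fun k' => X.st.arr aDone k' = 0).card * (n * H)))
    (n + 1) 1 ?_ ?_ ?_ ?_
  · refine ⟨by omega, by simp [Expr.eval, Nat.mod_eq_of_lt h1], ?_, ?_, ?_, ?_⟩
    · simp [Expr.eval, tableCount, multTable]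
    · intro k' h h'; omega
    · simp
    · simp only [Expr.cost]; omega
  · exact fun k Y h => h.1.2
  · rintro k Y hF ⟨hk, hkv, h2, h3, h4, h5⟩ he
    have hinY : Y.st.var .input = n := by rw [hF.var .input rfl]; simpa using hin
    simp only [Expr.lt, Expr.eval, Op.eval, hguard _ hinY, hkv, ite_eq_right_iff, one_ne_zero,
      imp_false, not_lt] at he
    obtain rfl : k = n + 1 := by omega
    refine ⟨fun k' hk1 hkn => h3 k' hk1 (by omega), ?_⟩
    have h6 : Finset.Ico 1 (n + 1) = Finset.Icc 1 n := rfl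
    rw [h6, ← hL.rem] at h5
    simp only [Expr.cost, Expr.lt, Expr.inputSucc]
    omega
  · rintro k Y hF ⟨hk, hkv, h2, h3, h4, h5⟩ he
    have hinY : Y.st.var .input = n := by rw [hF.var .input rfl]; simpa using hin
    simp only [Expr.lt, Expr.eval, Op.eval, hguard _ hinY, hkv, ne_eq, ite_eq_right_iff,
      one_ne_zero, imp_false, not_not] at he
    have hdY : Y.st.arr aDone = X.st.arr aDone := by rw [hF.arr aDone rfl]; simp
    have hXc : X.calls ⊆ Y.calls := hF.calls
    -- the common continuation of the two branches; `c` is the number of values computed directly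
    have hfin : ∀ (Z : Config) (D c : ℕ), Z.st.var rCur = k →
        Z.st.var rAcc = tableCount (k - 1) → Z.st.arr aDelta k = deltaCount k →
        Z.st.arr .out = Y.st.arr .out → Computed Z.calls k → Y.calls ⊆ Z.calls →
        (∀ k', k + 1 ≤ k' → Z.st.arr aDelta k' = X.st.arr aDelta k') →
        ((Finset.Ico 1 (k + 1)).filter fun k' => X.st.arr aDone k' = 0).card = D + c →
        Z.time ≤ X.time + 28 + 40 * (k - 1) + 300 * (D * (n * H)) + 300 * (c * (n * H)) →
        Wp w (Cmd.block [
            .assign rAcc (.bin .sub (.bin .add (.var rAcc) (.var rCur))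
              (.read aDelta (.var rCur))),
            .store .out (.var rCur) (.var rAcc),
            .incr rCur]) (fun Y => (1 ≤ k + 1 ∧ k + 1 ≤ n + 1) ∧ Y.st.var rCur = k + 1 ∧
          Y.st.var rAcc = tableCount (k + 1 - 1) ∧
          (∀ k', 1 ≤ k' → k' < k + 1 → Y.st.arr .out k' = tableCount k' ∧
            Computed Y.calls k') ∧
          (∀ k', k + 1 ≤ k' → Y.st.arr aDelta k' = X.st.arr aDelta k') ∧
          Y.time ≤ X.time + 4 + 40 * (k + 1 - 1) +
            300 * (((Finset.Ico 1 (k + 1)).filter fun k' => X.st.arr aDone k' = 0).card *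
              (n * H))) Z := by
      intro Z D c hZ1 hZ2 hZ3 hZ4 hZ5 hZ6 hZ7 hZ8 hZ9
      obtain ⟨l, rfl⟩ : ∃ l, k = l + 1 := ⟨k - 1, by omega⟩
      have h6 := tableCount_le l
      have h7 : l * l + (l + 1) < 2 ^ w := by nlinarith
      have h8 := tableCount_add_deltaCount l
      have h9 : tableCount l + (l + 1) - deltaCount (l + 1) = tableCount (l + 1) := by omega
      rw [Nat.add_sub_cancel] at hZ2 hZ9
      rw [hZ8, add_mul]
      simp only [Cmd.block_cons_cons, Cmd.block_singleton, Cmd.incr]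
      refine Wp.seq (Wp.assign (Wp.seq (Wp.store (Wp.assign ?_))))
      simp only [Expr.eval, Op.eval, hZ1, hZ2, hZ3, hZ4, Nat.mod_eq_of_lt h1, State.setVar_var,
        State.setVar_arr, State.setArr_var, State.setArr_arr, if_true, if_false, reduceCtorEq,
        Var.tmp.injEq, Nat.reduceEqDiff, Nat.mod_eq_of_lt (show l + 1 + 1 < 2 ^ w by omega),
        Nat.mod_eq_of_lt (show tableCount l + (l + 1) < 2 ^ w by omega), h9]
      refine ⟨by omega, trivial, rfl, fun k' hk1 hk2 => ?_, hZ7, ?_⟩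
      · by_cases hkk : k' = l + 1
        · subst hkk; simpa using hZ5
        · rw [Function.update_of_ne hkk]
          have := h3 k' hk1 (by omega)
          exact ⟨this.1, this.2.mono hZ6⟩
      · simp only [Expr.cost]
        omega
    have hcard : ((Finset.Ico 1 (k + 1)).filter fun k' => X.st.arr aDone k' = 0).card =
        ((Finset.Ico 1 k).filter fun k' => X.st.arr aDone k' = 0).card +
          if X.st.arr aDone k = 0 then 1 else 0 := by
      rw [← Finset.insert_Ico_right_eq_Ico_add_one hk.1, Finset.filter_insert]
      split_ifs with h
      · rw [Finset.card_insert_of_notMem (by simp)]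
      · simp
    simp only [finishBody]
    rw [Cmd.block_cons_cons]
    refine Wp.seq (Wp.ite (fun he' => ?_) (fun he' => ?_))
    · have h0 : X.st.arr aDone k = 0 := by
        simpa [Expr.eq, Expr.eval, Op.eval, hkv, hdY] using he'
      rw [if_pos h0] at hcard
      refine (wp_directDelta (k := k) hw hH hk.1 (by omega) ?_).mono ?_
      · exact hkv
      rintro Z hZ ⟨h6, h7, h8⟩
      refine hfin Z _ 1 ?_ ?_ ?_ ?_ h7 hZ.calls ?_ hcard ?_
      · rw [hZ.var rCur rfl]; exact hkv
      · rw [hZ.var rAcc rfl]; exact h2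
      · rw [h6, Function.update_self]
      · rw [hZ.arr .out rfl]
      · intro k' hk'
        rw [h6, Function.update_of_ne (by omega)]
        exact h4 k' (by omega)
      · simp only [Expr.cost, Expr.lt, Expr.eq, Expr.inputSucc] at h8
        omega
    · have h0 : X.st.arr aDone k ≠ 0 := by
        intro h
        simp [Expr.eq, Expr.eval, Op.eval, hkv, hdY, h] at he'
      rw [if_neg h0] at hcard
      have hkn := hL.known k hk.1 (by omega) h0
      refine Wp.skip (hfin _ _ 0 hkv h2 ?_ rfl (hkn.2.mono hXc) (fun _ h => h) ?_ hcard ?_)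
      · simp only; rw [h4 k le_rfl]; exact hkn.1
      · exact fun k' hk' => h4 k' (by omega)
      · simp only [Expr.cost, Expr.lt, Expr.eq, Expr.inputSucc]
        omega

/-- The tabulation program. -/
def tabulation : Cmd := .block [primeTable, columns, finish]

/-- The program is correct on words that can hold `(n + 1)²`.  Its running time is governed by the
last multiplier `m`, which also bounds, up to a factor `2`, the number of direct computations. -/
theorem tabulates {w n H : ℕ} (hn : 1 ≤ n) (hw : (n + 1) * (n + 1) < 2 ^ w)
    (hH : ∀ m ≤ n, harmonicMul m ≤ m * H) :
    ∃ m, 1 ≤ m ∧ (∀ m' < m, 1 ≤ m' → 2 * m' < uncovered n m') ∧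
      ∃ t ≤ 60 * (n * (n.sqrt + 1)) + 3000 * (m * (n * H)), Tabulates tabulation w n t := by
  have hnH : n ≤ n * H := (le_harmonicMul n).trans (hH n le_rfl)
  have key : Wp w tabulation (fun Y => (∀ k, 1 ≤ k → k ≤ n → Y.st.arr .out k = tableCount k ∧
        Computed Y.calls k) ∧ ∃ m, 1 ≤ m ∧ (∀ m' < m, 1 ≤ m' → 2 * m' < uncovered n m') ∧
      Y.time ≤ 60 * (n * (n.sqrt + 1)) + 3000 * (m * (n * H))) ⟨State.init n, 0, []⟩ := by
    simp only [tabulation, Cmd.block_cons_cons, Cmd.block_singleton]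
    refine Wp.seq ((wp_primeTable hn hw (by simp [State.init])).mono ?_)
    rintro Y hY ⟨h2, h3⟩
    have hi : Y.st.var .input = n := by rw [hY.var .input rfl]; simp [State.init]
    refine Wp.seq ((wp_columns hn hw hH ⟨hi, h2⟩ ?_).mono ?_)
    · intro k; rw [hY.arr aDone rfl]; rfl
    rintro Z hZ ⟨h4, m, h5, h6, h7, h8⟩
    refine (wp_finish hw hH ((hZ.var .input rfl).trans hi) h4).mono ?_
    rintro V - ⟨h9, h10⟩
    refine ⟨h9, m, h5, h6, ?_⟩
    have h11 : Z.st.var rRem * (n * H) ≤ 2 * (m * (n * H)) :=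
      (Nat.mul_le_mul_right _ h7).trans_eq (mul_assoc _ _ _)
    have h12 : n * H ≤ m * (n * H) := Nat.le_mul_of_pos_left _ h5
    simp only at h3
    omega
  obtain ⟨t, cs, s, hx, h2, m, h3, h4, h5⟩ := key
  refine ⟨m, h3, h4, t, by simpa using h5, cs, s, hx, fun k hk => ?_, fun k hk => ?_⟩
  · rw [Finset.mem_Icc] at hk
    exact (h2 k hk.1 hk.2).1
  · rw [Finset.mem_Icc] at hk
    simpa [Computed] using (h2 k hk.1 hk.2).2

/-! ### Smooth numbers -/

/-- Chebyshev's bound, in the form that the primes in a dyadic interval have a small product. -/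
theorem card_primes_dyadic_mul_le (j : ℕ) :
    ((Finset.Ico (2 ^ j) (2 ^ (j + 1))).filter Nat.Prime).card * j ≤ 4 * 2 ^ j := by
  set S := (Finset.Ico (2 ^ j) (2 ^ (j + 1))).filter Nat.Prime with hS
  have h1 : (2 ^ j) ^ S.card ≤ ∏ p ∈ S, p :=
    Finset.pow_card_le_prod _ _ _ fun p hp => by
      rw [hS, Finset.mem_filter, Finset.mem_Ico] at hp; exact hp.1.1
  have h2 : ∏ p ∈ S, p ≤ primorial (2 ^ (j + 1)) := by
    refine Finset.prod_le_prod_of_subset_of_one_le' (fun p hp => ?_) fun p hp _ => ?_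
    · rw [hS, Finset.mem_filter, Finset.mem_Ico] at hp
      rw [Finset.mem_filter, Finset.mem_range]
      exact ⟨by omega, hp.2⟩
    · exact (Finset.mem_filter.1 hp).2.one_le
  have h3 := (h1.trans h2).trans (primorial_le_four_pow _)
  rw [← pow_mul, show 4 = 2 ^ 2 from rfl, ← pow_mul] at h3
  have h4 := (Nat.pow_le_pow_iff_right (by norm_num)).1 h3
  rw [pow_succ] at h4
  linarith [mul_comm j S.card]

/-- Mertens' upper bound: the primes between `2 ^ j` and `2 ^ (j + 1)` contribute at most `4 / j`. -/
theorem sum_primesBelow_inv_le (J : ℕ) :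
    ∑ p ∈ Nat.primesBelow (2 ^ J), (p : ℝ)⁻¹ ≤ 4 * (1 + Real.log J) := by
  have key : ∀ J : ℕ, ∑ p ∈ Nat.primesBelow (2 ^ (J + 1)), (p : ℝ)⁻¹ ≤
      4 * ∑ j ∈ Finset.range J, ((j : ℝ) + 1)⁻¹ := by
    intro J
    induction J with
    | zero =>
      simp
    | succ J ih =>
      have h1 : Nat.primesBelow (2 ^ (J + 1 + 1)) = Nat.primesBelow (2 ^ (J + 1)) ∪
          (Finset.Ico (2 ^ (J + 1)) (2 ^ (J + 1 + 1))).filter Nat.Prime := by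
        have : 2 ^ (J + 1) ≤ 2 ^ (J + 1 + 1) := Nat.pow_le_pow_right (by norm_num) (by omega)
        ext p
        simp only [Nat.mem_primesBelow, Finset.mem_union, Finset.mem_filter, Finset.mem_Ico]
        constructor
        · rintro ⟨h, h'⟩
          rcases lt_or_ge p (2 ^ (J + 1)) with h'' | h''
          · exact Or.inl ⟨h'', h'⟩
          · exact Or.inr ⟨⟨h'', h⟩, h'⟩
        · rintro (⟨h, h'⟩ | ⟨⟨h, h'⟩, h''⟩)
          · exact ⟨h.trans_le this, h'⟩
          · exact ⟨h', h''⟩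
      have h2 : Disjoint (Nat.primesBelow (2 ^ (J + 1)))
          ((Finset.Ico (2 ^ (J + 1)) (2 ^ (J + 1 + 1))).filter Nat.Prime) := by
        rw [Finset.disjoint_left]
        intro p hp hp'
        simp only [Nat.mem_primesBelow, Finset.mem_filter, Finset.mem_Ico] at hp hp'
        omega
      rw [h1, Finset.sum_union h2, Finset.sum_range_succ, mul_add]
      refine add_le_add ih ?_
      have h3 := card_primes_dyadic_mul_le (J + 1)
      set S := (Finset.Ico (2 ^ (J + 1)) (2 ^ (J + 1 + 1))).filter Nat.Prime with hS
      have h4 : ∑ p ∈ S, (p : ℝ)⁻¹ ≤ ∑ p ∈ S, ((2 : ℝ) ^ (J + 1))⁻¹ := by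
        refine Finset.sum_le_sum fun p hp => ?_
        rw [hS, Finset.mem_filter, Finset.mem_Ico] at hp
        refine inv_anti₀ (by positivity) ?_
        exact_mod_cast hp.1.1
      refine h4.trans ?_
      rw [Finset.sum_const, nsmul_eq_mul, ← div_eq_mul_inv, ← div_eq_mul_inv,
        div_le_div_iff₀ (by positivity) (by positivity)]
      exact_mod_cast h3
  rcases J with _ | J
  · simp
  · refine (key J).trans (mul_le_mul_of_nonneg_left ?_ (by norm_num))
    have h1 := harmonic_le_one_add_log (J + 1)
    refine le_trans ?_ h1
    rw [harmonic]
    push_cast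
    rw [Finset.sum_range_succ]
    have : (0 : ℝ) ≤ ((J : ℝ) + 1)⁻¹ := by positivity
    linarith

/-- The number of `Y`-smooth numbers up to `n`, where smooth means that all prime factors are less
than `Y`. -/
noncomputable def smoothCount (n Y : ℕ) : ℕ := {k | k ∈ Finset.Icc 1 n ∧ k ∈ Y.smoothNumbers}.ncard

/-- Rankin's bound: each smooth `k ≤ n` contributes at least `1` to `∑ (n / k) ^ σ`, and the sum of
`k ^ (-σ)` over all smooth numbers is an Euler product. -/
theorem smoothCount_le_rankin (n Y : ℕ) {σ : ℝ} (hσ : 1 / 2 ≤ σ) :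
    (smoothCount n Y : ℝ) ≤
      (n : ℝ) ^ σ * Real.exp (4 * ∑ p ∈ Y.primesBelow, (p : ℝ) ^ (-σ)) := by
  have hσ0 : 0 < σ := by linarith
  let f : ℕ →* ℝ :=
    { toFun := fun k => (k : ℝ) ^ (-σ)
      map_one' := by simp
      map_mul' := fun a b => by
        push_cast
        exact Real.mul_rpow (Nat.cast_nonneg a) (Nat.cast_nonneg b) }
  have hf : ∀ k, f k = (k : ℝ) ^ (-σ) := fun _ => rfl
  have hf0 : ∀ k, 0 ≤ f k := fun k => Real.rpow_nonneg (Nat.cast_nonneg k) _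
  have hfp : ∀ {p : ℕ}, p.Prime → f p ≤ 3 / 4 := by
    intro p hp
    have h2 : (2 : ℝ) ≤ p := by exact_mod_cast hp.two_le
    calc (p : ℝ) ^ (-σ) ≤ (2 : ℝ) ^ (-σ) :=
          Real.rpow_le_rpow_of_nonpos (by norm_num) h2 (by linarith)
      _ ≤ (2 : ℝ) ^ (-(1 / 2) : ℝ) := Real.rpow_le_rpow_of_exponent_le (by norm_num) (by linarith)
      _ ≤ 3 / 4 := by
          rw [Real.rpow_neg (by norm_num), ← Real.sqrt_eq_rpow]
          have h3 : (4 / 3 : ℝ) ≤ √2 := Real.le_sqrt_of_sq_le (by norm_num)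
          calc (√2)⁻¹ ≤ (4 / 3 : ℝ)⁻¹ := inv_anti₀ (by norm_num) h3
            _ = 3 / 4 := by norm_num
  have hf1 : ∀ {p : ℕ}, p.Prime → ‖f p‖ < 1 := by
    intro p hp
    rw [Real.norm_of_nonneg (hf0 p)]
    linarith [hfp hp]
  have hsum := (EulerProduct.summable_and_hasSum_smoothNumbers_prod_primesBelow_geometric
    (f := f) hf1 Y).2
  have hprod : ∏ p ∈ Y.primesBelow, (1 - f p)⁻¹ ≤
      Real.exp (4 * ∑ p ∈ Y.primesBelow, (p : ℝ) ^ (-σ)) := by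
    rw [Finset.mul_sum, Real.exp_sum]
    refine Finset.prod_le_prod (fun p hp => ?_) fun p hp => ?_
    · have := hfp (Nat.prime_of_mem_primesBelow hp)
      exact inv_nonneg.2 (by linarith)
    · have h1 := hfp (Nat.prime_of_mem_primesBelow hp)
      have h0 := hf0 p
      have h2 : (1 - f p)⁻¹ ≤ 4 * f p + 1 := by
        rw [inv_le_iff_one_le_mul₀ (by linarith)]
        nlinarith
      exact h2.trans (Real.add_one_le_exp _)
  set A : Set ℕ := {k | k ∈ Finset.Icc 1 n ∧ k ∈ Y.smoothNumbers} with hA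
  have hAfin : A.Finite := (Finset.Icc 1 n).finite_toSet.subset fun k hk => hk.1
  set B : Finset Y.smoothNumbers := hAfin.toFinset.subtype (· ∈ Y.smoothNumbers) with hB
  have hcard : B.card = smoothCount n Y := by
    rw [hB, Finset.card_subtype, Finset.filter_true_of_mem, smoothCount,
      Set.ncard_eq_toFinset_card _ hAfin]
    intro k hk
    exact (hAfin.mem_toFinset.1 hk).2
  have h1 : ∑ k ∈ B, f k ≤ ∏ p ∈ Y.primesBelow, (1 - f p)⁻¹ :=
    sum_le_hasSum B (fun k _ => hf0 k) hsum
  have h2 : (B.card : ℝ) * (n : ℝ) ^ (-σ) ≤ ∑ k ∈ B, f k := by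
    rw [← nsmul_eq_mul]
    refine Finset.card_nsmul_le_sum _ _ _ fun k hk => ?_
    have hk' : (k : ℕ) ∈ Finset.Icc 1 n := by
      rw [hB, Finset.mem_subtype, hAfin.mem_toFinset] at hk
      exact hk.1
    rw [Finset.mem_Icc] at hk'
    rw [hf]
    exact Real.rpow_le_rpow_of_nonpos (by exact_mod_cast hk'.1) (by exact_mod_cast hk'.2)
      (by linarith)
  rcases Nat.eq_zero_or_pos n with rfl | hn
  · have : smoothCount 0 Y = 0 := by simp [smoothCount]
    rw [this]
    simp only [Nat.cast_zero]
    positivity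
  · have hn' : (0 : ℝ) < (n : ℝ) ^ σ := Real.rpow_pos_of_pos (by exact_mod_cast hn) _
    rw [hcard, Real.rpow_neg (Nat.cast_nonneg n), ← div_eq_mul_inv] at h2
    rw [mul_comm, ← div_le_iff₀ hn']
    exact (h2.trans h1).trans hprod

/-- If no factorization `k = m' q` with `q` prime has `m' < m`, then all prime factors of `k` are at
most `k / m`. -/
theorem uncovered_le_smoothCount {n m Y : ℕ} (h : n < m * Y) :
    uncovered n m ≤ smoothCount n Y := by
  refine Set.ncard_le_ncard ?_ ((Finset.Icc 1 n).finite_toSet.subset fun k hk => hk.1)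
  rintro k ⟨hk, hk'⟩
  refine ⟨hk, Nat.mem_smoothNumbers'.2 ?_⟩
  rintro p hp ⟨c, rfl⟩
  rw [Finset.mem_Icc] at hk
  have hc : m ≤ c := by
    by_contra hc
    exact hk' ⟨c, by omega, p, hp, mul_comm _ _⟩
  have h1 : m * p < m * Y := by
    calc m * p ≤ c * p := Nat.mul_le_mul_right _ hc
      _ = p * c := mul_comm _ _
      _ < m * Y := by omega
  exact lt_of_mul_lt_mul_left h1 (Nat.zero_le _)

/-- The program stops treating multipliers as soon as they exceed `n / Y` and half the number of
`Y`-smooth numbers up to `n`. -/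
theorem le_of_smoothCount_le {n m m₀ Y : ℕ}
    (hm : ∀ m' < m, 1 ≤ m' → 2 * m' < uncovered n m') (hm₀ : 1 ≤ m₀) (hY : n < m₀ * Y)
    (hs : smoothCount n Y ≤ 2 * m₀) : m ≤ m₀ := by
  by_contra h
  have h1 := hm m₀ (by omega) hm₀
  have h2 := uncovered_le_smoothCount hY
  omega

/-! ### Growth of the running time -/

/-- The exponent of `L(n)` as a function of `log n`. -/
noncomputable def subexpExponent (x : ℝ) : ℝ := √(x * Real.log x)

theorem subexpL_eq (n : ℕ) : subexpL n = Real.exp (subexpExponent (Real.log n)) := rfl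

theorem subexpL_rpow (n : ℕ) (s : ℝ) :
    subexpL n ^ s = Real.exp (subexpExponent (Real.log n) * s) := by
  rw [subexpL_eq, ← Real.exp_mul]

theorem eventually_rpow_mul_log_le {β c : ℝ} (hβ : β < 1 / 2) (hc : 0 < c) :
    ∀ᶠ x : ℝ in atTop, x ^ β * Real.log x ≤ c * subexpExponent x := by
  have h := (isLittleO_log_rpow_atTop (r := 1 - 2 * β) (by linarith)).bound
    (c := c ^ 2) (by positivity)
  filter_upwards [h, eventually_ge_atTop 1] with x hx h1
  have hl : 0 ≤ Real.log x := Real.log_nonneg h1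
  have hx0 : 0 < x := by linarith
  rw [Real.norm_of_nonneg hl, Real.norm_of_nonneg (Real.rpow_nonneg hx0.le _)] at hx
  rw [subexpExponent, ← Real.sqrt_sq hc.le, ← Real.sqrt_mul (sq_nonneg c)]
  refine Real.le_sqrt_of_sq_le ?_
  have h2 : (x ^ β) ^ 2 * x ^ (1 - 2 * β) = x := by
    rw [← Real.rpow_natCast, ← Real.rpow_mul hx0.le, ← Real.rpow_add hx0]
    norm_num
    rw [show β * 2 + (1 - 2 * β) = 1 by ring, Real.rpow_one]
  calc (x ^ β * Real.log x) ^ 2 = (x ^ β) ^ 2 * Real.log x * Real.log x := by ring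
    _ ≤ (x ^ β) ^ 2 * Real.log x * (c ^ 2 * x ^ (1 - 2 * β)) := by gcongr
    _ = c ^ 2 * (((x ^ β) ^ 2 * x ^ (1 - 2 * β)) * Real.log x) := by ring
    _ = c ^ 2 * (x * Real.log x) := by rw [h2]

theorem eventually_log_le_subexpExponent {c : ℝ} (hc : 0 < c) :
    ∀ᶠ x : ℝ in atTop, Real.log x ≤ c * subexpExponent x := by
  filter_upwards [eventually_rpow_mul_log_le (β := 0) (by norm_num) hc] with x hx
  simpa using hx

theorem eventually_subexpExponent_le {c : ℝ} (hc : 0 < c) :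
    ∀ᶠ x : ℝ in atTop, subexpExponent x ≤ c * x := by
  have h := (isLittleO_log_rpow_atTop (r := 1) one_pos).bound (c := c ^ 2) (by positivity)
  filter_upwards [h, eventually_ge_atTop 1] with x hx h1
  have hx0 : 0 < x := by linarith
  rw [Real.norm_of_nonneg (Real.log_nonneg h1), Real.rpow_one, Real.norm_of_nonneg hx0.le] at hx
  rw [subexpExponent]
  refine Real.sqrt_le_iff.2 ⟨by positivity, ?_⟩
  nlinarith

theorem tendsto_subexpExponent : Tendsto subexpExponent atTop atTop := by
  refine tendsto_atTop_mono' _ ?_ Real.tendsto_log_atTop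
  filter_upwards [eventually_log_le_subexpExponent one_pos] with x hx
  simpa using hx

theorem tendsto_log_natCast : Tendsto (fun n : ℕ => Real.log n) atTop atTop :=
  Real.tendsto_log_atTop.comp tendsto_natCast_atTop_atTop

/-- For `a < 1 / √2` there are at most `n / L(n) ^ a` numbers up to `n` without prime factors
`≥ L(n) ^ a`.  This is Rankin's bound with `σ = 1 - β log log n / log (L(n) ^ a)` for some `β`
between `a²` and `1 / 2`. -/
theorem eventually_smoothCount_le {a : ℝ} (ha0 : 0 < a) (ha : a < 1 / √2) :
    ∀ᶠ n : ℕ in atTop, (smoothCount n ⌈subexpL n ^ a⌉₊ : ℝ) ≤ n / subexpL n ^ a := by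
  have ha2 : a ^ 2 < 1 / 2 := by
    have h1 : a ^ 2 < (1 / √2) ^ 2 := pow_lt_pow_left₀ ha ha0.le (by norm_num)
    rwa [div_pow, Real.sq_sqrt (by norm_num), one_pow] at h1
  obtain ⟨β, hβ1, hβ2⟩ := exists_between ha2
  have hβ0 : 0 < β := (by positivity : 0 < a ^ 2).trans hβ1
  have hgap : 0 < β / a - a := by
    rw [sub_pos, lt_div_iff₀ ha0]; nlinarith
  have e1 := eventually_rpow_mul_log_le (c := (β / a - a) / 64) hβ2 (by positivity)
  have e2 := eventually_log_le_subexpExponent (c := a / (2 * β)) (by positivity)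
  have e3 := eventually_subexpExponent_le (c := 1 / (2 * a)) (by positivity)
  filter_upwards [tendsto_log_natCast.eventually e1, tendsto_log_natCast.eventually e2,
    tendsto_log_natCast.eventually e3,
    tendsto_log_natCast.eventually (Real.tendsto_log_atTop.eventually_ge_atTop 1),
    tendsto_log_natCast.eventually_ge_atTop 2,
    tendsto_log_natCast.eventually (tendsto_subexpExponent.eventually_gt_atTop 0),
    eventually_ge_atTop 1] with n h1 h2 h3 h4 h5 h6 hn
  set x := Real.log n with hx
  set R := subexpExponent x with hR
  have hn0 : (0 : ℝ) < n := by exact_mod_cast hn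
  have hnx : (n : ℝ) = Real.exp x := (Real.exp_log hn0).symm
  have hx0 : 0 < x := by linarith
  have hRR : R * R = x * Real.log x := Real.mul_self_sqrt (by positivity)
  set σ := 1 - β * Real.log x / (a * R) with hσ
  have hσ2 : 1 / 2 ≤ σ := by
    rw [hσ, le_sub_comm, div_le_iff₀ (by positivity)]
    rw [div_mul_eq_mul_div, le_div_iff₀ (by positivity)] at h2
    linarith
  have hY : subexpL n ^ a = Real.exp (R * a) := subexpL_rpow n a
  rw [hY]
  set Y := ⌈Real.exp (R * a)⌉₊ with hYdef
  refine (smoothCount_le_rankin n Y hσ2).trans ?_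
  -- the factor `p ^ (1 - σ)` is at most `(log n) ^ β` for `p ≤ L(n) ^ a`
  have hp : ∀ p ∈ Y.primesBelow, (p : ℝ) ^ (-σ) ≤ x ^ β * (p : ℝ)⁻¹ := by
    intro p hp
    have hpp := Nat.prime_of_mem_primesBelow hp
    have hp0 : (0 : ℝ) < p := by exact_mod_cast hpp.pos
    have hpY : (p : ℝ) < Real.exp (R * a) := Nat.lt_ceil.1 (Nat.lt_of_mem_primesBelow hp)
    rw [show -σ = β * Real.log x / (a * R) + (-1) by rw [hσ]; ring, Real.rpow_add hp0,
      Real.rpow_neg_one]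
    gcongr
    calc (p : ℝ) ^ (β * Real.log x / (a * R)) ≤
          Real.exp (R * a) ^ (β * Real.log x / (a * R)) :=
          Real.rpow_le_rpow hp0.le hpY.le (by positivity)
      _ = x ^ β := by
          rw [← Real.exp_mul, Real.rpow_def_of_pos hx0]
          congr 1
          field_simp
  have hYn : Y ≤ 2 ^ ⌈2 * x⌉₊ := by
    rw [hYdef, Nat.ceil_le]
    push_cast
    have hlog2 : (1 : ℝ) / 2 ≤ Real.log 2 := by linarith [Real.log_two_gt_d9]
    have hRa : R * a ≤ x := by
      calc R * a ≤ 1 / (2 * a) * x * a := by gcongr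
        _ = x / 2 := by field_simp
        _ ≤ x := by linarith
    calc Real.exp (R * a) ≤ Real.exp (Real.log 2 * ⌈2 * x⌉₊) := by
          apply Real.exp_le_exp.2
          have := Nat.le_ceil (2 * x)
          nlinarith
      _ = 2 ^ ⌈2 * x⌉₊ := by
          rw [mul_comm, Real.exp_nat_mul, Real.exp_log (by norm_num)]
  have hsum : ∑ p ∈ Y.primesBelow, (p : ℝ) ^ (-σ) ≤ x ^ β * (16 * Real.log x) := by
    calc ∑ p ∈ Y.primesBelow, (p : ℝ) ^ (-σ) ≤ ∑ p ∈ Y.primesBelow, x ^ β * (p : ℝ)⁻¹ :=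
          Finset.sum_le_sum hp
      _ = x ^ β * ∑ p ∈ Y.primesBelow, (p : ℝ)⁻¹ := by rw [Finset.mul_sum]
      _ ≤ x ^ β * ∑ p ∈ Nat.primesBelow (2 ^ ⌈2 * x⌉₊), (p : ℝ)⁻¹ := by
          gcongr
          intro p hp
          rw [Nat.mem_primesBelow] at hp ⊢
          exact ⟨hp.1.trans_le hYn, hp.2⟩
      _ ≤ x ^ β * (4 * (1 + Real.log ⌈2 * x⌉₊)) := by
          gcongr
          exact sum_primesBelow_inv_le _
      _ ≤ x ^ β * (16 * Real.log x) := by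
          refine mul_le_mul_of_nonneg_left ?_ (by positivity)
          have h7 : (⌈2 * x⌉₊ : ℝ) ≤ Real.exp 2 * x := by
            have h8 := (Nat.ceil_lt_add_one (show 0 ≤ 2 * x by linarith)).le
            have h9 : (3 : ℝ) ≤ Real.exp 2 := by linarith [Real.add_one_le_exp (2 : ℝ)]
            nlinarith
          have h8 : Real.log ⌈2 * x⌉₊ ≤ 2 + Real.log x := by
            calc Real.log ⌈2 * x⌉₊ ≤ Real.log (Real.exp 2 * x) :=
                  Real.log_le_log (by exact_mod_cast Nat.ceil_pos.2 (by linarith)) h7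
              _ = 2 + Real.log x := by
                  rw [Real.log_mul (Real.exp_ne_zero _) hx0.ne', Real.log_exp]
          linarith
  have hnσ : (n : ℝ) ^ σ = n * Real.exp (-(β / a) * R) := by
    rw [hnx, ← Real.exp_mul, ← Real.exp_add]
    congr 1
    rw [hσ]
    field_simp
    linear_combination β * hRR
  rw [hnσ, mul_assoc, ← Real.exp_add, div_eq_mul_inv _ (Real.exp (R * a)), ← Real.exp_neg]
  gcongr
  have h7 : x ^ β * Real.log x * 64 ≤ (β / a - a) * R := by
    rw [div_mul_eq_mul_div, le_div_iff₀ (by norm_num)] at h1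
    exact h1
  linarith

/-- With `Y = L(n) ^ a`, `b < a < 1 / √2`, the last multiplier is at most about `n / L(n) ^ a`; the
factor `log n` and the constants are absorbed by `L(n) ^ (a - b)`. -/
theorem eventually_time_le {T : ℕ → ℕ}
    (hT : ∀ n : ℕ, 1 ≤ n → ∃ m, 1 ≤ m ∧ (∀ m' < m, 1 ≤ m' → 2 * m' < uncovered n m') ∧
      T n ≤ 60 * (n * (n.sqrt + 1)) + 3000 * (m * (n * ⌈1 + Real.log n⌉₊)))
    {b : ℝ} (hb0 : 0 < b) (hb : b < 1 / √2) :
    ∀ᶠ n : ℕ in atTop, (T n : ℝ) + 1 ≤ n ^ 2 / subexpL n ^ b := by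
  obtain ⟨a, hba, ha⟩ := exists_between hb
  have ha0 : 0 < a := hb0.trans hba
  have hba0 : 0 < a - b := sub_pos.2 hba
  have e2 := eventually_log_le_subexpExponent (c := (a - b) / 2) (by positivity)
  have e3 := eventually_subexpExponent_le (c := 1 / (4 * a)) (by positivity)
  filter_upwards [eventually_smoothCount_le ha0 ha, tendsto_log_natCast.eventually e2,
    tendsto_log_natCast.eventually e3,
    tendsto_log_natCast.eventually (tendsto_subexpExponent.eventually_ge_atTop
      (2 * Real.log 36000 / (a - b))),
    tendsto_log_natCast.eventually_ge_atTop 4,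
    tendsto_log_natCast.eventually_ge_atTop (4 * Real.log 500),
    eventually_ge_atTop 1] with n h1 h2 h3 h4 h5 h6 hn
  set x := Real.log n with hx
  set R := subexpExponent x with hR
  have hn0 : (0 : ℝ) < n := by exact_mod_cast hn
  have hnx : (n : ℝ) = Real.exp x := (Real.exp_log hn0).symm
  have hR0 : 0 ≤ R := Real.sqrt_nonneg _
  have hx0 : 0 < x := by linarith
  rw [subexpL_rpow, ← hx, ← hR] at h1 ⊢
  obtain ⟨m, hm1, hm, hTn⟩ := hT n hn
  have hRa : R * a ≤ x / 4 := by
    calc R * a ≤ 1 / (4 * a) * x * a := by gcongr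
      _ = x / 4 := by field_simp
  set q : ℝ := n / Real.exp (R * a) with hq
  have hq0 : 0 < q := by positivity
  have hq1 : 1 ≤ q := by
    rw [hq, one_le_div (Real.exp_pos _), hnx]
    exact Real.exp_le_exp.2 (by linarith)
  have hmq : (m : ℝ) ≤ 2 * q := by
    have hle : m ≤ ⌊q⌋₊ + 1 := by
      refine le_of_smoothCount_le (Y := ⌈Real.exp (R * a)⌉₊) hm (by omega) ?_ ?_
      · have h7 : q < ⌊q⌋₊ + 1 := Nat.lt_floor_add_one q
        have h8 := Nat.le_ceil (Real.exp (R * a))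
        have h9 : (n : ℝ) < ((⌊q⌋₊ + 1 : ℕ) : ℝ) * (⌈Real.exp (R * a)⌉₊ : ℕ) := by
          calc (n : ℝ) = q * Real.exp (R * a) := by rw [hq]; field_simp
            _ < (⌊q⌋₊ + 1) * Real.exp (R * a) := by gcongr
            _ ≤ _ := by push_cast; gcongr
        exact_mod_cast h9
      · have h7 : smoothCount n ⌈Real.exp (R * a)⌉₊ ≤ ⌊q⌋₊ := Nat.le_floor h1
        omega
    have h7 : (m : ℝ) ≤ ⌊q⌋₊ + 1 := by exact_mod_cast hle
    have h8 := Nat.floor_le hq0.le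
    linarith
  have hH : (⌈1 + x⌉₊ : ℝ) ≤ 3 * x := by
    have := (Nat.ceil_lt_add_one (show 0 ≤ 1 + x by linarith)).le
    linarith
  have hsq : ((n.sqrt : ℕ) : ℝ) + 1 ≤ 2 * Real.exp (x / 2) := by
    have h7 : ((n.sqrt : ℕ) : ℝ) ≤ Real.exp (x / 2) := by
      have h8 : ((n.sqrt : ℕ) : ℝ) * n.sqrt ≤ n := by exact_mod_cast Nat.sqrt_le n
      have h9 : (n : ℝ) = Real.exp (x / 2) * Real.exp (x / 2) := by
        rw [← Real.exp_add, hnx]; congr 1; ring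
      rw [h9] at h8
      exact abs_le_of_sq_le_sq' (by nlinarith) (Real.exp_pos _).le |>.2
    have h8 : 1 ≤ Real.exp (x / 2) := Real.one_le_exp (by linarith)
    linarith
  have hT1 : (T n : ℝ) ≤ 60 * (n * (2 * Real.exp (x / 2))) + 3000 * (2 * q * (n * (3 * x))) := by
    calc (T n : ℝ) ≤ 60 * (n * ((n.sqrt : ℕ) + 1)) + 3000 * (m * (n * ⌈1 + x⌉₊)) := by
          exact_mod_cast hTn
      _ ≤ _ := by gcongr
  -- the two contributions to the bound for the running time
  have hA : 60 * (n * (2 * Real.exp (x / 2))) + 1 ≤ n ^ 2 / Real.exp (R * b) / 2 := by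
    have h8 : R * b ≤ x / 4 := le_trans (by gcongr) hRa
    have h9 : 1 ≤ Real.exp (x / 2) := Real.one_le_exp (by linarith)
    have h10 : (1 : ℝ) ≤ n := by exact_mod_cast hn
    have h11 : 500 ≤ Real.exp (x / 4) := by
      rw [← Real.exp_log (show (0 : ℝ) < 500 by norm_num)]
      exact Real.exp_le_exp.2 (by linarith)
    have h12 : (n : ℝ) = Real.exp (x / 2) * Real.exp (x / 4) * Real.exp (x / 4) := by
      rw [← Real.exp_add, ← Real.exp_add, hnx]; congr 1; ring
    have h13 : Real.exp (R * b) ≤ Real.exp (x / 4) := Real.exp_le_exp.2 h8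
    rw [div_div, le_div_iff₀ (by positivity)]
    calc (60 * (n * (2 * Real.exp (x / 2))) + 1) * (Real.exp (R * b) * 2)
        ≤ (60 * (n * (2 * Real.exp (x / 2))) + n * Real.exp (x / 2)) *
            (Real.exp (x / 4) * 2) := by
          gcongr
          nlinarith
      _ = n * (Real.exp (x / 2) * Real.exp (x / 4)) * 242 := by ring
      _ ≤ n * (Real.exp (x / 2) * Real.exp (x / 4)) * Real.exp (x / 4) := by
          gcongr; linarith
      _ = n ^ 2 := by rw [sq]; nth_rw 3 [h12]; ring
  have hB : 3000 * (2 * q * (n * (3 * x))) ≤ n ^ 2 / Real.exp (R * b) / 2 := by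
    have h8 : 36000 * x ≤ Real.exp (R * (a - b)) := by
      have h9 : Real.log 36000 ≤ (a - b) / 2 * R := by
        rw [div_le_iff₀ hba0] at h4
        linarith
      calc 36000 * x = Real.exp (Real.log 36000 + Real.log x) := by
            rw [Real.exp_add, Real.exp_log (by norm_num), Real.exp_log hx0]
        _ ≤ Real.exp (R * (a - b)) := Real.exp_le_exp.2 (by linarith)
    have h9 : Real.exp (R * a) = Real.exp (R * b) * Real.exp (R * (a - b)) := by
      rw [← Real.exp_add]; congr 1; ring
    have h10 : 3000 * (2 * q * (n * (3 * x))) =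
        n ^ 2 / Real.exp (R * b) / 2 * (36000 * x / Real.exp (R * (a - b))) := by
      rw [hq, h9]; field_simp; ring
    rw [h10]
    refine mul_le_of_le_one_right (by positivity) ?_
    rwa [div_le_one (Real.exp_pos _)]
  linarith

/-- A bound by `n² / L(n) ^ b` for each `b < B` amounts to a bound by `n² / L(n) ^ (B + o(1))`. -/
theorem exists_exponent {T : ℕ → ℕ} {B : ℝ} (hB : 0 < B)
    (h : ∀ b, 0 < b → b < B → ∀ᶠ n : ℕ in atTop, (T n : ℝ) + 1 ≤ n ^ 2 / subexpL n ^ b) :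
    ∃ ε : ℕ → ℝ, Tendsto ε atTop (𝓝 0) ∧
      (fun n : ℕ => (T n : ℝ)) =O[atTop] fun n : ℕ => (n : ℝ) ^ 2 / subexpL n ^ (B + ε n) := by
  set R : ℕ → ℝ := fun n => subexpExponent (Real.log n) with hR
  have hRpos : ∀ᶠ n in atTop, 0 < R n :=
    tendsto_log_natCast.eventually (tendsto_subexpExponent.eventually_gt_atTop 0)
  -- the minimum with `0` makes a lower bound for the running time unnecessary
  refine ⟨fun n => min 0 (Real.log (n ^ 2 / (T n + 1)) / R n - B), ?_, ?_⟩
  · rw [tendsto_order]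
    refine ⟨fun c hc => ?_, fun c hc => Eventually.of_forall fun n => (min_le_left _ _).trans_lt hc⟩
    obtain ⟨b, hb1, hb2⟩ := exists_between (max_lt hB (by linarith : B + c < B))
    have hb0 := (le_max_left _ _).trans_lt hb1
    have hbc := (le_max_right _ _).trans_lt hb1
    filter_upwards [h b hb0 hb2, hRpos, eventually_ge_atTop 1] with n h1 h2 hn
    refine lt_min hc ?_
    have hn0 : (0 : ℝ) < n := by exact_mod_cast hn
    rw [subexpL_rpow, le_div_iff₀ (Real.exp_pos _)] at h1
    have h3 : Real.exp (R n * b) ≤ n ^ 2 / (T n + 1) := by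
      rw [le_div_iff₀ (by positivity)]; linarith
    have h4 : R n * b ≤ Real.log (n ^ 2 / (T n + 1)) := by
      rwa [Real.le_log_iff_exp_le (by positivity)]
    have h5 : b ≤ Real.log (n ^ 2 / (T n + 1)) / R n := by
      rw [le_div_iff₀ h2]; linarith
    linarith
  · refine IsBigO.of_bound 1 ?_
    filter_upwards [hRpos, eventually_ge_atTop 1] with n h2 hn
    have hn0 : (0 : ℝ) < n := by exact_mod_cast hn
    rw [subexpL_rpow, Real.norm_of_nonneg (by positivity), Real.norm_of_nonneg (by positivity),
      one_mul, le_div_iff₀ (Real.exp_pos _)]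
    have h3 : R n * (B + min 0 (Real.log (n ^ 2 / (T n + 1)) / R n - B)) ≤
        Real.log (n ^ 2 / (T n + 1)) := by
      calc R n * (B + min 0 (Real.log (n ^ 2 / (T n + 1)) / R n - B)) ≤
            R n * (B + (Real.log (n ^ 2 / (T n + 1)) / R n - B)) := by
            gcongr; exact min_le_right _ _
        _ = _ := by field_simp; ring
    have h4 := (Real.le_log_iff_exp_le (by positivity)).1 h3
    calc (T n : ℝ) * Real.exp (R n * (B + min 0 (Real.log (n ^ 2 / (T n + 1)) / R n - B))) ≤
          (T n + 1) * (n ^ 2 / (T n + 1)) := by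
          gcongr; linarith
      _ = n ^ 2 := by field_simp

theorem word_size_bound {n : ℕ} (hn : 1 ≤ n) : (n + 1) * (n + 1) < 2 ^ (4 * Nat.size n) := by
  have h1 : n + 1 ≤ 2 ^ Nat.size n := Nat.lt_size_self n
  have h2 : 0 < Nat.size n := Nat.size_pos.2 hn
  calc (n + 1) * (n + 1) ≤ 2 ^ Nat.size n * 2 ^ Nat.size n := Nat.mul_le_mul h1 h1
    _ = 2 ^ (Nat.size n + Nat.size n) := by rw [pow_add]
    _ < 2 ^ (4 * Nat.size n) := Nat.pow_lt_pow_right (by norm_num) (by omega)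

theorem harmonicMul_le_mul_ceil {n m : ℕ} (hmn : m ≤ n) :
    harmonicMul m ≤ m * ⌈1 + Real.log n⌉₊ := by
  rcases Nat.eq_zero_or_pos m with rfl | hm
  · simp [harmonicMul]
  · have h1 : Real.log m ≤ Real.log n :=
      Real.log_le_log (by exact_mod_cast hm) (by exact_mod_cast hmn)
    have h2 : (harmonicMul m : ℝ) ≤ m * (⌈1 + Real.log n⌉₊ : ℕ) :=
      (harmonicMul_le m).trans
        (mul_le_mul_of_nonneg_left ((by linarith : _ ≤ _).trans (Nat.le_ceil _)) (by positivity))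
    exact_mod_cast h2

/-- There are a program `P` and a word size `c · (bit length of n) = Θ(log n)` such that, on each
input `n ≥ 1`, `P` tabulates `M(k)` for all `k ≤ n` through calls of the two algorithms, in time
`T(n) = O(n² / L(n) ^ (1/√2 + o(1)))`. -/
theorem mainTheorem1 :
    ∃ (P : Cmd) (c : ℕ) (T : ℕ → ℕ) (ε : ℕ → ℝ),
      0 < c ∧
      (∀ n : ℕ, 1 ≤ n → Tabulates P (c * Nat.size n) n (T n)) ∧
      Tendsto ε atTop (𝓝 0) ∧
      (fun n : ℕ => (T n : ℝ)) =O[atTop]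
        fun n : ℕ => (n : ℝ) ^ 2 / subexpL n ^ (1 / Real.sqrt 2 + ε n) := by
  have h : ∀ n : ℕ, ∃ t m : ℕ, 1 ≤ n → 1 ≤ m ∧ (∀ m' < m, 1 ≤ m' → 2 * m' < uncovered n m') ∧
      t ≤ 60 * (n * (n.sqrt + 1)) + 3000 * (m * (n * ⌈1 + Real.log n⌉₊)) ∧
      Tabulates tabulation (4 * Nat.size n) n t := by
    intro n
    by_cases hn : 1 ≤ n
    · obtain ⟨m, h1, h2, t, h3, h4⟩ :=
        tabulates hn (word_size_bound hn) (fun m hm => harmonicMul_le_mul_ceil hm)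
      exact ⟨t, m, fun _ => ⟨h1, h2, h3, h4⟩⟩
    · exact ⟨0, 0, fun h => absurd h hn⟩
  choose T m h using h
  obtain ⟨ε, hε, hO⟩ := exists_exponent (T := T) (B := 1 / √2) (by positivity)
    fun b hb0 hb => eventually_time_le
      (fun n hn => ⟨m n, (h n hn).1, (h n hn).2.1, (h n hn).2.2.1⟩) hb0 hb
  exact ⟨tabulation, 4, T, ε, by norm_num, fun n hn => (h n hn).2.2.2, hε, hO⟩
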